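/- Write $\mathfrak M(0,\infty)$ for the finite Borel measures on $(0,\infty)$ with the topology of weak convergence; identify $\mu\in\mathfrak M(0,\infty)$ with its distribution function $\mu(x)=\mu((0,x])$ (so that $\mathfrak M(0,\infty)$ is identified with the set $\mathfrak D(0,\infty)$ of bounded, nonnegative, right-continuous, increasing functions on $\mathbb R$ vanishing on $(-\infty,0]$), and put $\mu(\infty)=\mu((0,\infty))$ and $\langle\mu,f\rangle=\int_{(0,\infty)}f\,d\mu$. Let $C^1(0,\infty)^+$ be the set of nonnegative bounded continuous functions on $(0,\infty)$ with bounded continuous derivative. Functions on $(0,\infty)$ are extended by $0$ to $[-\infty,\infty]\setminus(0,\infty)$. Let $\alpha\in C^1(0,\infty)^+$, and for each $x>0$ let $\{p(x,i):i\in\mathbb N\}$, $\mathbb N=\{0,1,2,\dots\}$, be a probability distribution with $p(\cdot,i)\in C^1(0,\infty)^+$ for every $i$ and $\sup_{x>0}\sum_{i}i\,p(x,i)<\infty$. Put $\beta=\sup_{x>0}\alpha(x)\sum_i i\,p(x,i)$. Let $G$ be a Borel probability measure on $(0,\infty)$. For a finite measure $\mu$ on $[0,\infty)$ and $0\le y\le1$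 let $$A_\alpha(\mu,y)=\inf\{z\ge0:\langle\mu,\alpha1_{(0,z]}\rangle>\langle\mu,\alpha\rangle y\},\qquad \inf\emptyset=\infty .$$ Let $(\Omega,\mathscr F,(\mathscr F_t)_{t\ge0},\mathbf P)$ be a filtered probability space satisfying the usual hypotheses, let $E=(0,1]\times\mathbb N\times(0,\infty)^{\infty}$ with points $w=(y,n,z)$, $z=(z_1,z_2,\dots)$, and let $M(ds,du,dw,dv)$ be an $(\mathscr F_t)$-Poisson random measure on $(0,\infty)^2\times E\times(0,1]$ with intensity $ds\,du\,K(dw)\,dv$, where $K(dw)=dy\,\pi(dn)\,G^{\infty}(dz)$, $\pi$ is the counting measure on $\mathbb N$ and $G^\infty$ the infinite product measure. Let $X_0$ be an $\mathscr F_0$-measurable random element of $\mathfrak M(0,\infty)$. Consider the equation $$X_t(x)=X_0(x+t)-X_0(t)+\int_0^t\!\int_0^{\langle X_{s-},\alpha\rangle}\!\int_E\int_0^{p(A_\alpha(X_{s-},y),n)}\sum_{i=1}^n1_{\{0<z_i-(t-s)\le x\}}\,M(ds,du,dw,dv),\qquad x>0. \tag{$*$}$$ For a stopping time $\zeta$ with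 values in $[0,\infty]$, a solution with lifetime $\zeta$ is an $(\mathscr F_t)$-adapted $\mathfrak M(0,\infty)$-valued process $X$ such that almost surely $t\mapsto X_t$ is càdlàg on $[0,\zeta)$ (left limits $X_{s-}$ being taken in the sense of weak convergence of finite measures on $[0,\infty)$, so that they may charge $0$) and $(*)$ holds for all $t\in[0,\zeta)$ and $x>0$. It is a strong solution if it is adapted to the $\mathbf P$-completed filtration generated by $X_0$ and $M$, i.e. $X_t$ is measurable with respect to the $\sigma$-algebra generated by $X_0$, by $M$ restricted to times $\le t$, and by the $\mathbf P$-null sets. Then: 1. There is a strong solution $X$ of $(*)$ with lifetime $\zeta=\infty$. Almost surely, for every $t\ge0$ only finitely many points $(s,u,(y,n,z),v)$ of $M$ satisfy $0<s\le t$, $u\le\langle X_{s-},\alpha\rangle$ and $v\le p(A_\alpha(X_{s-},y),n)$. Moreover, for all $t\ge0$, $$\mathbf E\Big[\sup_{0\le s\le t}X_s(\infty)\Big]\le\mathbf E[X_0(\infty)]\,e^{\beta t}$$ (the bound being trivial when $\mathbf E[X_0(\infty)]=\infty$). 2. Pathwise uniqueness holds: if $X$ and $Y$ are solutions of $(*)$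 with lifetimes $\zeta$ and $\eta$ (with the same $\mathscr F_t$, $M$ and $X_0$), then almost surely $X_t=Y_t$ for all $t<\zeta\wedge\eta$. -/

import Mathlib

open MeasureTheory ProbabilityTheory Set Filter Topology
open scoped NNReal ENNReal

noncomputable section

namespace AgeBranching

/-- `𝔐(0,∞)`: the finite Borel measures on `(0,∞)`, realised as the finite Borel measures on `ℝ`
that do not charge `(-∞,0]`. The subspace topology is that of weak convergence on `(0,∞)`. A measure
is identified with its distribution function, see `distrib`. -/
abbrev LifeMeasure : Type := {μ : FiniteMeasure ℝ // μ (Iic 0) = 0}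

/-- The distribution function `μ(x) = μ((0,x])`, which vanishes for `x ≤ 0`. -/
def distrib (μ : LifeMeasure) (x : ℝ) : ℝ≥0∞ := (μ.1 : Measure ℝ) (Ioc 0 x)

/-- The total mass `μ(∞)`. -/
def totalMass (μ : LifeMeasure) : ℝ≥0∞ := (μ.1 : Measure ℝ) univ

/-- `⟨ν,f⟩`, the integral of `f` over `(0,∞)`. It is also applied to left limits in time of paths
with values in `𝔐(0,∞)`; these may carry mass at `0` (particles that die at that very time), which
does not contribute. -/
def pairing (ν : FiniteMeasure ℝ) (f : ℝ → ℝ) : ℝ := ∫ x in Ioi 0, f x ∂(ν : Measure ℝ)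

/-- `A_α(ν,y) = inf {z ≥ 0 : ⟨ν, α 1_{(0,z]}⟩ > ⟨ν,α⟩ y}` in `[0,∞]`, with `inf ∅ = ∞`. -/
def parentLife (α : ℝ → ℝ) (ν : FiniteMeasure ℝ) (y : ℝ) : ℝ≥0∞ :=
  ⨅ (z : ℝ≥0) (_ : pairing ν α * y < pairing ν ((Ioc 0 (z : ℝ)).indicator α)), (z : ℝ≥0∞)

/-- `p(a,n)` for `a ∈ [0,∞]`, extended by zero outside `(0,∞)`. -/
def offspringProb (p : ℝ → ℕ → ℝ) (a : ℝ≥0∞) (n : ℕ) : ℝ :=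
  if 0 < a ∧ a < ⊤ then p a.toReal n else 0

/-- The class `C¹(0,∞)⁺` of nonnegative bounded continuous functions on `(0,∞)` with bounded
continuous derivative. -/
structure IsC1Plus (f : ℝ → ℝ) : Prop where
  contDiffOn : ContDiffOn ℝ 1 f (Ioi 0)
  nonneg : ∀ x, 0 < x → 0 ≤ f x
  bounded : ∃ C, ∀ x, 0 < x → f x ≤ C
  deriv_bounded : ∃ C, ∀ x, 0 < x → |deriv f x| ≤ C

/-- The mean offspring number `g'(x,1-) = ∑ i, i p(x,i)`. -/
def offspringMean (p : ℝ → ℕ → ℝ) (x : ℝ) : ℝ≥0∞ :=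
  ∑' i : ℕ, (i : ℝ≥0∞) * ENNReal.ofReal (p x i)

/-- The assumptions on the birth rate `α` and on the offspring laws `p(x,·)`. -/
structure IsBranchingMechanism (α : ℝ → ℝ) (p : ℝ → ℕ → ℝ) : Prop where
  rate : IsC1Plus α
  prob : ∀ i, IsC1Plus fun x => p x i
  prob_sum : ∀ x, 0 < x → HasSum (p x) 1
  mean_bounded : (⨆ x ∈ Ioi (0 : ℝ), offspringMean p x) < ⊤

/-- `β = ‖α g'(·,1-)‖`. -/
def growthRate (α : ℝ → ℝ) (p : ℝ → ℕ → ℝ) : ℝ≥0∞ :=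
  ⨆ x ∈ Ioi (0 : ℝ), ENNReal.ofReal (α x) * offspringMean p x

/-- Points `w = (y,n,z)` of `E = (0,1] × ℕ × (0,∞)^∞`; the constraints are carried by
`markMeasure`, and the coordinates `z_1, z_2, …` are indexed from `0`. -/
abbrev Mark : Type := ℝ × ℕ × (ℕ → ℝ)

/-- Points `(s,u,w,v)` of `(0,∞)² × E × (0,1]`; the constraints are carried by `intensity`. -/
abbrev NoisePoint : Type := ℝ × ℝ × Mark × ℝ

/-- `K(dw) = dy π(dn) G^∞(dz)`, with `π` the counting measure. -/
def markMeasure (G : Measure ℝ) [IsProbabilityMeasure G] : Measure Mark :=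
  (volume.restrict (Ioc (0 : ℝ) 1)).prod
    ((Measure.count : Measure ℕ).prod (Measure.infinitePi fun _ : ℕ => G))

/-- The intensity `ds du K(dw) dv` on `(0,∞)² × E × (0,1]`. -/
def intensity (G : Measure ℝ) [IsProbabilityMeasure G] : Measure NoisePoint :=
  (volume.restrict (Ioi (0 : ℝ))).prod
    ((volume.restrict (Ioi (0 : ℝ))).prod
      ((markMeasure G).prod (volume.restrict (Ioc (0 : ℝ) 1))))

/-- The σ-algebra generated by the noise at times in `I`. -/
@[reducible] def noiseSigma {Ω : Type*} (M : Ω → Measure NoisePoint) (I : Set ℝ) : MeasurableSpace Ω :=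
  ⨆ (B : Set NoisePoint) (_ : MeasurableSet B ∧ B ⊆ {q | q.1 ∈ I}),
    MeasurableSpace.comap (fun ω => M ω B) inferInstance

/-- The usual hypotheses: the filtration is right-continuous and its initial σ-algebra contains all
subsets of null sets. -/
structure UsualHypotheses {Ω : Type*} {mΩ : MeasurableSpace Ω} (P : Measure Ω)
    (F : Filtration ℝ≥0 mΩ) : Prop where
  rightCont : F.IsRightContinuous
  complete : ∀ N : Set Ω, P N = 0 → MeasurableSet[F 0] N

/-- `M` is an `(F_t)`-Poisson random measure with intensity `Λ`; the first coordinate is time. -/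
structure IsPoissonRandomMeasure {Ω : Type*} {mΩ : MeasurableSpace Ω} (P : Measure Ω)
    (F : Filtration ℝ≥0 mΩ) (Λ : Measure NoisePoint) (M : Ω → Measure NoisePoint) : Prop where
  measurable : Measurable M
  integer_valued : ∀ ω B, MeasurableSet B → ∃ k : ℕ∞, M ω B = (k : ℝ≥0∞)
  law : ∀ B, MeasurableSet B → Λ B < ⊤ →
    P.map (fun ω => M ω B) = (poissonMeasure (Λ B).toNNReal).map (fun k : ℕ => (k : ℝ≥0∞))
  indep : ∀ (n : ℕ) (B : Fin n → Set NoisePoint), (∀ i, MeasurableSet (B i)) →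
    Pairwise (Function.onFun Disjoint B) → iIndepFun (fun i ω => M ω (B i)) P
  adapted : ∀ t : ℝ≥0, noiseSigma M (Iic (t : ℝ)) ≤ F t
  indep_past : ∀ t : ℝ≥0, Indep (noiseSigma M (Ioi (t : ℝ))) (F t) P

/-- `X_{s-}`, the left limit of a path in the space of finite measures on `ℝ` with the topology of
weak convergence. -/
def leftLimit (X : ℝ≥0 → LifeMeasure) (s : ℝ≥0) : FiniteMeasure ℝ :=
  Function.leftLim (fun r => (X r).1) s

/-- The points `(s,u,(y,n,z),v)` with `0 < s ≤ t`, `0 < u ≤ ⟨X_{s-},α⟩` and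
`0 < v ≤ p(A_α(X_{s-},y),n)`: the domain of integration up to time `t`, i.e. the reproduction events
of the path `X`. -/
def birthEvents (α : ℝ → ℝ) (p : ℝ → ℕ → ℝ) (X : ℝ≥0 → LifeMeasure) (t : ℝ≥0) :
    Set NoisePoint :=
  {q | q.1 ∈ Ioc 0 (t : ℝ) ∧
    q.2.1 ∈ Ioc 0 (pairing (leftLimit X q.1.toNNReal) α) ∧
    q.2.2.2 ∈ Ioc 0
      (offspringProb p (parentLife α (leftLimit X q.1.toNNReal) q.2.2.1.1) q.2.2.1.2.1)}

/-- `∑_{i=1}^n 1_{0 < z_i - (t-s) ≤ x}` for the point `(s,u,(y,n,z),v)`. -/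
def aliveOffspring (t : ℝ≥0) (x : ℝ) (q : NoisePoint) : ℝ≥0∞ :=
  ∑ i ∈ Finset.range q.2.2.1.2.1, (Ioc 0 x).indicator 1 (q.2.2.1.2.2 i - ((t : ℝ) - q.1))

/-- The stochastic integral equation at time `t` for one realisation `N` of the noise, one initial
value `μ` and one path `X`:
`X_t(x) = μ(x+t) - μ(t) + ∫ ∑_{i=1}^n 1_{0 < z_i - (t-s) ≤ x} N(ds,du,dw,dv)` for all `x > 0`,
the integral being over `birthEvents`. It is an identity in `[0,∞]` whose left side is finite. -/
def SolvesAt (α : ℝ → ℝ) (p : ℝ → ℕ → ℝ) (N : Measure NoisePoint) (μ : LifeMeasure)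
    (X : ℝ≥0 → LifeMeasure) (t : ℝ≥0) : Prop :=
  ∀ x : ℝ, 0 < x →
    distrib (X t) x = (distrib μ (x + t) - distrib μ t) +
      ∫⁻ q, (birthEvents α p X t).indicator (aliveOffspring t x) q ∂N

/-- The path is right-continuous at `t` and has a left limit at `t`. The left limit is taken
among finite measures on `ℝ`, because it has mass at `0` when particles die at time `t`. -/
def CadlagAt (X : ℝ≥0 → LifeMeasure) (t : ℝ≥0) : Prop :=
  ContinuousWithinAt X (Ici t) t ∧
    ∃ ν : FiniteMeasure ℝ, Tendsto (fun r => (X r).1) (𝓝[<] t) (𝓝 ν)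

/-- `X` is an `(F_t)`-adapted càdlàg solution on the random time interval `[0,ζ)`, where the
lifetime `ζ` is a stopping time with values in `[0,∞]`. The values of `X` from time `ζ` on are
irrelevant. -/
structure IsSolution {Ω : Type*} {mΩ : MeasurableSpace Ω} (P : Measure Ω)
    (F : Filtration ℝ≥0 mΩ) (α : ℝ → ℝ) (p : ℝ → ℕ → ℝ) (M : Ω → Measure NoisePoint)
    (X₀ : Ω → LifeMeasure) (X : ℝ≥0 → Ω → LifeMeasure) (ζ : Ω → WithTop ℝ≥0) : Prop where
  lifetime : IsStoppingTime F ζ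
  adapted : ∀ t, Measurable[F t] (X t)
  cadlag : ∀ᵐ ω ∂P, ∀ t : ℝ≥0, (t : WithTop ℝ≥0) < ζ ω → CadlagAt (fun r => X r ω) t
  equation : ∀ᵐ ω ∂P, ∀ t : ℝ≥0, (t : WithTop ℝ≥0) < ζ ω →
    SolvesAt α p (M ω) (X₀ ω) (fun r => X r ω) t

/-- The σ-algebra generated by the initial value, the noise up to time `t` and the null sets. -/
@[reducible] def drivingSigma {Ω : Type*} {mΩ : MeasurableSpace Ω} (P : Measure Ω)
    (M : Ω → Measure NoisePoint) (X₀ : Ω → LifeMeasure) (t : ℝ≥0) : MeasurableSpace Ω :=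
  MeasurableSpace.comap X₀ inferInstance ⊔ noiseSigma M (Iic (t : ℝ)) ⊔
    MeasurableSpace.generateFrom {N | P N = 0}

/-- A strong solution is one adapted to the completed filtration generated by the initial value and
the noise. -/
structure IsStrongSolution {Ω : Type*} {mΩ : MeasurableSpace Ω} (P : Measure Ω)
    (F : Filtration ℝ≥0 mΩ) (α : ℝ → ℝ) (p : ℝ → ℕ → ℝ) (M : Ω → Measure NoisePoint)
    (X₀ : Ω → LifeMeasure) (X : ℝ≥0 → Ω → LifeMeasure) (ζ : Ω → WithTop ℝ≥0) : Prop
    extends IsSolution P F α p M X₀ X ζ where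
  strong : ∀ t, Measurable[drivingSigma P M X₀ t] (X t)

end AgeBranching

end

noncomputable section

namespace AgeBranching

/-! A path decides, through its left limits, which points of the noise are reproduction events, and
(*) says that the path is the residual-life distribution of the population formed by the initial
individuals and the children born at these events. So (*) is a fixed-point problem: path to event
set to path. The events up to time `t` depend only on the path before `t`, and when the event set is
prescribed the right side is an explicit càdlàg path (`residualLives_birthMeasure_Ioc`).

The probabilistic estimates all come from the compensation formula: the noise and its intensity give
predictable sets the same expected mass. Since `A_α(ν,·)` carries the uniform law to the
normalisation of `α dν` (`map_parentLife`), events weighted by `f(n)` occur in a population `ν` at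
rate at most `b ν(ℝ)` when `α(x) ∑ f(n) p(x,n) ≤ b` (`lintegral_reproduces_le`). Taking `f = 1`
counts events, with `b` a bound for `α`; taking `f(n) = n` counts children, with `b = β`.

Uniqueness: along an adapted path only finitely many events occur in bounded time in populations of
mass at most `k`. Let `T` be the infimum of the times at which two solutions differ. They have the
same events up to `T`, hence agree at `T`; their masses stay bounded shortly after `T`, and since
the noise is integer valued there is a short interval without events, on which they still agree
(`eq_of_produces`).

Existence: forbid reproduction while the mass exceeds `K` and iterate. Two successive iterates
differ before `t` only if the noise hits the symmetric difference of the event sets of their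
predecessors, so the probability that the iteration has not settled after `j` steps is at most
`(2bKt)^j / j!`. Almost surely the iterates become constant on `[0,t]`, not merely convergent. To
remove `K`, the initial mass plus all births is bounded in mean by Gronwall, uniformly in `K`, on
each event `{X₀(∞) ≤ m}`. Hence almost surely some level `K` is not exceeded up to `t`, and by
uniqueness all higher levels give the same path. The progeny dominates the running supremum of the
mass, so Fatou yields the moment bound. Carrying this out in the completed filtration generated by
`X₀` and `M` makes the solution strong. -/

/-! ### Finite measures on the half-line and measurable versions of weak limits. -/

theorem Iic_sdiff_Iic_eq (a b : ℝ) : Iic b \ Iic a = Ioc a b := by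
  ext x
  simp [and_comm]

theorem ennreal_limsup_add_le (u v : ℕ → ℝ≥0∞) :
    limsup (u + v) atTop ≤ limsup u atTop + limsup v atTop := by
  refine ENNReal.le_of_forall_pos_le_add fun ε hε hfin => ?_
  have hε2 : ((ε / 2 : ℝ≥0) : ℝ≥0∞) ≠ 0 := by
    simpa using hε.ne'
  have hu : limsup u atTop ≠ ⊤ := (ENNReal.add_lt_top.1 hfin).1.ne
  have hv : limsup v atTop ≠ ⊤ := (ENNReal.add_lt_top.1 hfin).2.ne
  have h1 := eventually_lt_of_limsup_lt (ENNReal.lt_add_right hu hε2)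
  have h2 := eventually_lt_of_limsup_lt (ENNReal.lt_add_right hv hε2)
  refine limsup_le_of_le (h := ?_)
  filter_upwards [h1, h2] with n hn hn'
  calc u n + v n ≤ (limsup u atTop + (ε / 2 : ℝ≥0)) + (limsup v atTop + (ε / 2 : ℝ≥0)) :=
        add_le_add hn.le hn'.le
    _ = limsup u atTop + limsup v atTop + ((ε / 2 : ℝ≥0) + (ε / 2 : ℝ≥0) : ℝ≥0) := by
        push_cast; ring
    _ = _ := by rw [add_halves]

/-- No mass lies on `(-∞,0]`, so half-open intervals are measured by differences of the distribution
function. This turns the equation, an identity of distribution functions, into an identity of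
states. -/
theorem distrib_ext {μ ν : LifeMeasure} (h : ∀ x, 0 < x → distrib μ x = distrib ν x) : μ = ν := by
  have key : ∀ (ρ : LifeMeasure) (a b : ℝ),
      (ρ.1 : Measure ℝ) (Ioc a b) = distrib ρ b - distrib ρ a := by
    intro ρ a b
    have h0 : (ρ.1 : Measure ℝ) (Iic 0) = 0 := by
      have := ρ.2
      rwa [FiniteMeasure.null_iff_toMeasure_null] at this
    have hz : ∀ x : ℝ, distrib ρ x = (ρ.1 : Measure ℝ) (Iic x) := by
      intro x
      refine le_antisymm (measure_mono Ioc_subset_Iic_self) ?_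
      calc (ρ.1 : Measure ℝ) (Iic x) ≤ (ρ.1 : Measure ℝ) (Iic 0 ∪ Ioc 0 x) := by
            apply measure_mono
            intro y hy
            rcases le_or_gt y 0 with h | h
            · exact Or.inl h
            · exact Or.inr ⟨h, hy⟩
        _ ≤ _ := (measure_union_le _ _)
        _ = distrib ρ x := by rw [h0, zero_add]; rfl
    rw [hz, hz]
    rcases le_total a b with hab | hab
    · rw [← Iic_sdiff_Iic_eq a b, measure_sdiff (Iic_subset_Iic.2 hab)
        measurableSet_Iic.nullMeasurableSet (measure_ne_top _ _)]
    · rw [Ioc_eq_empty (not_lt.2 hab), measure_empty, tsub_eq_zero_of_le]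
      exact measure_mono (Iic_subset_Iic.2 hab)
  have hall : ∀ x, distrib μ x = distrib ν x := by
    intro x
    rcases le_or_gt x 0 with hx | hx
    · simp [distrib, Ioc_eq_empty (not_lt.2 hx)]
    · exact h x hx
  apply Subtype.ext
  apply Subtype.ext
  change (μ.1 : Measure ℝ) = (ν.1 : Measure ℝ)
  refine Measure.ext_of_Ioc _ _ fun a b _ => ?_
  rw [key, key, hall, hall]

/-- The upper limit of the distribution functions of a sequence of finite measures, set to zero if
the total masses are unbounded. -/
def limsupDistrib (ν : ℕ → FiniteMeasure ℝ) (a : ℝ) : ℝ :=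
  if limsup (fun n => (ν n : Measure ℝ) univ) atTop = ⊤ then 0
  else (limsup (fun n => (ν n : Measure ℝ) (Iic a)) atTop).toReal

theorem limsupDistrib_le_mass (ν : ℕ → FiniteMeasure ℝ) (a : ℝ) :
    limsup (fun n => (ν n : Measure ℝ) (Iic a)) atTop ≤
      limsup (fun n => (ν n : Measure ℝ) univ) atTop :=
  limsup_le_limsup (Eventually.of_forall fun _ => measure_mono (subset_univ _))

theorem limsupDistrib_mono (ν : ℕ → FiniteMeasure ℝ) : Monotone (limsupDistrib ν) := by
  intro a b hab
  unfold limsupDistrib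
  split_ifs with h
  · exact le_rfl
  · refine ENNReal.toReal_mono (ne_top_of_le_ne_top h (limsupDistrib_le_mass ν b)) ?_
    exact limsup_le_limsup (Eventually.of_forall fun _ => measure_mono (Iic_subset_Iic.2 hab))

theorem limsupDistrib_mem (ν : ℕ → FiniteMeasure ℝ) (a : ℝ) :
    limsupDistrib ν a ∈
      Icc 0 (limsup (fun n => (ν n : Measure ℝ) univ) atTop).toReal := by
  unfold limsupDistrib
  split_ifs with h
  · simp
  · exact ⟨ENNReal.toReal_nonneg, ENNReal.toReal_mono h (limsupDistrib_le_mass ν a)⟩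

/-- The right-continuous modification of `limsupDistrib`. -/
def limsupStieltjes (ν : ℕ → FiniteMeasure ℝ) : StieltjesFunction ℝ :=
  (limsupDistrib_mono ν).stieltjesFunction

theorem limsupStieltjes_mem (ν : ℕ → FiniteMeasure ℝ) (a : ℝ) :
    limsupStieltjes ν a ∈
      Icc 0 (limsup (fun n => (ν n : Measure ℝ) univ) atTop).toReal := by
  have h : limsupStieltjes ν a = Function.rightLim (limsupDistrib ν) a := rfl
  rw [h]
  refine ⟨?_, ?_⟩
  · exact (limsupDistrib_mem ν a).1.trans ((limsupDistrib_mono ν).le_rightLim le_rfl)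
  · exact ((limsupDistrib_mono ν).rightLim_le (lt_add_one a)).trans (limsupDistrib_mem ν _).2

theorem limsupStieltjes_isFinite (ν : ℕ → FiniteMeasure ℝ) :
    IsFiniteMeasure (limsupStieltjes ν).measure := by
  have hb : BddBelow (range (limsupStieltjes ν)) :=
    ⟨0, by rintro _ ⟨a, rfl⟩; exact (limsupStieltjes_mem ν a).1⟩
  have ha : BddAbove (range (limsupStieltjes ν)) :=
    ⟨_, by rintro _ ⟨a, rfl⟩; exact (limsupStieltjes_mem ν a).2⟩
  exact (limsupStieltjes ν).isFiniteMeasure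
    (tendsto_atBot_ciInf (limsupStieltjes ν).mono hb)
    (tendsto_atTop_ciSup (limsupStieltjes ν).mono ha)

/-- A measure attached to every sequence of finite measures that depends measurably on the sequence
and is the weak limit if the sequence converges weakly. -/
def limsupMeasure (ν : ℕ → FiniteMeasure ℝ) : FiniteMeasure ℝ :=
  ⟨(limsupStieltjes ν).measure, limsupStieltjes_isFinite ν⟩

/-- Writing the right limit along one fixed sequence makes it a countable limit, which preserves
measurability in the sequence of measures. -/
theorem tendsto_limsupStieltjes (ν : ℕ → FiniteMeasure ℝ) (a : ℝ) :
    Tendsto (fun m : ℕ => limsupDistrib ν (a + 1 / ((m : ℝ) + 1))) atTop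
      (𝓝 (limsupStieltjes ν a)) := by
  have h : Tendsto (limsupDistrib ν) (𝓝[>] a) (𝓝 (limsupStieltjes ν a)) :=
    (limsupDistrib_mono ν).tendsto_rightLim a
  refine h.comp ?_
  refine tendsto_nhdsWithin_iff.2 ⟨?_, Eventually.of_forall fun m => ?_⟩
  · have := (tendsto_one_div_add_atTop_nhds_zero_nat (𝕜 := ℝ)).const_add a
    simpa using this
  · have : (0 : ℝ) < 1 / ((m : ℝ) + 1) := by positivity
    simpa using this

theorem tendsto_measure_Iic_add (ρ : Measure ℝ) [IsFiniteMeasure ρ] (a : ℝ) :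
    Tendsto (fun m : ℕ => ρ (Iic (a + 1 / ((m : ℝ) + 1)))) atTop (𝓝 (ρ (Iic a))) := by
  have hI : Iic a = ⋂ m : ℕ, Iic (a + 1 / ((m : ℝ) + 1)) := by
    ext x
    simp only [mem_Iic, mem_iInter]
    constructor
    · intro hx m
      have : (0 : ℝ) < 1 / ((m : ℝ) + 1) := by positivity
      linarith
    · intro hx
      have := (tendsto_one_div_add_atTop_nhds_zero_nat (𝕜 := ℝ)).const_add a
      rw [add_zero] at this
      exact ge_of_tendsto' this hx
  rw [hI]
  refine tendsto_measure_iInter_atTop (fun m => measurableSet_Iic.nullMeasurableSet) ?_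
    ⟨0, measure_ne_top _ _⟩
  intro m n hmn
  apply Iic_subset_Iic.2
  gcongr

/-- Portmanteau on `Iic b` bounds the upper limit from above. Portmanteau on `Ici b`, with
convergence of the total masses, bounds it from below by the limit mass of `Iic a` for every `a <
b`. Letting `b` decrease to `a` closes the gap. -/
theorem limsupMeasure_eq_of_tendsto {ν : ℕ → FiniteMeasure ℝ} {ρ : FiniteMeasure ℝ}
    (h : Tendsto ν atTop (𝓝 ρ)) : limsupMeasure ν = ρ := by
  have hmass : limsup (fun n => (ν n : Measure ℝ) univ) atTop ≠ ⊤ :=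
    ne_top_of_le_ne_top (measure_ne_top _ _)
      (FiniteMeasure.limsup_measure_closed_le_of_tendsto h isClosed_univ)
  have hup : ∀ b, limsup (fun n => (ν n : Measure ℝ) (Iic b)) atTop ≤ (ρ : Measure ℝ) (Iic b) :=
    fun b => FiniteMeasure.limsup_measure_closed_le_of_tendsto h isClosed_Iic
  have hmassT : Tendsto (fun n => (ν n : Measure ℝ) univ) atTop (𝓝 ((ρ : Measure ℝ) univ)) := by
    have := (FiniteMeasure.continuous_mass.tendsto ρ).comp h
    have h2 := (ENNReal.continuous_coe.tendsto _).comp this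
    simpa [Function.comp_def, FiniteMeasure.ennreal_mass] using h2
  have hlow : ∀ a b, a < b →
      (ρ : Measure ℝ) (Iic a) ≤ limsup (fun n => (ν n : Measure ℝ) (Iic b)) atTop := by
    intro a b hab
    have h1 := FiniteMeasure.limsup_measure_closed_le_of_tendsto h (isClosed_Ici (a := b))
    have h2 : (ρ : Measure ℝ) univ ≤ limsup (fun n => (ν n : Measure ℝ) (Iic b)) atTop +
        limsup (fun n => (ν n : Measure ℝ) (Ici b)) atTop := by
      rw [← hmassT.limsup_eq]
      refine le_trans (limsup_le_limsup (Eventually.of_forall fun n => ?_))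
        (ennreal_limsup_add_le _ _)
      change (ν n : Measure ℝ) univ ≤ (ν n : Measure ℝ) (Iic b) + (ν n : Measure ℝ) (Ici b)
      rw [← Iic_union_Ici (a := b)]
      exact measure_union_le _ _
    have h3 : (ρ : Measure ℝ) (Iic a) + (ρ : Measure ℝ) (Ici b) ≤ (ρ : Measure ℝ) univ := by
      rw [← measure_union _ measurableSet_Ici]
      · exact measure_mono (subset_univ _)
      · exact Set.disjoint_left.2 fun x hx hx' => absurd (hab.trans_le hx') (not_lt.2 hx)
    have h4 := (h3.trans h2).trans (add_le_add_right h1 _)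
    exact (ENNReal.add_le_add_iff_right (measure_ne_top (ρ : Measure ℝ) (Ici b))).1 h4
  have hF : ∀ a, limsupStieltjes ν a = ((ρ : Measure ℝ) (Iic a)).toReal := by
    intro a
    refine tendsto_nhds_unique (tendsto_limsupStieltjes ν a) ?_
    have hd : ∀ b, limsupDistrib ν b =
        (limsup (fun n => (ν n : Measure ℝ) (Iic b)) atTop).toReal := by
      intro b; simp [limsupDistrib, hmass]
    have hanti := tendsto_measure_Iic_add (ρ : Measure ℝ) a
    refine tendsto_of_tendsto_of_tendsto_of_le_of_le tendsto_const_nhds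
      ((ENNReal.tendsto_toReal (measure_ne_top _ _)).comp hanti) ?_ ?_
    · intro m
      change _ ≤ limsupDistrib ν _
      rw [hd]
      have hm : a < a + 1 / ((m : ℝ) + 1) := by
        have : (0 : ℝ) < 1 / ((m : ℝ) + 1) := by positivity
        linarith
      exact ENNReal.toReal_mono (ne_top_of_le_ne_top (measure_ne_top _ _) (hup _)) (hlow _ _ hm)
    · intro m
      change limsupDistrib ν _ ≤ _
      rw [hd]
      exact ENNReal.toReal_mono (measure_ne_top _ _) (hup _)
  apply Subtype.ext
  change (limsupStieltjes ν).measure = (ρ : Measure ℝ)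
  have := limsupStieltjes_isFinite ν
  refine Measure.ext_of_Ioc _ _ fun a b hab => ?_
  rw [StieltjesFunction.measure_Ioc, hF, hF, ← Iic_sdiff_Iic_eq,
    measure_sdiff (Iic_subset_Iic.2 hab.le) measurableSet_Iic.nullMeasurableSet
      (measure_ne_top _ _), ENNReal.ofReal_sub _ ENNReal.toReal_nonneg,
    ENNReal.ofReal_toReal (measure_ne_top _ _), ENNReal.ofReal_toReal (measure_ne_top _ _)]

theorem measurable_finiteMeasure_apply {s : Set ℝ} (hs : MeasurableSet s) :
    Measurable fun ν : FiniteMeasure ℝ => (ν : Measure ℝ) s :=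
  (Measure.measurable_coe hs).comp measurable_subtype_coe

theorem measurable_limsupMeasure {X : Type*} [MeasurableSpace X] {ν : ℕ → X → FiniteMeasure ℝ}
    (hν : ∀ n, Measurable (ν n)) : Measurable fun x => limsupMeasure fun n => ν n x := by
  have hD : ∀ a, Measurable fun x => limsupDistrib (fun n => ν n x) a := by
    intro a
    unfold limsupDistrib
    refine Measurable.ite ?_ measurable_const ?_
    · refine measurableSet_eq_fun (Measurable.limsup fun n => ?_) measurable_const
      exact (measurable_finiteMeasure_apply MeasurableSet.univ).comp (hν n)
    · refine (Measurable.limsup fun n => ?_).ennreal_toReal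
      exact (measurable_finiteMeasure_apply measurableSet_Iic).comp (hν n)
  have hS : ∀ a, Measurable fun x => limsupStieltjes (fun n => ν n x) a := by
    intro a
    exact measurable_of_tendsto_metrizable (fun m => hD (a + 1 / ((m : ℝ) + 1)))
      (tendsto_pi_nhds.2 fun x => tendsto_limsupStieltjes (fun n => ν n x) a)
  have hI : ∀ a b : ℝ,
      Measurable fun x => (limsupStieltjes fun n => ν n x).measure (Ioc a b) := by
    intro a b
    simp_rw [StieltjesFunction.measure_Ioc]
    exact ((hS b).sub (hS a)).ennreal_ofReal
  refine Measurable.subtype_mk ?_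
  have : ∀ x, IsFiniteMeasure (limsupStieltjes fun n => ν n x).measure :=
    fun x => limsupStieltjes_isFinite _
  refine Measurable.measure_of_isPiSystem (borel_eq_generateFrom_Ioc ℝ ▸
    BorelSpace.measurable_eq) (isPiSystem_Ioc id id) ?_ ?_
  · rintro s ⟨a, b, _, rfl⟩
    exact hI _ _
  · have hU : (univ : Set ℝ) = ⋃ n : ℕ, Ioc (-(n : ℝ)) n := by
      refine (eq_univ_of_forall fun x => ?_).symm
      obtain ⟨n, hn⟩ := exists_nat_gt |x|
      exact mem_iUnion.2 ⟨n, (abs_lt.1 hn).1, (abs_lt.1 hn).2.le⟩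
    have hm : Monotone fun n : ℕ => Ioc (-(n : ℝ)) n := by
      intro m n hmn
      have : (m : ℝ) ≤ n := by exact_mod_cast hmn
      exact Ioc_subset_Ioc (by linarith) this
    simp_rw [hU, hm.measure_iUnion]
    exact Measurable.iSup fun n => hI _ _

/-! ### Residual-life paths of a population. -/

/-- Individuals `(b,d)` with birth time `b ≤ t` and death time `d > t`. -/
def aliveAt (t : ℝ) : Set (ℝ × ℝ) := {b | b.1 ≤ t ∧ t < b.2}

theorem measurableSet_aliveAt (t : ℝ) : MeasurableSet (aliveAt t) :=
  (measurableSet_le measurable_fst measurable_const).inter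
    (measurableSet_lt measurable_const measurable_snd)

/-- The distribution of the residual lives at time `t` of a population `B` of pairs of birth and
death times. -/
def residualLives (B : Measure (ℝ × ℝ)) (t : ℝ) : Measure ℝ :=
  (B.restrict (aliveAt t)).map fun b => b.2 - t

theorem residualLives_apply (B : Measure (ℝ × ℝ)) (t : ℝ) {s : Set ℝ} (hs : MeasurableSet s) :
    residualLives B t s = B {b | b ∈ aliveAt t ∧ b.2 - t ∈ s} := by
  have hm : Measurable fun b : ℝ × ℝ => b.2 - t := by fun_prop
  rw [residualLives, Measure.map_apply hm hs, Measure.restrict_apply (hm hs), inter_comm]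
  rfl

theorem residualLives_le (B : Measure (ℝ × ℝ)) (t : ℝ) (s : Set ℝ) :
    residualLives B t s ≤ B {b | b.1 ≤ t} := by
  refine (measure_mono (subset_univ s)).trans ?_
  rw [residualLives_apply _ _ MeasurableSet.univ]
  exact measure_mono fun b hb => hb.1.1

/-- The path of residual life distributions of a population with finitely many births in finite
time. -/
def residualPath (B : Measure (ℝ × ℝ)) (hB : ∀ t : ℝ≥0, B {b | b.1 ≤ t} < ⊤) (t : ℝ≥0) :
    LifeMeasure :=
  ⟨⟨residualLives B t, ⟨(residualLives_le B t univ).trans_lt (hB t)⟩⟩, by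
    refine (FiniteMeasure.null_iff_toMeasure_null _ _).2 ?_
    change residualLives B t (Iic 0) = 0
    rw [residualLives_apply _ _ measurableSet_Iic]
    convert measure_empty (μ := B)
    ext b
    simp only [aliveAt, mem_ofPred_eq, mem_Iic, mem_empty_iff_false, iff_false]
    rintro ⟨⟨_, h⟩, h'⟩
    linarith⟩

/-- Dominated convergence over the finite set of births up to `T`: each individual eventually has a
constant status along the filter, so its contribution `f (b.2 - r)` converges. -/
theorem tendsto_restrict_map {B : Measure (ℝ × ℝ)} {T : ℝ} (hT : B {b | b.1 ≤ T} < ⊤)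
    {ν : ℝ≥0 → FiniteMeasure ℝ} {ρ : FiniteMeasure ℝ} {l : Filter ℝ≥0} [l.IsCountablyGenerated]
    {t : ℝ≥0} (hl : Tendsto (fun r : ℝ≥0 => (r : ℝ)) l (𝓝 (t : ℝ)))
    {D : ℝ≥0 → Set (ℝ × ℝ)} {D' : Set (ℝ × ℝ)} (hD : ∀ r, MeasurableSet (D r))
    (hD' : MeasurableSet D') (hDT : ∀ᶠ r in l, D r ⊆ {b | b.1 ≤ T}) (hDT' : D' ⊆ {b | b.1 ≤ T})
    (hν : ∀ r, (ν r : Measure ℝ) = (B.restrict (D r)).map fun b => b.2 - (r : ℝ))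
    (hρ : (ρ : Measure ℝ) = (B.restrict D').map fun b => b.2 - (t : ℝ))
    (hlim : ∀ b, ∀ᶠ r in l, (b ∈ D r ↔ b ∈ D')) : Tendsto ν l (𝓝 ρ) := by
  have hTm : MeasurableSet {b : ℝ × ℝ | b.1 ≤ T} :=
    measurableSet_le measurable_fst measurable_const
  have : IsFiniteMeasure (B.restrict {b | b.1 ≤ T}) := ⟨by simpa using hT⟩
  rw [FiniteMeasure.tendsto_iff_forall_integral_tendsto]
  intro f
  have hint : ∀ (r : ℝ≥0) (C : Set (ℝ × ℝ)), MeasurableSet C → C ⊆ {b | b.1 ≤ T} →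
      ∫ x, f x ∂((B.restrict C).map fun b => b.2 - (r : ℝ)) =
        ∫ b, C.indicator (fun b => f (b.2 - r)) b ∂(B.restrict {b | b.1 ≤ T}) := by
    intro r C hC hCT
    have hm : Measurable fun b : ℝ × ℝ => b.2 - (r : ℝ) := by fun_prop
    rw [integral_map hm.aemeasurable f.continuous.aestronglyMeasurable, integral_indicator hC,
      Measure.restrict_restrict hC, inter_eq_left.2 hCT]
  have hev : (fun r => ∫ b, (D r).indicator (fun b => f (b.2 - r)) b
      ∂(B.restrict {b | b.1 ≤ T})) =ᶠ[l] fun r => ∫ x, f x ∂(ν r : Measure ℝ) := by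
    filter_upwards [hDT] with r hr
    rw [hν, hint r _ (hD r) hr]
  refine Tendsto.congr' hev ?_
  rw [hρ, hint t _ hD' hDT']
  refine tendsto_integral_filter_of_dominated_convergence (fun _ => ‖f‖) ?_ ?_
    (integrable_const _) ?_
  · refine Eventually.of_forall fun r => Measurable.aestronglyMeasurable ?_
    refine Measurable.indicator ?_ (hD r)
    exact f.continuous.measurable.comp (by fun_prop)
  · refine Eventually.of_forall fun r => Eventually.of_forall fun b => ?_
    refine (norm_indicator_le_norm_self _ _).trans ?_
    exact f.norm_coe_le_norm _
  · refine Eventually.of_forall fun b => ?_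
    by_cases hb : b ∈ D'
    · have h1 : Tendsto (fun r : ℝ≥0 => f (b.2 - r)) l (𝓝 (f (b.2 - t))) :=
        (f.continuous.tendsto _).comp (hl.const_sub b.2)
      rw [indicator_of_mem hb]
      refine h1.congr' ?_
      filter_upwards [hlim b] with r hr
      rw [indicator_of_mem (hr.2 hb)]
    · rw [indicator_of_notMem hb]
      refine tendsto_const_nhds.congr' ?_
      filter_upwards [hlim b] with r hr
      rw [indicator_of_notMem (fun h => hb (hr.1 h))]

theorem cadlagAt_residualPath (B : Measure (ℝ × ℝ)) (hB : ∀ t : ℝ≥0, B {b | b.1 ≤ t} < ⊤)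
    (t : ℝ≥0) : CadlagAt (residualPath B hB) t := by
  have hcoe : Tendsto (fun r : ℝ≥0 => (r : ℝ)) (𝓝 t) (𝓝 (t : ℝ)) :=
    NNReal.continuous_coe.tendsto t
  have hT : B {b | b.1 ≤ (t : ℝ) + 1} < ⊤ := by
    have := hB (t + 1)
    simpa using this
  refine ⟨?_, ?_⟩
  · rw [ContinuousWithinAt, tendsto_subtype_rng]
    refine tendsto_restrict_map hT (hcoe.mono_left nhdsWithin_le_nhds)
      (D := fun r => aliveAt r) (D' := aliveAt t)
      (fun r => measurableSet_aliveAt r) (measurableSet_aliveAt t) ?_ ?_ (fun r => rfl) rfl ?_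
    · have : ∀ᶠ r : ℝ≥0 in 𝓝[≥] t, (r : ℝ) < (t : ℝ) + 1 :=
        (hcoe.mono_left nhdsWithin_le_nhds).eventually (gt_mem_nhds (by linarith))
      filter_upwards [this] with r hr b hb
      exact hb.1.trans hr.le
    · intro b hb
      have := hb.1
      simp only [mem_ofPred_eq]
      linarith
    · intro b
      have hge : ∀ᶠ r : ℝ≥0 in 𝓝[≥] t, (t : ℝ) ≤ r := by
        filter_upwards [self_mem_nhdsWithin] with r hr
        exact_mod_cast hr
      have hlt : ∀ c : ℝ, (t : ℝ) < c → ∀ᶠ r : ℝ≥0 in 𝓝[≥] t, (r : ℝ) < c := fun c hc =>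
        (hcoe.mono_left nhdsWithin_le_nhds).eventually (gt_mem_nhds hc)
      have h1 : ∀ᶠ r : ℝ≥0 in 𝓝[≥] t, (b.1 ≤ r ↔ b.1 ≤ (t : ℝ)) := by
        by_cases h : b.1 ≤ t
        · filter_upwards [hge] with r hr
          exact ⟨fun _ => h, fun _ => h.trans hr⟩
        · filter_upwards [hlt _ (not_le.1 h)] with r hr
          exact ⟨fun h' => absurd h' (not_le.2 hr), fun h' => absurd h' h⟩
      have h2 : ∀ᶠ r : ℝ≥0 in 𝓝[≥] t, ((r : ℝ) < b.2 ↔ (t : ℝ) < b.2) := by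
        by_cases h : (t : ℝ) < b.2
        · filter_upwards [hlt _ h] with r hr
          exact ⟨fun _ => h, fun _ => hr⟩
        · filter_upwards [hge] with r hr
          exact ⟨fun h' => absurd (hr.trans_lt h') h, fun h' => absurd h' h⟩
      filter_upwards [h1, h2] with r hr1 hr2
      simp only [aliveAt, mem_ofPred_eq, hr1, hr2]
  -- The individuals seen just before `t`: a death exactly at `t` still counts and gives an atom at
  -- `0`, while a birth exactly at `t` does not count.
  · let D' : Set (ℝ × ℝ) := {b | b.1 < t ∧ (t : ℝ) ≤ b.2}
    have hD' : MeasurableSet D' := (measurableSet_lt measurable_fst measurable_const).inter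
      (measurableSet_le measurable_const measurable_snd)
    have hD'T : D' ⊆ {b | b.1 ≤ (t : ℝ) + 1} := by
      intro b hb
      have := hb.1
      simp only [mem_ofPred_eq]
      linarith
    have hfin : IsFiniteMeasure (B.restrict D') :=
      ⟨by simpa using (measure_mono hD'T).trans_lt hT⟩
    refine ⟨⟨(B.restrict D').map fun b => b.2 - t, inferInstance⟩, ?_⟩
    have hlt' : ∀ᶠ r : ℝ≥0 in 𝓝[<] t, (r : ℝ) < t := by
      filter_upwards [self_mem_nhdsWithin] with r hr
      exact_mod_cast hr
    refine tendsto_restrict_map hT (hcoe.mono_left nhdsWithin_le_nhds)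
      (D := fun r => aliveAt r) (D' := D')
      (fun r => measurableSet_aliveAt r) hD' ?_ hD'T (fun r => rfl) rfl ?_
    · filter_upwards [hlt'] with r hr b hb
      have := hb.1
      simp only [mem_ofPred_eq]
      linarith
    · intro b
      have hgt : ∀ c : ℝ, c < t → ∀ᶠ r : ℝ≥0 in 𝓝[<] t, c < (r : ℝ) := fun c hc =>
        (hcoe.mono_left nhdsWithin_le_nhds).eventually (lt_mem_nhds hc)
      have h1 : ∀ᶠ r : ℝ≥0 in 𝓝[<] t, (b.1 ≤ r ↔ b.1 < (t : ℝ)) := by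
        by_cases h : b.1 < t
        · filter_upwards [hgt _ h] with r hr
          exact ⟨fun _ => h, fun _ => hr.le⟩
        · filter_upwards [hlt'] with r hr
          exact ⟨fun h' => absurd (h'.trans_lt hr) h, fun h' => absurd h' h⟩
      have h2 : ∀ᶠ r : ℝ≥0 in 𝓝[<] t, ((r : ℝ) < b.2 ↔ (t : ℝ) ≤ b.2) := by
        by_cases h : (t : ℝ) ≤ b.2
        · filter_upwards [hlt'] with r hr
          exact ⟨fun _ => h, fun _ => hr.trans_le h⟩
        · filter_upwards [hgt _ (not_le.1 h)] with r hr
          exact ⟨fun h' => absurd h' (not_lt.2 hr.le), fun h' => absurd h' h⟩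
      filter_upwards [h1, h2] with r hr1 hr2
      simp only [aliveAt, mem_ofPred_eq, hr1, hr2, D']

/-! ### Left limits of paths. -/

theorem nhdsLT_neBot {s : ℝ≥0} (hs : 0 < s) : (𝓝[<] s).NeBot :=
  nhdsLT_neBot_of_exists_lt ⟨0, hs⟩

theorem CadlagAt.tendsto_leftLimit {X : ℝ≥0 → LifeMeasure} {s : ℝ≥0} (h : CadlagAt X s)
    (hs : 0 < s) : Tendsto (fun r => (X r).1) (𝓝[<] s) (𝓝 (leftLimit X s)) := by
  obtain ⟨ν, hν⟩ := h.2
  have := nhdsLT_neBot hs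
  rw [leftLimit, leftLim_eq_of_tendsto hν]
  exact hν

theorem leftLimit_congr {X Y : ℝ≥0 → LifeMeasure} {s : ℝ≥0} (hs : 0 < s) (hX : CadlagAt X s)
    (h : ∀ r < s, X r = Y r) : leftLimit X s = leftLimit Y s := by
  have := nhdsLT_neBot hs
  refine (leftLim_eq_of_tendsto ((hX.tendsto_leftLimit hs).congr' ?_)).symm
  filter_upwards [self_mem_nhdsWithin] with r hr
  rw [h r hr]

/-- If the masses on the left of `s` are at most `K`, then so is the mass of the left limit. -/
theorem mass_leftLimit_le {X : ℝ≥0 → LifeMeasure} {s : ℝ≥0} (hs : 0 < s) (hX : CadlagAt X s)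
    {K : ℝ≥0∞} (h : ∀ᶠ r in 𝓝[<] s, totalMass (X r) ≤ K) :
    (leftLimit X s : Measure ℝ) univ ≤ K := by
  have := nhdsLT_neBot hs
  have h1 := (FiniteMeasure.continuous_mass.tendsto _).comp (hX.tendsto_leftLimit hs)
  have h2 := (ENNReal.continuous_coe.tendsto _).comp h1
  simp only [Function.comp_def, FiniteMeasure.ennreal_mass] at h2
  exact le_of_tendsto h2 h

/-! ### The predictable σ-algebra. -/

section Predictable

variable {Ω : Type*} {mΩ : MeasurableSpace Ω}

/-- The rectangles `A × B` with `A` known at a time `s` and `B` after time `s`. -/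
def predictableRectangles (F : Filtration ℝ≥0 mΩ) : Set (Set (Ω × NoisePoint)) :=
  {C | ∃ (s : ℝ≥0) (A : Set Ω) (B : Set NoisePoint), MeasurableSet[F s] A ∧ MeasurableSet B ∧
    -- For `s = 0` no constraint on time is imposed, so that the whole space is a rectangle;
    -- nonpositive times carry no intensity.
    (∀ q ∈ B, s = 0 ∨ (s : ℝ) < q.1) ∧ C = A ×ˢ B}

/-- The predictable σ-algebra on `Ω × NoisePoint`. -/
@[reducible] def predictableSigma (F : Filtration ℝ≥0 mΩ) : MeasurableSpace (Ω × NoisePoint) :=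
  MeasurableSpace.generateFrom (predictableRectangles F)

theorem isPiSystem_predictableRectangles (F : Filtration ℝ≥0 mΩ) :
    IsPiSystem (predictableRectangles F) := by
  rintro _ ⟨s, A, B, hA, hB, hs, rfl⟩ _ ⟨s', A', B', hA', hB', hs', rfl⟩ _
  refine ⟨max s s', A ∩ A', B ∩ B', ?_, hB.inter hB', ?_, prod_inter_prod⟩
  · exact (F.mono (le_max_left s s') _ hA).inter (F.mono (le_max_right s s') _ hA')
  · rintro q ⟨hq, hq'⟩
    rcases le_total s s' with h | h
    · rw [max_eq_right h]; exact hs' q hq'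
    · rw [max_eq_left h]; exact hs q hq

theorem predictableSigma_le (F : Filtration ℝ≥0 mΩ) :
    predictableSigma F ≤ (inferInstance : MeasurableSpace (Ω × NoisePoint)) := by
  refine MeasurableSpace.generateFrom_le ?_
  rintro _ ⟨s, A, B, hA, hB, -, rfl⟩
  exact (F.le s _ hA).prod hB

theorem measurable_snd_predictable (F : Filtration ℝ≥0 mΩ) :
    Measurable[predictableSigma F] (Prod.snd : Ω × NoisePoint → NoisePoint) := by
  intro B hB
  refine MeasurableSpace.measurableSet_generateFrom
    ⟨0, univ, B, MeasurableSet.univ, hB, fun _ _ => Or.inl rfl, ?_⟩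
  ext x
  simp

theorem measurableSet_predictable_initial (F : Filtration ℝ≥0 mΩ) {A : Set Ω}
    (hA : MeasurableSet[F 0] A) :
    MeasurableSet[predictableSigma F] (Prod.fst ⁻¹' A : Set (Ω × NoisePoint)) := by
  refine MeasurableSpace.measurableSet_generateFrom
    ⟨0, A, univ, hA, MeasurableSet.univ, fun _ _ => Or.inl rfl, ?_⟩
  ext x
  simp

/-- The restriction of a predictable set to the times up to `t` is known at time `t`. -/
theorem measurableSet_predictable_inter (F : Filtration ℝ≥0 mΩ) (t : ℝ≥0)
    {C : Set (Ω × NoisePoint)} (hC : MeasurableSet[predictableSigma F] C) :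
    MeasurableSet[(F t).prod inferInstance] (C ∩ {x | x.2.1 ≤ t}) := by
  have hT : MeasurableSet[(F t).prod inferInstance] {x : Ω × NoisePoint | x.2.1 ≤ (t : ℝ)} := by
    have h1 : MeasurableSet {q : NoisePoint | q.1 ≤ (t : ℝ)} :=
      measurableSet_le measurable_fst measurable_const
    exact (@measurable_snd Ω NoisePoint (F t) inferInstance) h1
  induction C, hC using MeasurableSpace.generateFrom_induction with
  | hC C hC _ =>
    obtain ⟨s, A, B, hA, hB, hs, rfl⟩ := hC
    by_cases hst : s ≤ t
    · refine MeasurableSet.inter ?_ hT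
      exact @MeasurableSet.prod Ω NoisePoint (F t) inferInstance _ _ (F.mono hst _ hA) hB
    · convert @MeasurableSet.empty _ ((F t).prod inferInstance)
      ext ⟨ω, q⟩
      simp only [mem_inter_iff, mem_prod, mem_ofPred_eq, mem_empty_iff_false, iff_false]
      rintro ⟨⟨-, hq⟩, hqt⟩
      rcases hs q hq with h | h
      · exact hst (h ▸ zero_le)
      · exact hst (by exact_mod_cast (h.trans_le hqt).le)
  | empty => simp
  | compl C _ ih =>
    have : Cᶜ ∩ {x : Ω × NoisePoint | x.2.1 ≤ (t : ℝ)} =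
        {x : Ω × NoisePoint | x.2.1 ≤ (t : ℝ)} \ (C ∩ {x | x.2.1 ≤ (t : ℝ)}) := by
      ext x
      simp only [mem_inter_iff, mem_compl_iff, Set.mem_sdiff]
      tauto
    rw [this]
    exact hT.diff ih
  | iUnion f _ ih =>
    rw [iUnion_inter]
    exact MeasurableSet.iUnion ih

end Predictable

/-! ### Measurability and compensation formula for the noise. -/

section RandomMeasure

/-- A partition of the space into sets of finite intensity. -/
def chunk (Λ : Measure NoisePoint) [SigmaFinite Λ] (n : ℕ) : Set NoisePoint :=
  disjointed (spanningSets Λ) n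

variable {Λ : Measure NoisePoint} [SigmaFinite Λ]

theorem measurableSet_chunk (n : ℕ) : MeasurableSet (chunk Λ n) :=
  MeasurableSet.disjointed (measurableSet_spanningSets Λ) n

theorem measure_chunk_lt_top (n : ℕ) : Λ (chunk Λ n) < ⊤ :=
  (measure_mono (disjointed_subset _ n)).trans_lt (measure_spanningSets_lt_top Λ n)

theorem iUnion_chunk : ⋃ n, chunk Λ n = univ :=
  (iUnion_disjointed).trans (iUnion_spanningSets Λ)

theorem tsum_measure_chunk (N : Measure NoisePoint) {B : Set NoisePoint} (hB : MeasurableSet B) :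
    ∑' n, N (B ∩ chunk Λ n) = N B := by
  rw [← measure_iUnion, ← inter_iUnion, iUnion_chunk, inter_univ]
  · intro i j hij
    exact ((disjoint_disjointed (spanningSets Λ)) hij).mono inter_subset_right inter_subset_right
  · exact fun n => hB.inter (measurableSet_chunk n)

variable (Λ) in
/-- A random measure that is finite on each chunk integrates jointly measurable functions to
measurable functions. -/
theorem measurable_measure_section {Ω : Type*} [MeasurableSpace Ω] {N : Ω → Measure NoisePoint}
    (hN : Measurable N) (hfin : ∀ ω n, N ω (chunk Λ n) < ⊤) {C : Set (Ω × NoisePoint)}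
    (hC : MeasurableSet C) : Measurable fun ω => N ω (Prod.mk ω ⁻¹' C) := by
  have hsec : ∀ ω, MeasurableSet (Prod.mk ω ⁻¹' C : Set NoisePoint) :=
    fun ω => measurable_prodMk_left hC
  have hκ : ∀ n, Measurable fun ω => N ω (Prod.mk ω ⁻¹' C ∩ chunk Λ n) := by
    intro n
    let κ : Kernel Ω NoisePoint :=
      ⟨fun ω => (N ω).restrict (chunk Λ n), by
        refine Measure.measurable_of_measurable_coe _ fun B hB => ?_
        simp_rw [Measure.restrict_apply hB]
        exact (Measure.measurable_coe (hB.inter (measurableSet_chunk n))).comp hN⟩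
    have := Kernel.measurable_kernel_prodMk_left_of_finite (κ := κ) hC
      (fun ω => ⟨by simpa [κ] using hfin ω n⟩)
    convert this using 2 with ω
    exact (Measure.restrict_apply (hsec ω)).symm
  simp_rw [← fun ω => tsum_measure_chunk (Λ := Λ) (N ω) (hsec ω)]
  exact Measurable.tsum hκ

variable {Ω : Type*} {mΩ : MeasurableSpace Ω} {P : Measure Ω} {F : Filtration ℝ≥0 mΩ}
  {M : Ω → Measure NoisePoint}

theorem lintegral_poissonMeasure_natCast (r : ℝ≥0) :
    ∫⁻ k : ℕ, (k : ℝ≥0∞) ∂(poissonMeasure r) = r := by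
  rw [lintegral_countable']
  have hr : ∀ n : ℕ, (n : ℝ≥0∞) * poissonMeasure r {n} =
      ENNReal.ofReal (n * (Real.exp (-r) * r ^ n / n.factorial)) := by
    intro n
    rw [poissonMeasure_singleton, ENNReal.ofReal_mul (by positivity), ENNReal.ofReal_natCast]
  simp_rw [hr]
  have hs : HasSum (fun n : ℕ => (n : ℝ) * (Real.exp (-r) * r ^ n / n.factorial)) r := by
    -- The term `n = 0` vanishes, and cancelling `n` against `n!` turns the rest into `r` times the
    -- Poisson weights.
    rw [← hasSum_nat_add_iff' 1]
    simp only [Finset.range_one, Finset.sum_singleton, CharP.cast_eq_zero, zero_mul, sub_zero]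
    have := (hasSum_one_poissonMeasure r).mul_left (r : ℝ)
    rw [mul_one] at this
    have he : (fun n : ℕ => ((n + 1 : ℕ) : ℝ) *
        (Real.exp (-r) * (r : ℝ) ^ (n + 1) / (n + 1).factorial)) =
        fun n : ℕ => (r : ℝ) * (Real.exp (-r) * (r : ℝ) ^ n / n.factorial) := by
      funext n
      rw [Nat.factorial_succ]
      push_cast
      field_simp
      ring
    rw [he]
    exact this
  rw [← ENNReal.ofReal_tsum_of_nonneg (fun n => by positivity) hs.summable, hs.tsum_eq,
    ENNReal.ofReal_coe_nnreal]

theorem IsPoissonRandomMeasure.lintegral_apply {Λ : Measure NoisePoint}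
    (hM : IsPoissonRandomMeasure P F Λ M) {B : Set NoisePoint} (hB : MeasurableSet B) (hΛ : Λ B < ⊤) :
    ∫⁻ ω, M ω B ∂P = Λ B := by
  have hm : Measurable fun ω => M ω B := (Measure.measurable_coe hB).comp hM.measurable
  calc ∫⁻ ω, M ω B ∂P = ∫⁻ x, x ∂(P.map fun ω => M ω B) := by
        exact (lintegral_map (f := fun x => x) measurable_id hm).symm
    _ = ∫⁻ k : ℕ, (k : ℝ≥0∞) ∂(poissonMeasure (Λ B).toNNReal) := by
        rw [hM.law B hB hΛ, lintegral_map (f := fun x => x) measurable_id measurable_from_top]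
    _ = Λ B := by
        rw [lintegral_poissonMeasure_natCast, ENNReal.coe_toNNReal hΛ.ne]

theorem IsPoissonRandomMeasure.ae_apply_lt_top {Λ : Measure NoisePoint}
    (hM : IsPoissonRandomMeasure P F Λ M) {B : Set NoisePoint} (hB : MeasurableSet B) (hΛ : Λ B < ⊤) : ∀ᵐ ω ∂P, M ω B < ⊤ :=
  ae_lt_top ((Measure.measurable_coe hB).comp hM.measurable)
    (by rw [hM.lintegral_apply hB hΛ]; exact hΛ.ne)

open Classical in
variable (Λ) in
/-- The random measure set to zero on the event where it is infinite on some chunk. -/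
def regularize (M : Ω → Measure NoisePoint) (ω : Ω) : Measure NoisePoint :=
  if ∀ n, M ω (chunk Λ n) < ⊤ then M ω else 0

theorem regularize_chunk_lt_top (ω : Ω) (n : ℕ) : regularize Λ M ω (chunk Λ n) < ⊤ := by
  unfold regularize
  split_ifs with h
  · exact h n
  · simp

theorem IsPoissonRandomMeasure.ae_regularize_eq (hM : IsPoissonRandomMeasure P F Λ M) :
    ∀ᵐ ω ∂P, regularize Λ M ω = M ω := by
  filter_upwards [ae_all_iff.2 fun n =>
    hM.ae_apply_lt_top (measurableSet_chunk n) (measure_chunk_lt_top (Λ := Λ) n)] with ω hω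
  exact if_pos hω

theorem IsPoissonRandomMeasure.measurable_regularize (hM : IsPoissonRandomMeasure P F Λ M) :
    Measurable (regularize Λ M) := by
  refine Measurable.ite ?_ hM.measurable measurable_const
  simp only [ofPred_forall]
  exact MeasurableSet.iInter fun n => measurableSet_lt
    ((Measure.measurable_coe (measurableSet_chunk n)).comp hM.measurable) measurable_const

theorem IsPoissonRandomMeasure.measurable_apply_adapted {Λ : Measure NoisePoint}
    (hM : IsPoissonRandomMeasure P F Λ M) (t : ℝ≥0) {B : Set NoisePoint} (hB : MeasurableSet B) (hBt : B ⊆ {q | q.1 ≤ t}) :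
    Measurable[F t] fun ω => M ω B := by
  have h1 : Measurable[noiseSigma M (Iic (t : ℝ))] fun ω => M ω B := by
    refine Measurable.mono (comap_measurable _) ?_ le_rfl
    exact le_iSup₂_of_le B ⟨hB, hBt⟩ le_rfl
  exact h1.mono (hM.adapted t) le_rfl

theorem measurableSet_of_null {N : Set Ω} (hF : ∀ N : Set Ω, P N = 0 → MeasurableSet[F 0] N)
    (t : ℝ≥0) (hN : P N = 0) : MeasurableSet[F t] N :=
  F.mono zero_le _ (hF N hN)

theorem measurableSet_of_ae_iff (hF : ∀ N : Set Ω, P N = 0 → MeasurableSet[F 0] N) {t : ℝ≥0}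
    {V W : Set Ω} (hW : MeasurableSet[F t] W) (hVW : ∀ᵐ ω ∂P, ω ∈ W ↔ ω ∈ V) :
    MeasurableSet[F t] V := by
  have h1 : P {ω | ¬ (ω ∈ W ↔ ω ∈ V)} = 0 := ae_iff.1 hVW
  have h2 : MeasurableSet[F t] {ω | ¬ (ω ∈ W ↔ ω ∈ V)} := measurableSet_of_null hF t h1
  have h3 : MeasurableSet[F t] (V ∩ {ω | ¬ (ω ∈ W ↔ ω ∈ V)}) :=
    measurableSet_of_null hF t (measure_mono_null inter_subset_right h1)
  have h4 : V = (W \ {ω | ¬ (ω ∈ W ↔ ω ∈ V)}) ∪ (V ∩ {ω | ¬ (ω ∈ W ↔ ω ∈ V)}) := by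
    ext ω
    simp only [mem_union, Set.mem_sdiff, mem_inter_iff, mem_ofPred_eq]
    tauto
  rw [h4]
  exact (hW.diff h2).union h3

/-- A function that agrees almost surely with one known at time `t` is itself known at time `t`. -/
theorem measurable_of_ae_eq {E : Type*} [MeasurableSpace E]
    (hF : ∀ N : Set Ω, P N = 0 → MeasurableSet[F 0] N) {t : ℝ≥0} {f g : Ω → E}
    (hf : Measurable[F t] f) (hfg : ∀ᵐ ω ∂P, f ω = g ω) : Measurable[F t] g := by
  intro B hB
  refine measurableSet_of_ae_iff hF (hf hB) ?_
  filter_upwards [hfg] with ω hω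
  simp [hω]

/-- The mass that the noise puts on a predictable set before time `t` is known at time `t`. -/
theorem IsPoissonRandomMeasure.measurable_predictable_section
    (hM : IsPoissonRandomMeasure P F Λ M) (hF : ∀ N : Set Ω, P N = 0 → MeasurableSet[F 0] N)
    (t : ℝ≥0) {C : Set (Ω × NoisePoint)} (hC : MeasurableSet[predictableSigma F] C)
    (hCt : C ⊆ {x | x.2.1 ≤ t}) : Measurable[F t] fun ω => M ω (Prod.mk ω ⁻¹' C) := by
  have hT : MeasurableSet {q : NoisePoint | q.1 ≤ (t : ℝ)} :=
    measurableSet_le measurable_fst measurable_const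
  have hC' : MeasurableSet[(F t).prod inferInstance] C := by
    have := measurableSet_predictable_inter F t hC
    rwa [inter_eq_left.2 hCt] at this
  -- The noise up to time `t` is known at time `t` as a measure-valued variable, so the section
  -- lemma applies with `F t` as the σ-algebra on `Ω`. Regularising changes it only on a null set,
  -- which is known at time `0`.
  have hmeas : Measurable[F t] fun ω => (regularize Λ M ω).restrict {q | q.1 ≤ (t : ℝ)} := by
    refine Measure.measurable_of_measurable_coe _ fun B hB => ?_
    simp_rw [Measure.restrict_apply hB]
    refine measurable_of_ae_eq hF (hM.measurable_apply_adapted t (hB.inter hT)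
      inter_subset_right) ?_
    filter_upwards [hM.ae_regularize_eq] with ω hω
    rw [hω]
  have h := @measurable_measure_section Λ _ Ω (F t) _ hmeas (fun ω n => by
    rw [Measure.restrict_apply (measurableSet_chunk n)]
    exact (measure_mono inter_subset_left).trans_lt (regularize_chunk_lt_top ω n)) C hC'
  refine measurable_of_ae_eq hF h ?_
  filter_upwards [hM.ae_regularize_eq] with ω hω
  rw [hω, Measure.restrict_eq_self]
  intro q hq
  exact hCt hq

theorem IsPoissonRandomMeasure.aemeasurable_section (hM : IsPoissonRandomMeasure P F Λ M)
    {C : Set (Ω × NoisePoint)} (hC : MeasurableSet C) :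
    AEMeasurable (fun ω => M ω (Prod.mk ω ⁻¹' C)) P := by
  refine ⟨_, measurable_measure_section Λ hM.measurable_regularize regularize_chunk_lt_top hC, ?_⟩
  filter_upwards [hM.ae_regularize_eq] with ω hω
  rw [hω]

/-- The noise after time `s` is independent of `F s`. When `s = 0` the set `B` may reach nonpositive
times, and this null part is cut off first. -/
theorem IsPoissonRandomMeasure.lintegral_rectangle {Λ : Measure NoisePoint}
    (hM : IsPoissonRandomMeasure P F Λ M) (hΛ : Λ {q | q.1 ≤ 0} = 0) {s : ℝ≥0} {A : Set Ω}
    (hA : MeasurableSet[F s] A) {B : Set NoisePoint} (hB : MeasurableSet B)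
    (hs : ∀ q ∈ B, s = 0 ∨ (s : ℝ) < q.1) (hfin : Λ B < ⊤) :
    ∫⁻ ω, A.indicator (fun ω => M ω B) ω ∂P = P A * Λ B := by
  have hpos : MeasurableSet {q : NoisePoint | (s : ℝ) < q.1} :=
    measurableSet_lt measurable_const measurable_fst
  set B' := B ∩ {q : NoisePoint | (s : ℝ) < q.1} with hB'def
  have hB' : MeasurableSet B' := hB.inter hpos
  have hnull : MeasurableSet (B \ B') ∧ Λ (B \ B') = 0 := by
    refine ⟨hB.diff hB', measure_mono_null ?_ hΛ⟩
    rintro q ⟨hq, hq'⟩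
    rcases hs q hq with h | h
    · by_contra h'
      exact hq' ⟨hq, by subst h; simpa using h'⟩
    · exact absurd ⟨hq, h⟩ hq'
  have hΛB : Λ B' = Λ B := by
    refine le_antisymm (measure_mono inter_subset_left) ?_
    calc Λ B ≤ Λ (B' ∪ B \ B') := measure_mono (by intro q hq; by_cases h : q ∈ B' <;> simp [h, hq])
      _ ≤ Λ B' + Λ (B \ B') := measure_union_le _ _
      _ = Λ B' := by rw [hnull.2, add_zero]
  have hMB : ∀ᵐ ω ∂P, M ω B = M ω B' := by
    have h0 := hM.lintegral_apply hnull.1 (by rw [hnull.2]; exact ENNReal.zero_lt_top)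
    rw [hnull.2, lintegral_eq_zero_iff (f := fun ω => M ω (B \ B'))
      ((Measure.measurable_coe hnull.1).comp hM.measurable)] at h0
    filter_upwards [h0] with ω hω
    refine le_antisymm ?_ (measure_mono inter_subset_left)
    calc M ω B ≤ M ω (B' ∪ B \ B') :=
          measure_mono (by intro q hq; by_cases h : q ∈ B' <;> simp [h, hq])
      _ ≤ M ω B' + M ω (B \ B') := measure_union_le _ _
      _ = M ω B' := by
        have : M ω (B \ B') = 0 := hω
        rw [this, add_zero]
  have hsig : noiseSigma M (Ioi (s : ℝ)) ≤ mΩ := by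
    refine iSup₂_le fun C hC => ?_
    exact ((Measure.measurable_coe hC.1).comp hM.measurable).comap_le
  have hmB : Measurable[noiseSigma M (Ioi (s : ℝ))] fun ω => M ω B' := by
    refine Measurable.mono (comap_measurable _) ?_ le_rfl
    exact le_iSup₂_of_le B' ⟨hB', inter_subset_right⟩ le_rfl
  have hind : Measurable[F s] (A.indicator (1 : Ω → ℝ≥0∞)) :=
    (@measurable_const ℝ≥0∞ Ω _ (F s) 1).indicator hA
  calc ∫⁻ ω, A.indicator (fun ω => M ω B) ω ∂P = ∫⁻ ω, M ω B' * A.indicator 1 ω ∂P := by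
        refine lintegral_congr_ae ?_
        filter_upwards [hMB] with ω hω
        by_cases h : ω ∈ A <;> simp [h, hω]
    _ = (∫⁻ ω, M ω B' ∂P) * ∫⁻ ω, A.indicator 1 ω ∂P :=
        lintegral_mul_eq_lintegral_mul_lintegral_of_independent_measurableSpace hsig (F.le s)
          (hM.indep_past s) hmB hind
    _ = P A * Λ B := by
        rw [hM.lintegral_apply hB' (hΛB ▸ hfin), hΛB, lintegral_indicator_one (F.le s _ hA), mul_comm]

/-- Induction from the rectangles, which form a π-system. Staying inside a chunk keeps all masses
finite in mean, so that complements can be treated by cancellation. -/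
theorem IsPoissonRandomMeasure.lintegral_predictable_chunk [IsProbabilityMeasure P]
    (hM : IsPoissonRandomMeasure P F Λ M) (hΛ : Λ {q | q.1 ≤ 0} = 0) (n : ℕ)
    {C : Set (Ω × NoisePoint)} (hC : MeasurableSet[predictableSigma F] C) :
    ∫⁻ ω, M ω (Prod.mk ω ⁻¹' C ∩ chunk Λ n) ∂P = ∫⁻ ω, Λ (Prod.mk ω ⁻¹' C ∩ chunk Λ n) ∂P := by
  have hT := measurableSet_chunk (Λ := Λ) n
  have hTfin := measure_chunk_lt_top (Λ := Λ) n
  have hsec : ∀ {C : Set (Ω × NoisePoint)}, MeasurableSet[predictableSigma F] C → ∀ ω,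
      MeasurableSet (Prod.mk ω ⁻¹' C : Set NoisePoint) :=
    fun hC ω => measurable_prodMk_left (predictableSigma_le F _ hC)
  have hmM : ∀ {C : Set (Ω × NoisePoint)}, MeasurableSet[predictableSigma F] C →
      AEMeasurable (fun ω => M ω (Prod.mk ω ⁻¹' C ∩ chunk Λ n)) P := fun {C} hC =>
    hM.aemeasurable_section (C := C ∩ Prod.snd ⁻¹' chunk Λ n)
      ((predictableSigma_le F _ hC).inter (measurable_snd hT))
  have hmΛ : ∀ {C : Set (Ω × NoisePoint)}, MeasurableSet[predictableSigma F] C →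
      AEMeasurable (fun ω => Λ (Prod.mk ω ⁻¹' C ∩ chunk Λ n)) P := fun {C} hC =>
    (measurable_measure_prodMk_left (s := C ∩ Prod.snd ⁻¹' chunk Λ n)
      ((predictableSigma_le F _ hC).inter (measurable_snd hT))).aemeasurable
  have htot : ∫⁻ ω, M ω (chunk Λ n) ∂P = Λ (chunk Λ n) := hM.lintegral_apply hT hTfin
  induction C, hC using MeasurableSpace.induction_on_inter (s := predictableRectangles F) with
  | h_eq => rfl
  | h_inter => exact isPiSystem_predictableRectangles F
  | empty => simp
  | basic C hC =>
    obtain ⟨s, A, B, hA, hB, hs, rfl⟩ := hC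
    have h1 : ∀ (N : Ω → Measure NoisePoint) ω, N ω (Prod.mk ω ⁻¹' A ×ˢ B ∩ chunk Λ n) =
        A.indicator (fun ω => N ω (B ∩ chunk Λ n)) ω := by
      intro N ω
      by_cases h : ω ∈ A
      · rw [indicator_of_mem h, mk_preimage_prod_right h]
      · rw [indicator_of_notMem h, mk_preimage_prod_right_eq_empty h]
        simp
    simp_rw [h1 M, h1 fun _ => Λ]
    rw [hM.lintegral_rectangle hΛ hA (hB.inter hT) (fun q hq => hs q hq.1)
      ((measure_mono inter_subset_right).trans_lt hTfin), lintegral_indicator_const (F.le s _ hA),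
      mul_comm]
  | compl C hC ih =>
    have hadd : ∀ (N : Measure NoisePoint) ω, N (Prod.mk ω ⁻¹' C ∩ chunk Λ n) +
        N (Prod.mk ω ⁻¹' Cᶜ ∩ chunk Λ n) = N (chunk Λ n) := by
      intro N ω
      rw [preimage_compl, inter_comm, inter_comm _ (chunk Λ n), ← sdiff_eq]
      exact measure_inter_add_sdiff _ (hsec hC ω)
    have e1 : ∫⁻ ω, M ω (Prod.mk ω ⁻¹' C ∩ chunk Λ n) ∂P +
        ∫⁻ ω, M ω (Prod.mk ω ⁻¹' Cᶜ ∩ chunk Λ n) ∂P = Λ (chunk Λ n) := by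
      rw [← lintegral_add_left' (hmM hC), ← htot]
      exact lintegral_congr fun ω => hadd _ ω
    have e2 : ∫⁻ ω, Λ (Prod.mk ω ⁻¹' C ∩ chunk Λ n) ∂P +
        ∫⁻ ω, Λ (Prod.mk ω ⁻¹' Cᶜ ∩ chunk Λ n) ∂P = Λ (chunk Λ n) := by
      rw [← lintegral_add_left' (hmΛ hC)]
      simp_rw [hadd]
      simp
    have hne : ∫⁻ ω, Λ (Prod.mk ω ⁻¹' C ∩ chunk Λ n) ∂P ≠ ⊤ :=
      ne_top_of_le_ne_top hTfin.ne (e2 ▸ le_self_add)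
    rw [ih, ← e2] at e1
    exact (ENNReal.add_right_inj hne).1 e1
  | iUnion f hd hf ih =>
    have hU : ∀ (N : Measure NoisePoint) ω, N (Prod.mk ω ⁻¹' (⋃ i, f i) ∩ chunk Λ n) =
        ∑' i, N (Prod.mk ω ⁻¹' f i ∩ chunk Λ n) := by
      intro N ω
      rw [preimage_iUnion, iUnion_inter, measure_iUnion]
      · intro i j hij
        exact ((hd hij).preimage _).mono inter_subset_left inter_subset_left
      · exact fun i => (hsec (hf i) ω).inter hT
    simp_rw [hU]
    rw [lintegral_tsum fun i => hmM (hf i), lintegral_tsum fun i => hmΛ (hf i)]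
    simp_rw [ih]

/-- The compensation formula for predictable sets. -/
theorem IsPoissonRandomMeasure.lintegral_predictable_set [IsProbabilityMeasure P]
    (hM : IsPoissonRandomMeasure P F Λ M) (hΛ : Λ {q | q.1 ≤ 0} = 0)
    {C : Set (Ω × NoisePoint)} (hC : MeasurableSet[predictableSigma F] C) :
    ∫⁻ ω, M ω (Prod.mk ω ⁻¹' C) ∂P = ∫⁻ ω, Λ (Prod.mk ω ⁻¹' C) ∂P := by
  have hC' := predictableSigma_le F _ hC
  have hsec : ∀ ω, MeasurableSet (Prod.mk ω ⁻¹' C : Set NoisePoint) :=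
    fun ω => measurable_prodMk_left hC'
  have hT := measurableSet_chunk (Λ := Λ)
  simp_rw [← fun N ω => tsum_measure_chunk (Λ := Λ) N (hsec ω)]
  rw [lintegral_tsum, lintegral_tsum]
  · simp_rw [hM.lintegral_predictable_chunk hΛ _ hC]
  · exact fun n => (measurable_measure_prodMk_left (s := C ∩ Prod.snd ⁻¹' chunk Λ n)
      (hC'.inter (measurable_snd (hT n)))).aemeasurable
  · exact fun n => hM.aemeasurable_section (C := C ∩ Prod.snd ⁻¹' chunk Λ n)
      (hC'.inter (measurable_snd (hT n)))

/-- The number of offspring attached to a point of the noise. -/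
def offspring (q : NoisePoint) : ℕ := q.2.2.1.2.1

theorem measurable_offspring : Measurable offspring := by
  unfold offspring
  fun_prop

/-- Splitting by the number of offspring reduces such integrals to masses of sets, for which the
compensation formula is already available. -/
theorem setLIntegral_offspring (N : Measure NoisePoint) (B : Set NoisePoint)
    (f : ℕ → ℝ≥0∞) :
    ∫⁻ q in B, f (offspring q) ∂N = ∑' k, f k * N (B ∩ offspring ⁻¹' {k}) := by
  have hf : Measurable f := measurable_from_top
  rw [← lintegral_map hf measurable_offspring, lintegral_countable']
  refine tsum_congr fun k => ?_
  rw [Measure.map_apply measurable_offspring (measurableSet_singleton k),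
    Measure.restrict_apply (measurable_offspring (measurableSet_singleton k)), inter_comm]

theorem IsPoissonRandomMeasure.aemeasurable_setLIntegral (hM : IsPoissonRandomMeasure P F Λ M)
    {C : Set (Ω × NoisePoint)} (hC : MeasurableSet C) (f : ℕ → ℝ≥0∞) :
    AEMeasurable (fun ω => ∫⁻ q in Prod.mk ω ⁻¹' C, f (offspring q) ∂(M ω)) P := by
  simp_rw [fun ω => setLIntegral_offspring (M ω) (Prod.mk ω ⁻¹' C) f]
  refine AEMeasurable.tsum fun k => AEMeasurable.const_mul ?_ _
  exact hM.aemeasurable_section (C := C ∩ Prod.snd ⁻¹' (offspring ⁻¹' {k}))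
    (hC.inter (measurable_snd (measurable_offspring (measurableSet_singleton k))))

/-- The compensation formula for integrands that depend on the number of offspring only. -/
theorem IsPoissonRandomMeasure.lintegral_setLIntegral [IsProbabilityMeasure P]
    (hM : IsPoissonRandomMeasure P F Λ M) (hΛ : Λ {q | q.1 ≤ 0} = 0)
    {C : Set (Ω × NoisePoint)} (hC : MeasurableSet[predictableSigma F] C) (f : ℕ → ℝ≥0∞) :
    ∫⁻ ω, ∫⁻ q in Prod.mk ω ⁻¹' C, f (offspring q) ∂(M ω) ∂P =
      ∫⁻ ω, ∫⁻ q in Prod.mk ω ⁻¹' C, f (offspring q) ∂Λ ∂P := by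
  have hC' := predictableSigma_le F _ hC
  have hk : ∀ k : ℕ, MeasurableSet (offspring ⁻¹' {k}) :=
    fun k => measurable_offspring (measurableSet_singleton k)
  have hCk : ∀ k, MeasurableSet (C ∩ Prod.snd ⁻¹' (offspring ⁻¹' {k})) :=
    fun k => hC'.inter (measurable_snd (hk k))
  simp_rw [fun (N : Measure NoisePoint) ω =>
    setLIntegral_offspring N (Prod.mk ω ⁻¹' C) f]
  have hm1 : ∀ k, AEMeasurable (fun ω => M ω (Prod.mk ω ⁻¹' C ∩ offspring ⁻¹' {k})) P :=
    fun k => hM.aemeasurable_section (hCk k)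
  have hm2 : ∀ k, Measurable (fun ω => Λ (Prod.mk ω ⁻¹' C ∩ offspring ⁻¹' {k})) :=
    fun k => measurable_measure_prodMk_left (hCk k)
  rw [lintegral_tsum fun k => (hm1 k).const_mul _,
    lintegral_tsum fun k => ((hm2 k).const_mul _).aemeasurable]
  refine tsum_congr fun k => ?_
  rw [lintegral_const_mul'' _ (hm1 k), lintegral_const_mul _ (hm2 k)]
  congr 1
  exact hM.lintegral_predictable_set hΛ
    (hC.inter (measurable_snd_predictable F (hk k)))

end RandomMeasure

/-! ### Quantile transform and reproduction rates. -/

section Rates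

variable {α : ℝ → ℝ} {p : ℝ → ℕ → ℝ}

/-- The measure `α(x) ν(dx)` on `(0,∞)`. -/
def rateMeasure (α : ℝ → ℝ) (ν : FiniteMeasure ℝ) : Measure ℝ :=
  ((ν : Measure ℝ).restrict (Ioi 0)).withDensity ((Ioi 0).indicator fun x => ENNReal.ofReal (α x))

theorem IsC1Plus.measurable_indicator {f : ℝ → ℝ} (hf : IsC1Plus f) :
    Measurable ((Ioi 0).indicator f) := by
  classical
  rw [← piecewise_eq_indicator]
  exact hf.contDiffOn.continuousOn.measurable_piecewise continuousOn_const measurableSet_Ioi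

theorem IsC1Plus.measurable_ofReal {f : ℝ → ℝ} (hf : IsC1Plus f) :
    Measurable ((Ioi 0).indicator fun x => ENNReal.ofReal (f x)) := by
  convert hf.measurable_indicator.ennreal_ofReal using 1
  ext x
  by_cases hx : x ∈ Ioi (0 : ℝ) <;> simp [hx, indicator]

theorem rateMeasure_apply (α : ℝ → ℝ) (ν : FiniteMeasure ℝ) {s : Set ℝ} (hs : MeasurableSet s) :
    rateMeasure α ν s = ∫⁻ x, (s ∩ Ioi 0).indicator (fun x => ENNReal.ofReal (α x)) x ∂ν := by
  rw [rateMeasure, withDensity_apply _ hs, Measure.restrict_restrict hs,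
    lintegral_indicator (hs.inter measurableSet_Ioi)]
  refine setLIntegral_congr_fun (hs.inter measurableSet_Ioi) fun x hx => ?_
  exact indicator_of_mem hx.2 _

theorem rateMeasure_univ_le {b : ℝ≥0∞} (hb : ∀ x, 0 < x → ENNReal.ofReal (α x) ≤ b)
    (ν : FiniteMeasure ℝ) : rateMeasure α ν univ ≤ b * (ν : Measure ℝ) univ := by
  rw [rateMeasure_apply _ _ MeasurableSet.univ, ← lintegral_const]
  refine lintegral_mono fun x => ?_
  by_cases hx : 0 < x
  · simpa [indicator, hx] using hb x hx
  · simp [indicator, hx]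

theorem isFiniteMeasure_rateMeasure (hα : IsC1Plus α) (ν : FiniteMeasure ℝ) :
    IsFiniteMeasure (rateMeasure α ν) := by
  obtain ⟨C, hC⟩ := hα.bounded
  refine ⟨(rateMeasure_univ_le (b := ENNReal.ofReal C)
    (fun x hx => ENNReal.ofReal_le_ofReal (hC x hx)) ν).trans_lt ?_⟩
  exact ENNReal.mul_lt_top ENNReal.ofReal_lt_top (measure_lt_top _ _)

theorem pairing_indicator (hα : IsC1Plus α) (ν : FiniteMeasure ℝ) (z : ℝ) :
    pairing ν ((Ioc 0 z).indicator α) = (rateMeasure α ν (Iic z)).toReal := by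
  rw [pairing, rateMeasure_apply _ _ measurableSet_Iic, ← integral_indicator measurableSet_Ioi,
    integral_eq_lintegral_of_nonneg_ae]
  · congr 1
    refine lintegral_congr fun x => ?_
    simp only [indicator, mem_Ioi, mem_Ioc, mem_inter_iff, mem_Iic]
    split_ifs <;> simp_all
  · refine Eventually.of_forall fun x => ?_
    simp only [indicator, mem_Ioi, mem_Ioc, Pi.zero_apply]
    split_ifs with h1 h2
    · exact hα.nonneg x h1
    · exact le_rfl
    · exact le_rfl
  · refine Measurable.aestronglyMeasurable ?_
    convert hα.measurable_indicator.indicator (measurableSet_Ioc (a := (0 : ℝ)) (b := z)) using 1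
    ext x
    simp only [indicator, mem_Ioi, mem_Ioc]
    split_ifs <;> simp_all

theorem pairing_eq (hα : IsC1Plus α) (ν : FiniteMeasure ℝ) :
    pairing ν α = (rateMeasure α ν univ).toReal := by
  rw [pairing, rateMeasure_apply _ _ MeasurableSet.univ, ← integral_indicator measurableSet_Ioi,
    integral_eq_lintegral_of_nonneg_ae]
  · congr 1
    refine lintegral_congr fun x => ?_
    simp only [indicator, mem_Ioi, mem_inter_iff, mem_univ, true_and]
    split_ifs <;> simp_all
  · refine Eventually.of_forall fun x => ?_
    exact indicator_nonneg (fun x hx => hα.nonneg x hx) x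
  · exact hα.measurable_indicator.aestronglyMeasurable

theorem measurable_rateMeasure_apply (hα : IsC1Plus α) {s : Set ℝ} (hs : MeasurableSet s) :
    Measurable fun ν : FiniteMeasure ℝ => rateMeasure α ν s := by
  simp_rw [fun ν => rateMeasure_apply α ν hs]
  refine (Measure.measurable_lintegral ?_).comp measurable_subtype_coe
  rw [← indicator_indicator]
  exact hα.measurable_ofReal.indicator hs

/-- The condition on `z` persists when `z` grows, so rational `z` suffice; a countable infimum is
measurable jointly in the population and `y`. -/
theorem parentLife_eq (hα : IsC1Plus α) (ν : FiniteMeasure ℝ) (y : ℝ) :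
    parentLife α ν y = ⨅ z : ℚ, if 0 ≤ z ∧
      (rateMeasure α ν univ).toReal * y < (rateMeasure α ν (Iic (z : ℝ))).toReal
      then ENNReal.ofReal z else ⊤ := by
  have := isFiniteMeasure_rateMeasure hα ν
  unfold parentLife
  simp_rw [pairing_eq hα, pairing_indicator hα]
  refine le_antisymm (le_iInf fun z => ?_) (le_iInf₂ fun z hz => ?_)
  · split_ifs with h
    · refine iInf₂_le_of_le (z : ℝ).toNNReal ?_ le_rfl
      rw [Real.coe_toNNReal _ (by exact_mod_cast h.1)]
      exact h.2
    · exact le_top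
  · refine ENNReal.le_of_forall_pos_le_add fun ε hε _ => ?_
    obtain ⟨x, hx1, hx2⟩ := exists_rat_btwn (show (z : ℝ) < z + ε by simpa using hε)
    refine iInf_le_of_le x ?_
    rw [if_pos]
    · rw [← ENNReal.coe_add, ← ENNReal.ofReal_coe_nnreal]
      exact ENNReal.ofReal_le_ofReal (by push_cast; exact hx2.le)
    · refine ⟨by exact_mod_cast z.2.trans hx1.le, hz.trans_le ?_⟩
      exact ENNReal.toReal_mono (measure_ne_top _ _) (measure_mono (Iic_subset_Iic.2 hx1.le))

theorem measurable_parentLife (hα : IsC1Plus α) :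
    Measurable fun x : FiniteMeasure ℝ × ℝ => parentLife α x.1 x.2 := by
  simp_rw [parentLife_eq hα]
  refine Measurable.iInf fun z => Measurable.ite ?_ measurable_const measurable_const
  rw [ofPred_and]
  refine (MeasurableSet.const _).inter (measurableSet_lt ?_ ?_)
  · exact (((measurable_rateMeasure_apply hα MeasurableSet.univ).comp
      measurable_fst).ennreal_toReal).mul measurable_snd
  · exact ((measurable_rateMeasure_apply hα measurableSet_Iic).comp measurable_fst).ennreal_toReal

/-- The quantile transform: `A_α(ν,·)` maps Lebesgue measure on `(0,1]` to the normalisation of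
`α(x) ν(dx)`. -/
theorem map_parentLife (hα : IsC1Plus α) (ν : FiniteMeasure ℝ) (hc : rateMeasure α ν univ ≠ 0) :
    rateMeasure α ν univ • (volume.restrict (Ioc (0 : ℝ) 1)).map (parentLife α ν) =
      (rateMeasure α ν).map ENNReal.ofReal := by
  have := isFiniteMeasure_rateMeasure hα ν
  have hA : Measurable (parentLife α ν) := 
    Measurable.of_uncurry_left (f := parentLife α) (measurable_parentLife hα)
  have hct : rateMeasure α ν univ ≠ ⊤ := measure_ne_top _ _
  set c := (rateMeasure α ν univ).toReal with hcdef
  have hcpos : 0 < c := ENNReal.toReal_pos hc hct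
  have hfin : IsFiniteMeasure
      (rateMeasure α ν univ • (volume.restrict (Ioc (0 : ℝ) 1)).map (parentLife α ν)) := by
    refine ⟨?_⟩
    rw [Measure.smul_apply, Measure.map_apply hA MeasurableSet.univ]
    simp [hct.lt_top]
  refine Measure.ext_of_Iic _ _ fun a => ?_
  rw [Measure.smul_apply, Measure.map_apply hA measurableSet_Iic,
    Measure.map_apply ENNReal.measurable_ofReal measurableSet_Iic, smul_eq_mul]
  induction a using ENNReal.recTopCoe with
  | top => simp
  | coe z =>
    have hR : ENNReal.ofReal ⁻¹' Iic (z : ℝ≥0∞) = Iic (z : ℝ) := by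
      ext x
      simp only [mem_preimage, mem_Iic]
      rw [← ENNReal.ofReal_coe_nnreal, ENNReal.ofReal_le_ofReal_iff z.coe_nonneg]
    rw [hR]
    set f := (rateMeasure α ν (Iic (z : ℝ))).toReal with hf
    have hfc : f ≤ c := ENNReal.toReal_mono hct (measure_mono (subset_univ _))
    have hmono : ∀ a b : ℝ, a ≤ b →
        (rateMeasure α ν (Iic a)).toReal ≤ (rateMeasure α ν (Iic b)).toReal := fun a b hab =>
      ENNReal.toReal_mono (measure_ne_top _ _) (measure_mono (Iic_subset_Iic.2 hab))
    -- The preimage of `Iic z` lies between `Iio (f / c)` and `Iic (f / c)`, which differ by one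
    -- Lebesgue-null point. The second inclusion needs right-continuity, because the infimum
    -- defining `parentLife` may not be attained.
    have hsub : Iio (f / c) ⊆ parentLife α ν ⁻¹' Iic (z : ℝ≥0∞) := by
      intro y hy
      have hy' : c * y < f := by rwa [mem_Iio, lt_div_iff₀ hcpos, mul_comm] at hy
      change parentLife α ν y ≤ z
      refine iInf₂_le z ?_
      rwa [pairing_eq hα, pairing_indicator hα]
    have hsup : parentLife α ν ⁻¹' Iic (z : ℝ≥0∞) ⊆ Iic (f / c) := by
      intro y hy
      rw [mem_Iic, le_div_iff₀ hcpos, mul_comm]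
      have hlt : ∀ n : ℕ, c * y ≤ (rateMeasure α ν (Iic (z + 1 / ((n : ℝ) + 1)))).toReal := by
        intro n
        have hpos : (0 : ℝ) < 1 / ((n : ℝ) + 1) := by positivity
        have h1 : parentLife α ν y < ENNReal.ofReal (z + 1 / ((n : ℝ) + 1)) := by
          refine lt_of_le_of_lt hy ?_
          rw [← ENNReal.ofReal_coe_nnreal]
          exact (ENNReal.ofReal_lt_ofReal_iff (by positivity)).2 (by linarith)
        simp only [parentLife, iInf_lt_iff] at h1
        obtain ⟨w, hw, hw'⟩ := h1
        rw [pairing_eq hα, pairing_indicator hα] at hw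
        refine hw.le.trans (hmono _ _ ?_)
        rw [← ENNReal.ofReal_coe_nnreal] at hw'
        exact (ENNReal.ofReal_lt_ofReal_iff (by positivity)).1 hw' |>.le
      have hlim : Tendsto (fun n : ℕ => (rateMeasure α ν (Iic (z + 1 / ((n : ℝ) + 1)))).toReal)
          atTop (𝓝 f) := by
        refine (ENNReal.tendsto_toReal (measure_ne_top _ _)).comp ?_
        exact tendsto_measure_Iic_add _ _
      exact ge_of_tendsto' hlim hlt
    have h01 : 0 ≤ f / c ∧ f / c ≤ 1 :=
      ⟨div_nonneg ENNReal.toReal_nonneg hcpos.le, (div_le_one hcpos).2 hfc⟩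
    have hvol : (volume.restrict (Ioc (0 : ℝ) 1)) (parentLife α ν ⁻¹' Iic (z : ℝ≥0∞)) =
        ENNReal.ofReal (f / c) := by
      rw [Measure.restrict_apply (hA measurableSet_Iic)]
      refine le_antisymm ?_ ?_
      · calc volume (parentLife α ν ⁻¹' Iic (z : ℝ≥0∞) ∩ Ioc 0 1) ≤ volume (Ioc 0 (f / c)) :=
              measure_mono fun y hy => ⟨hy.2.1, hsup hy.1⟩
          _ = _ := by simp
      · calc ENNReal.ofReal (f / c) = volume (Ioo 0 (f / c)) := by simp
          _ ≤ volume (parentLife α ν ⁻¹' Iic (z : ℝ≥0∞) ∩ Ioc 0 1) :=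
              measure_mono fun y hy => ⟨hsub hy.2, hy.1, hy.2.le.trans h01.2⟩
    rw [hvol, ← ENNReal.ofReal_toReal hct, ← hcdef, ← ENNReal.ofReal_mul hcpos.le,
      mul_div_cancel₀ _ hcpos.ne', hf, ENNReal.ofReal_toReal (measure_ne_top _ _)]

theorem IsBranchingMechanism.measurable_offspringProb (h : IsBranchingMechanism α p) :
    Measurable fun x : ℝ≥0∞ × ℕ => offspringProb p x.1 x.2 := by
  refine measurable_from_prod_countable_left fun n => ?_
  have he : (fun a : ℝ≥0∞ => offspringProb p a n) =
      fun a => if 0 < a ∧ a < ⊤ then (Ioi 0).indicator (fun x => p x n) a.toReal else 0 := by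
    funext a
    unfold offspringProb
    split_ifs with ha
    · rw [indicator_of_mem]
      exact ENNReal.toReal_pos ha.1.ne' ha.2.ne
    · rfl
  rw [he]
  refine Measurable.ite ?_ ((h.prob n).measurable_indicator.comp ENNReal.measurable_toReal)
    measurable_const
  exact measurableSet_Ioo (a := (0 : ℝ≥0∞)) (b := ⊤)

/-- The marks `(u,w,v)` of the noise that cause a reproduction in a population `ν` of mass at
most `K`. -/
def reproduces (α : ℝ → ℝ) (p : ℝ → ℕ → ℝ) (K : ℝ≥0∞) (ν : FiniteMeasure ℝ) :
    Set (ℝ × Mark × ℝ) :=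
  {r | (ν : Measure ℝ) univ ≤ K ∧ r.1 ∈ Ioc 0 (pairing ν α) ∧
    r.2.2 ∈ Ioc 0 (offspringProb p (parentLife α ν r.2.1.1) r.2.1.2.1)}

theorem measurable_pairing (hα : IsC1Plus α) : Measurable fun ν => pairing ν α := by
  simp_rw [pairing_eq hα]
  exact (measurable_rateMeasure_apply hα MeasurableSet.univ).ennreal_toReal

theorem IsBranchingMechanism.measurable_birthProb (h : IsBranchingMechanism α p) :
    Measurable fun x : FiniteMeasure ℝ × ℝ × ℕ =>
      offspringProb p (parentLife α x.1 x.2.1) x.2.2 :=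
  h.measurable_offspringProb.comp
    (((measurable_parentLife h.rate).comp
      (measurable_fst.prodMk (measurable_fst.comp measurable_snd))).prodMk
        (measurable_snd.comp measurable_snd))

theorem IsBranchingMechanism.measurableSet_reproduces (h : IsBranchingMechanism α p) (K : ℝ≥0∞) :
    MeasurableSet {x : FiniteMeasure ℝ × (ℝ × Mark × ℝ) | x.2 ∈ reproduces α p K x.1} := by
  have h1 : Measurable fun x : FiniteMeasure ℝ × (ℝ × Mark × ℝ) => (x.1 : Measure ℝ) univ :=
    (measurable_finiteMeasure_apply MeasurableSet.univ).comp measurable_fst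
  have h2 : Measurable fun x : FiniteMeasure ℝ × (ℝ × Mark × ℝ) => pairing x.1 α :=
    (measurable_pairing h.rate).comp measurable_fst
  have h3 : Measurable fun x : FiniteMeasure ℝ × (ℝ × Mark × ℝ) =>
      offspringProb p (parentLife α x.1 x.2.2.1.1) x.2.2.1.2.1 :=
    h.measurable_birthProb.comp (g := fun x : FiniteMeasure ℝ × ℝ × ℕ =>
      offspringProb p (parentLife α x.1 x.2.1) x.2.2)
      (f := fun x : FiniteMeasure ℝ × (ℝ × Mark × ℝ) => (x.1, x.2.2.1.1, x.2.2.1.2.1))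
      (by fun_prop)
  have m1 : Measurable fun x : FiniteMeasure ℝ × (ℝ × Mark × ℝ) => x.2.1 := by fun_prop
  have m2 : Measurable fun x : FiniteMeasure ℝ × (ℝ × Mark × ℝ) => x.2.2.2 := by fun_prop
  exact (measurableSet_le h1 measurable_const).inter
    (((measurableSet_lt measurable_const m1).inter (measurableSet_le m1 h2)).inter
      ((measurableSet_lt measurable_const m2).inter (measurableSet_le m2 h3)))

/-- The part of the intensity that refers to the marks. -/
def tailIntensity (G : Measure ℝ) [IsProbabilityMeasure G] : Measure (ℝ × Mark × ℝ) :=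
  (volume.restrict (Ioi (0 : ℝ))).prod
    ((markMeasure G).prod (volume.restrict (Ioc (0 : ℝ) 1)))

variable (G : Measure ℝ) [IsProbabilityMeasure G]

instance : SigmaFinite (markMeasure G) := by
  unfold markMeasure
  infer_instance

instance : SigmaFinite (tailIntensity G) := by
  unfold tailIntensity
  infer_instance

instance : SigmaFinite (intensity G) := by
  unfold intensity
  infer_instance

theorem intensity_eq : intensity G = (volume.restrict (Ioi (0 : ℝ))).prod (tailIntensity G) := rfl

theorem intensity_nonpos : intensity G {q | q.1 ≤ 0} = 0 := by
  have : {q : NoisePoint | q.1 ≤ 0} = Iic 0 ×ˢ univ := by ext; simp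
  rw [intensity_eq, this, Measure.prod_prod, Measure.restrict_apply measurableSet_Iic,
    Iic_inter_Ioi, Ioc_self, measure_empty, zero_mul]

/-- Integrating out `u` gives `⟨ν,α⟩`, integrating out `v` gives the offspring probability, the
lifetimes have total mass one, and the counting measure yields the sum over `n`. Dropping the
truncation at `K` and the bound `v ≤ 1` leaves an inequality. -/
theorem lintegral_reproduces_le_parent (h : IsBranchingMechanism α p) (ν : FiniteMeasure ℝ)
    (K : ℝ≥0∞) (f : ℕ → ℝ≥0∞) :
    ∫⁻ r in reproduces α p K ν, f r.2.1.2.1 ∂(tailIntensity G) ≤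
      ENNReal.ofReal (pairing ν α) * ∫⁻ y in Ioc (0 : ℝ) 1,
        ∑' n, f n * ENNReal.ofReal (offspringProb p (parentLife α ν y) n) := by
  have hf : Measurable f := measurable_from_top
  have hprob : Measurable fun w : Mark => offspringProb p (parentLife α ν w.1) w.2.1 :=
    h.measurable_birthProb.comp (g := fun x : FiniteMeasure ℝ × ℝ × ℕ =>
      offspringProb p (parentLife α x.1 x.2.1) x.2.2)
      (f := fun w : Mark => (ν, w.1, w.2.1)) (by fun_prop)
  have hrep : MeasurableSet (reproduces α p K ν) :=
    measurable_prodMk_left (x := ν) (h.measurableSet_reproduces K)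
  let S : Set (Mark × ℝ) :=
    {x | 0 < x.2 ∧ x.2 ≤ offspringProb p (parentLife α ν x.1.1) x.1.2.1}
  have hS : MeasurableSet S := (measurableSet_lt measurable_const measurable_snd).inter
    (measurableSet_le measurable_snd (hprob.comp measurable_fst))
  let g : Mark × ℝ → ℝ≥0∞ := S.indicator fun x => f x.1.2.1
  have hfn : Measurable fun x : Mark × ℝ => f x.1.2.1 := hf.comp (by fun_prop)
  have hg : Measurable g := hfn.indicator hS
  have hfprob : Measurable fun w : Mark =>
      f w.2.1 * ENNReal.ofReal (offspringProb p (parentLife α ν w.1) w.2.1) :=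
    (hf.comp (by fun_prop)).mul hprob.ennreal_ofReal
  calc ∫⁻ r in reproduces α p K ν, f r.2.1.2.1 ∂(tailIntensity G)
      = ∫⁻ r, (reproduces α p K ν).indicator (fun r => f r.2.1.2.1) r ∂(tailIntensity G) :=
        (lintegral_indicator hrep _).symm
    _ ≤ ∫⁻ r : ℝ × Mark × ℝ, (Ioc 0 (pairing ν α)).indicator 1 r.1 * g r.2 ∂(tailIntensity G) := by
        refine lintegral_mono fun r => ?_
        by_cases hr : r ∈ reproduces α p K ν
        · have h1 : r.1 ∈ Ioc 0 (pairing ν α) := hr.2.1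
          have h2 : r.2 ∈ S := hr.2.2
          simp [indicator_of_mem hr, indicator_of_mem h1, g, indicator_of_mem h2]
        · simp [indicator_of_notMem hr]
    _ = (∫⁻ u, (Ioc 0 (pairing ν α)).indicator 1 u ∂(volume.restrict (Ioi (0 : ℝ)))) *
          ∫⁻ x, g x ∂((markMeasure G).prod (volume.restrict (Ioc (0 : ℝ) 1))) :=
        lintegral_prod_mul (measurable_one.indicator measurableSet_Ioc).aemeasurable
          hg.aemeasurable
    _ ≤ ENNReal.ofReal (pairing ν α) * ∫⁻ w,
          f w.2.1 * ENNReal.ofReal (offspringProb p (parentLife α ν w.1) w.2.1)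
            ∂(markMeasure G) := by
        refine mul_le_mul' ?_ ?_
        · rw [lintegral_indicator_one measurableSet_Ioc, Measure.restrict_apply measurableSet_Ioc]
          calc _ ≤ volume (Ioc 0 (pairing ν α)) := measure_mono inter_subset_left
            _ = _ := by simp
        · rw [lintegral_prod _ hg.aemeasurable]
          refine lintegral_mono fun w => ?_
          set c := offspringProb p (parentLife α ν w.1) w.2.1 with hc
          calc ∫⁻ v in Ioc (0 : ℝ) 1, g (w, v)
              = ∫⁻ v in Ioc (0 : ℝ) 1, (Ioc 0 c).indicator (fun _ => f w.2.1) v := rfl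
            _ = f w.2.1 * (volume.restrict (Ioc (0 : ℝ) 1)) (Ioc 0 c) :=
                lintegral_indicator_const measurableSet_Ioc _
            _ ≤ f w.2.1 * ENNReal.ofReal c := by
                gcongr
                calc _ ≤ volume (Ioc 0 c) := Measure.restrict_apply_le _ _
                  _ = _ := by simp
    _ = _ := by
        congr 1
        rw [markMeasure, lintegral_prod _ hfprob.aemeasurable]
        refine lintegral_congr fun y => ?_
        have hy : Measurable fun w : ℕ × (ℕ → ℝ) =>
            f w.1 * ENNReal.ofReal (offspringProb p (parentLife α ν y) w.1) :=
          hfprob.comp measurable_prodMk_left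
        change ∫⁻ w, f w.1 * ENNReal.ofReal (offspringProb p (parentLife α ν y) w.1)
          ∂Measure.count.prod (Measure.infinitePi fun _ => G) = _
        rw [lintegral_prod _ hy.aemeasurable, lintegral_count]
        simp

/-- If `α(x) ∑ f(n) p(x,n) ≤ b` for all `x`, then reproductions weighted by `f` occur in a
population `ν` at rate at most `b ν(ℝ)`. -/
theorem lintegral_reproduces_le (h : IsBranchingMechanism α p) (ν : FiniteMeasure ℝ)
    (K : ℝ≥0∞) (f : ℕ → ℝ≥0∞) {b : ℝ≥0∞}
    (hb : ∀ x, 0 < x → ENNReal.ofReal (α x) * ∑' n, f n * ENNReal.ofReal (p x n) ≤ b) :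
    ∫⁻ r in reproduces α p K ν, f r.2.1.2.1 ∂(tailIntensity G) ≤ b * (ν : Measure ℝ) univ := by
  have := isFiniteMeasure_rateMeasure h.rate ν
  refine (lintegral_reproduces_le_parent G h ν K f).trans ?_
  rw [pairing_eq h.rate, ENNReal.ofReal_toReal (measure_ne_top _ _)]
  by_cases hc : rateMeasure α ν univ = 0
  · simp [hc]
  let m : ℝ≥0∞ → ℝ≥0∞ := fun a => ∑' n, f n * ENNReal.ofReal (offspringProb p a n)
  have hm : Measurable m := by
    refine Measurable.tsum fun n => Measurable.const_mul ?_ _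
    exact (h.measurable_offspringProb.comp measurable_prodMk_right).ennreal_ofReal
  have hA : Measurable (parentLife α ν) :=
    Measurable.of_uncurry_left (f := parentLife α) (measurable_parentLife h.rate)
  -- The factor `⟨ν,α⟩` cancels the normalisation in the quantile transform; what remains is an
  -- integral against `ν` to which the pointwise bound applies.
  calc rateMeasure α ν univ * ∫⁻ y in Ioc (0 : ℝ) 1, m (parentLife α ν y)
      = ∫⁻ a, m a ∂(rateMeasure α ν univ •
          (volume.restrict (Ioc (0 : ℝ) 1)).map (parentLife α ν)) := by
        rw [lintegral_smul_measure, lintegral_map hm hA, smul_eq_mul]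
    _ = ∫⁻ x, m (ENNReal.ofReal x) ∂(rateMeasure α ν) := by
        rw [map_parentLife h.rate ν hc, lintegral_map hm ENNReal.measurable_ofReal]
    _ = ∫⁻ x in Ioi 0, (Ioi 0).indicator (fun x => ENNReal.ofReal (α x)) x *
          m (ENNReal.ofReal x) ∂(ν : Measure ℝ) := by
        exact lintegral_withDensity_eq_lintegral_mul _ h.rate.measurable_ofReal
          (hm.comp ENNReal.measurable_ofReal)
    _ ≤ ∫⁻ x in Ioi 0, b ∂(ν : Measure ℝ) := by
        refine setLIntegral_mono measurable_const fun x hx => ?_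
        have hx' : (0 : ℝ) < x := hx
        rw [indicator_of_mem hx]
        refine le_trans (le_of_eq ?_) (hb x hx')
        simp [m, offspringProb, hx', ENNReal.toReal_ofReal hx'.le]
    _ ≤ ∫⁻ x, b ∂(ν : Measure ℝ) := setLIntegral_le_lintegral _ _
    _ = b * (ν : Measure ℝ) univ := lintegral_const _

end Rates

/-! ### Event sets of a path, and deterministic uniqueness. -/

section Events

variable {α : ℝ → ℝ} {p : ℝ → ℕ → ℝ}

/-- The index `j` of the last dyadic point `j / 2 ^ n` strictly before `s`. -/
def gridIndex (n : ℕ) (s : ℝ) : ℕ := ⌈s * 2 ^ n⌉₊ - 1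

/-- The last dyadic point of order `n` strictly before `s`. -/
def gridPoint (n : ℕ) (s : ℝ) : ℝ≥0 := gridIndex n s / 2 ^ n

theorem gridIndex_lt {n : ℕ} {s : ℝ} (hs : 0 < s) : (gridIndex n s : ℝ) < s * 2 ^ n := by
  have h1 : 0 < s * 2 ^ n := by positivity
  have h2 := Nat.ceil_lt_add_one h1.le
  have h3 : 0 < ⌈s * 2 ^ n⌉₊ := Nat.ceil_pos.2 h1
  have h4 : (gridIndex n s : ℝ) = (⌈s * 2 ^ n⌉₊ : ℝ) - 1 := by
    rw [gridIndex, Nat.cast_sub h3]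
    simp
  rw [h4]
  linarith

theorem le_gridIndex {n : ℕ} {s : ℝ} : s * 2 ^ n - 1 ≤ gridIndex n s := by
  have h2 := Nat.le_ceil (s * 2 ^ n)
  have h3 : (⌈s * 2 ^ n⌉₊ : ℝ) ≤ gridIndex n s + 1 := by
    rw [gridIndex]
    have : ⌈s * 2 ^ n⌉₊ ≤ (⌈s * 2 ^ n⌉₊ - 1) + 1 := by omega
    exact_mod_cast this
  linarith

theorem gridPoint_lt {n : ℕ} {s : ℝ} (hs : 0 < s) : (gridPoint n s : ℝ) < s := by
  have := gridIndex_lt (n := n) hs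
  rw [gridPoint]
  push_cast
  rwa [div_lt_iff₀ (by positivity)]

theorem tendsto_gridPoint {s : ℝ≥0} (hs : 0 < s) :
    Tendsto (fun n => gridPoint n s) atTop (𝓝[<] s) := by
  have hs' : (0 : ℝ) < s := by exact_mod_cast hs
  refine tendsto_nhdsWithin_iff.2 ⟨?_, Eventually.of_forall fun n => ?_⟩
  · rw [← NNReal.tendsto_coe]
    have h0 : Tendsto (fun n : ℕ => (s : ℝ) - (1 / 2) ^ n) atTop (𝓝 (s - 0)) :=
      (tendsto_pow_atTop_nhds_zero_of_lt_one (by norm_num) (by norm_num)).const_sub _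
    rw [sub_zero] at h0
    refine tendsto_of_tendsto_of_tendsto_of_le_of_le h0 tendsto_const_nhds (fun n => ?_)
      fun n => (gridPoint_lt hs').le
    have := le_gridIndex (n := n) (s := s)
    rw [gridPoint]
    push_cast
    rw [le_div_iff₀ (by positivity), sub_mul, ← mul_pow]
    norm_num
    linarith
  · exact_mod_cast gridPoint_lt (n := n) hs'

/-- A version of the left limit that is defined for every path. -/
def leftVersion (X : ℝ≥0 → LifeMeasure) (s : ℝ) : FiniteMeasure ℝ :=
  limsupMeasure fun n => (X (gridPoint n s)).1

theorem leftVersion_eq {X : ℝ≥0 → LifeMeasure} {s : ℝ≥0} (hs : 0 < s) (hX : CadlagAt X s) :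
    leftVersion X s = leftLimit X s :=
  limsupMeasure_eq_of_tendsto ((hX.tendsto_leftLimit hs).comp (tendsto_gridPoint hs))

/-- Where the grid index is `j`, the approximation is the state at `j / 2 ^ n`, strictly earlier
than every positive time in that slab; hence preimages are countable unions of predictable
rectangles. Nonpositive times all fall in the slab `j = 0`, where rectangles are unrestricted. -/
theorem measurable_leftVersion {Ω : Type*} {mΩ : MeasurableSpace Ω} {F : Filtration ℝ≥0 mΩ}
    {X : ℝ≥0 → Ω → LifeMeasure} (hX : ∀ t, Measurable[F t] (X t)) :
    Measurable[predictableSigma F] fun x : Ω × NoisePoint =>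
      leftVersion (fun r => X r x.1) x.2.1 := by
  refine @measurable_limsupMeasure _ (predictableSigma F) _ fun n => ?_
  intro B hB
  have hidx : ∀ j, MeasurableSet {q : NoisePoint | gridIndex n q.1 = j} := by
    intro j
    have : Measurable fun q : NoisePoint => gridIndex n q.1 := by
      unfold gridIndex
      exact (measurable_from_top (f := fun k : ℕ => k - 1)).comp
        (Nat.measurable_ceil.comp (measurable_fst.mul_const _))
    exact this (measurableSet_singleton j)
  have hU : (fun x : Ω × NoisePoint => (X (gridPoint n x.2.1) x.1).1) ⁻¹' B =
      ⋃ j : ℕ, ((fun ω => (X (j / 2 ^ n) ω).1) ⁻¹' B) ×ˢ {q : NoisePoint | gridIndex n q.1 = j} := by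
    ext x
    simp only [mem_preimage, mem_iUnion, mem_prod, mem_ofPred_eq, exists_eq_right', gridPoint]
  rw [hU]
  refine MeasurableSet.iUnion fun j => MeasurableSpace.measurableSet_generateFrom
    ⟨j / 2 ^ n, _, _, (measurable_subtype_coe.comp (hX _)) hB, hidx j, ?_, rfl⟩
  intro q hq
  by_cases hj : j = 0
  · left
    simp [hj]
  · right
    have hpos : 0 < q.1 := by
      by_contra h
      apply hj
      have hle : q.1 * 2 ^ n ≤ 0 := mul_nonpos_of_nonpos_of_nonneg (not_lt.1 h) (by positivity)
      have : gridIndex n q.1 = 0 := by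
        rw [gridIndex, Nat.ceil_eq_zero.2 hle]
      rw [← this]
      exact hq.symm
    have := gridPoint_lt (n := n) hpos
    rw [gridPoint, show gridIndex n q.1 = j from hq] at this
    exact this

/-- The reproduction events of a path, restricted to the times when the mass of the population is
at most `K`. -/
def eventSet (α : ℝ → ℝ) (p : ℝ → ℕ → ℝ) (K : ℝ≥0∞) (X : ℝ≥0 → LifeMeasure) : Set NoisePoint :=
  {q | 0 < q.1 ∧ q.2 ∈ reproduces α p K (leftVersion X q.1)}

/-- The reproduction events up to time `t`, restricted to the times when the mass of the population
is at most `K`. -/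
def truncEvents (α : ℝ → ℝ) (p : ℝ → ℕ → ℝ) (K : ℝ≥0∞) (X : ℝ≥0 → LifeMeasure) (t : ℝ≥0) :
    Set NoisePoint :=
  {q | q.1 ∈ Ioc 0 (t : ℝ) ∧ q.2 ∈ reproduces α p K (leftLimit X q.1.toNNReal)}

theorem truncEvents_top (X : ℝ≥0 → LifeMeasure) (t : ℝ≥0) :
    truncEvents α p ⊤ X t = birthEvents α p X t := by
  ext q
  simp [truncEvents, birthEvents, reproduces]

theorem truncEvents_mono_time (K : ℝ≥0∞) (X : ℝ≥0 → LifeMeasure) {s t : ℝ≥0} (h : s ≤ t) :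
    truncEvents α p K X s ⊆ truncEvents α p K X t :=
  fun _ hq => ⟨⟨hq.1.1, hq.1.2.trans (by exact_mod_cast h)⟩, hq.2⟩

/-- A point at time `s` is tested only against the left limit at `s`, so the events up to and
including `t` are fixed by the path strictly before `t`. -/
theorem truncEvents_congr_path (K : ℝ≥0∞) {X Y : ℝ≥0 → LifeMeasure} {t : ℝ≥0}
    (hX : ∀ s ≤ t, CadlagAt X s) (h : ∀ s < t, X s = Y s) :
    truncEvents α p K X t = truncEvents α p K Y t := by
  ext q
  refine and_congr_right fun hq => ?_
  have hs : 0 < q.1.toNNReal := Real.toNNReal_pos.2 hq.1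
  have hst : q.1.toNNReal ≤ t := Real.toNNReal_le_iff_le_coe.2 hq.2
  rw [leftLimit_congr hs (hX _ hst) fun r hr => h r (hr.trans_le hst)]

/-- Connects the true left limits, in which the equation is written, with the version whose event
set is predictable. -/
theorem truncEvents_eq_eventSet (K : ℝ≥0∞) {X : ℝ≥0 → LifeMeasure} {t : ℝ≥0}
    (hX : ∀ s ≤ t, CadlagAt X s) :
    truncEvents α p K X t = eventSet α p K X ∩ {q | q.1 ≤ t} := by
  ext q
  have key : 0 < q.1 → q.1 ≤ t → leftVersion X q.1 = leftLimit X q.1.toNNReal := by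
    intro h0 ht
    have hs : 0 < q.1.toNNReal := Real.toNNReal_pos.2 h0
    have := leftVersion_eq hs (hX _ (Real.toNNReal_le_iff_le_coe.2 ht))
    rwa [Real.coe_toNNReal _ h0.le] at this
  constructor
  · rintro ⟨⟨h0, ht⟩, hq⟩
    exact ⟨⟨h0, by rwa [key h0 ht]⟩, ht⟩
  · rintro ⟨⟨h0, hq⟩, ht⟩
    exact ⟨⟨h0, ht⟩, by rwa [← key h0 ht]⟩

/-- Truncation at `K` is immaterial as long as the mass does not exceed `K`. -/
theorem truncEvents_congr_level {K K' : ℝ≥0∞} {X : ℝ≥0 → LifeMeasure} {t : ℝ≥0}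
    (hX : ∀ s ≤ t, CadlagAt X s) (hK : ∀ s < t, totalMass (X s) ≤ K) (hKK' : K ≤ K') :
    truncEvents α p K X t = truncEvents α p K' X t := by
  ext q
  refine and_congr_right fun hq => ?_
  have hs : 0 < q.1.toNNReal := Real.toNNReal_pos.2 hq.1
  have hst : q.1.toNNReal ≤ t := Real.toNNReal_le_iff_le_coe.2 hq.2
  have hm : (leftLimit X q.1.toNNReal : Measure ℝ) univ ≤ K := by
    refine mass_leftLimit_le hs (hX _ hst) ?_
    filter_upwards [self_mem_nhdsWithin] with r hr
    exact hK r (lt_of_lt_of_le hr hst)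
  simp [reproduces, hm, hm.trans hKK']

theorem measurableSet_predictable_eventSet {Ω : Type*} {mΩ : MeasurableSpace Ω}
    {F : Filtration ℝ≥0 mΩ} (h : IsBranchingMechanism α p) (K : ℝ≥0∞)
    {X : ℝ≥0 → Ω → LifeMeasure} (hX : ∀ t, Measurable[F t] (X t)) :
    MeasurableSet[predictableSigma F]
      {x : Ω × NoisePoint | x.2 ∈ eventSet α p K fun r => X r x.1} := by
  have h2 := measurable_snd_predictable F
  have h1 : Measurable[predictableSigma F] fun x : Ω × NoisePoint => x.2.1 := measurable_fst.comp h2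
  have h3 : Measurable[predictableSigma F] fun x : Ω × NoisePoint =>
      (leftVersion (fun r => X r x.1) x.2.1, x.2.2) :=
    (measurable_leftVersion hX).prodMk (measurable_snd.comp h2)
  exact (h1 measurableSet_Ioi).inter (h3 (h.measurableSet_reproduces K))

/-- The right side of the truncated equation driven by the path `X` is the path `Y` at time `t`. -/
def Produces (α : ℝ → ℝ) (p : ℝ → ℕ → ℝ) (K : ℝ≥0∞) (N : Measure NoisePoint) (μ : LifeMeasure)
    (X Y : ℝ≥0 → LifeMeasure) (t : ℝ≥0) : Prop :=
  ∀ x : ℝ, 0 < x →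
    distrib (Y t) x = (distrib μ (x + t) - distrib μ t) +
      ∫⁻ q, (truncEvents α p K X t).indicator (aliveOffspring t x) q ∂N

theorem solvesAt_iff (N : Measure NoisePoint) (μ : LifeMeasure) (X : ℝ≥0 → LifeMeasure)
    (t : ℝ≥0) : SolvesAt α p N μ X t ↔ Produces α p ⊤ N μ X X t := by
  simp [SolvesAt, Produces, truncEvents_top]

theorem Produces.eq {K K' : ℝ≥0∞} {N : Measure NoisePoint} {μ : LifeMeasure}
    {X Y X' Y' : ℝ≥0 → LifeMeasure} {t : ℝ≥0} (h : Produces α p K N μ X Y t)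
    (h' : Produces α p K' N μ X' Y' t)
    (hE : ∀ᵐ q ∂N, q ∈ truncEvents α p K X t ↔ q ∈ truncEvents α p K' X' t) : Y t = Y' t := by
  refine distrib_ext fun x hx => ?_
  rw [h x hx, h' x hx]
  congr 1
  refine lintegral_congr_ae ?_
  filter_upwards [hE] with q hq
  by_cases hq' : q ∈ truncEvents α p K X t
  · rw [indicator_of_mem hq', indicator_of_mem (hq.1 hq')]
  · rw [indicator_of_notMem hq', indicator_of_notMem fun h => hq' (hq.2 h)]

/-- If finitely many events happen in populations of bounded mass, then there is no event right
after a given time. -/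
theorem exists_no_event {K : ℝ≥0∞} {N : Measure NoisePoint}
    (hN : ∀ B, MeasurableSet B → ∃ k : ℕ∞, N B = (k : ℝ≥0∞)) {X : ℝ≥0 → LifeMeasure} {T t₁ : ℝ≥0}
    (hT : T < t₁) (hX : ∀ t ≤ t₁, CadlagAt X t)
    (hfin : ∀ k : ℕ, N (truncEvents α p k X t₁) < ⊤) :
    ∃ t₂, T < t₂ ∧ t₂ ≤ t₁ ∧ ∀ t, T ≤ t → t ≤ t₂ →
      ∀ᵐ q ∂N, q ∈ truncEvents α p K X t ↔ q ∈ truncEvents α p K X T := by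
  have hc : Tendsto (fun r => totalMass (X r)) (𝓝[≥] T) (𝓝 (totalMass (X T))) := by
    have h1 : Tendsto (fun r => (X r).1) (𝓝[≥] T) (𝓝 (X T).1) :=
      (continuous_subtype_val.tendsto _).comp (hX T hT.le).1
    have h2 := (FiniteMeasure.continuous_mass.tendsto _).comp h1
    have h3 := (ENNReal.continuous_coe.tendsto _).comp h2
    simp only [Function.comp_def, FiniteMeasure.ennreal_mass] at h3
    exact h3
  -- Any level strictly above the mass at `T` remains above it on some `[T, t₃)` by
  -- right-continuity, so all events there are counted by the finite set at level `k`.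
  obtain ⟨k, hk⟩ := ENNReal.exists_nat_gt (show totalMass (X T) ≠ ⊤ from measure_ne_top _ _)
  obtain ⟨t₃, hTt₃, ht₃⟩ := (mem_nhdsGE_iff_exists_Ico_subset' hT).1 (hc.eventually (gt_mem_nhds hk))
  -- A measurable hull stands in for the event set, whose measurability is not available. Its parts
  -- in shrinking intervals after `T` decrease to the empty set, and an integer mass below one is
  -- zero.
  set S := toMeasurable N (truncEvents α p k X t₁) with hS
  have hSm : MeasurableSet S := measurableSet_toMeasurable _ _
  have hSfin : N S < ⊤ := by rw [hS, measure_toMeasurable]; exact hfin k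
  let D : ℕ → Set NoisePoint := fun n => S ∩ {q | q.1 ∈ Ioc (T : ℝ) (T + 1 / ((n : ℝ) + 1))}
  have hDm : ∀ n, MeasurableSet (D n) := fun n => hSm.inter (measurable_fst measurableSet_Ioc)
  have hD : Tendsto (fun n => N (D n)) atTop (𝓝 0) := by
    have hI : ⋂ n, D n = ∅ := by
      rw [eq_empty_iff_forall_notMem]
      intro q hq
      rw [mem_iInter] at hq
      have h0 : (T : ℝ) < q.1 := (hq 0).2.1
      have h1 := (tendsto_one_div_add_atTop_nhds_zero_nat (𝕜 := ℝ)).const_add (T : ℝ)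
      rw [add_zero] at h1
      exact absurd (ge_of_tendsto' h1 fun n => (hq n).2.2) (not_le.2 h0)
    rw [← measure_empty (μ := N), ← hI]
    refine tendsto_measure_iInter_atTop (fun n => (hDm n).nullMeasurableSet) ?_
      ⟨0, ((measure_mono inter_subset_left).trans_lt hSfin).ne⟩
    intro m n hmn q hq
    refine ⟨hq.1, hq.2.1, hq.2.2.trans ?_⟩
    gcongr
  obtain ⟨n, hn⟩ := (hD.eventually (gt_mem_nhds zero_lt_one)).exists
  have hn0 : N (D n) = 0 := by
    obtain ⟨j, hj⟩ := hN _ (hDm n)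
    rw [hj] at hn ⊢
    have : j < 1 := by exact_mod_cast hn
    simp [Order.lt_one_iff.1 this]
  let t₄ : ℝ≥0 := T + 1 / ((n : ℝ≥0) + 1)
  have hTt₄ : T < t₄ := lt_add_of_pos_right _ (by positivity)
  obtain ⟨t₂, ht₂, ht₂'⟩ := exists_between (lt_min hT (lt_min hTt₃ hTt₄))
  have ht₂₁ : t₂ < t₁ := ht₂'.trans_le (min_le_left _ _)
  have ht₂₃ : t₂ < t₃ := ht₂'.trans_le ((min_le_right _ _).trans (min_le_left _ _))
  have ht₂₄ : t₂ < t₄ := ht₂'.trans_le ((min_le_right _ _).trans (min_le_right _ _))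
  refine ⟨t₂, ht₂, ht₂₁.le, fun t hTt ht => ?_⟩
  refine (measure_eq_zero_iff_ae_notMem.1 hn0).mono fun q hq => ?_
  refine ⟨fun hqt => ?_, fun hqT => truncEvents_mono_time K X hTt hqT⟩
  by_contra hqT
  have hTq : (T : ℝ) < q.1 := by
    by_contra h
    exact hqT ⟨⟨hqt.1.1, not_lt.1 h⟩, hqt.2⟩
  have hqt₂ : q.1 ≤ t₂ := hqt.1.2.trans (by exact_mod_cast ht)
  have hTq' : T < q.1.toNNReal := by
    rw [Real.lt_toNNReal_iff_coe_lt]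
    exact hTq
  have hqt' : q.1.toNNReal ≤ t₂ := Real.toNNReal_le_iff_le_coe.2 hqt₂
  apply hq
  refine ⟨subset_toMeasurable _ _ ⟨⟨hqt.1.1, hqt₂.trans (by exact_mod_cast ht₂₁.le)⟩, ?_,
    hqt.2.2⟩, hTq, ?_⟩
  · refine mass_leftLimit_le (zero_le.trans_lt hTq') (hX _ (hqt'.trans ht₂₁.le)) ?_
    filter_upwards [Ioo_mem_nhdsLT hTq'] with r hr
    exact (ht₃ ⟨hr.1.le, hr.2.trans_le (hqt'.trans ht₂₃.le)⟩ : totalMass (X r) < k).le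
  · have : (t₂ : ℝ) ≤ t₄ := by exact_mod_cast ht₂₄.le
    refine hqt₂.trans (this.trans (le_of_eq ?_))
    simp [t₄]

/-- Two càdlàg paths that solve the same truncated equation coincide, provided that only finitely
many reproduction events happen in populations of bounded mass. -/
theorem eq_of_produces {K : ℝ≥0∞} {N : Measure NoisePoint} {μ : LifeMeasure}
    (hN : ∀ B, MeasurableSet B → ∃ k : ℕ∞, N B = (k : ℝ≥0∞)) {X Y : ℝ≥0 → LifeMeasure} {t₁ : ℝ≥0}
    (hX : ∀ t ≤ t₁, CadlagAt X t) (hY : ∀ t ≤ t₁, CadlagAt Y t)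
    (hXfin : ∀ k : ℕ, N (truncEvents α p k X t₁) < ⊤)
    (hYfin : ∀ k : ℕ, N (truncEvents α p k Y t₁) < ⊤)
    (hXeq : ∀ t ≤ t₁, Produces α p K N μ X X t) (hYeq : ∀ t ≤ t₁, Produces α p K N μ Y Y t) :
    ∀ t ≤ t₁, X t = Y t := by
  by_contra! hne
  obtain ⟨t₀, ht₀, hne⟩ := hne
  let D : Set ℝ≥0 := {t | X t ≠ Y t}
  have hDne : D.Nonempty := ⟨t₀, hne⟩
  set T := sInf D with hTdef
  have hTt₀ : T ≤ t₀ := csInf_le' hne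
  have hTt₁ : T ≤ t₁ := hTt₀.trans ht₀
  have hlt : ∀ s < T, X s = Y s := fun s hs => not_not.1 (notMem_of_lt_csInf' hs)
  -- Agreement before `T` already fixes the events through `T`, so the paths agree at `T` too, and
  -- any disagreement must begin strictly later.
  have hev : truncEvents α p K X T = truncEvents α p K Y T :=
    truncEvents_congr_path K (fun s hs => hX s (hs.trans hTt₁)) hlt
  have hTeq : X T = Y T :=
    (hXeq T hTt₁).eq (hYeq T hTt₁) (Eventually.of_forall fun q => by rw [hev])
  have hTlt : T < t₁ := by
    refine lt_of_le_of_ne hTt₁ fun h => hne ?_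
    have : t₀ = T := le_antisymm (ht₀.trans h.ge) hTt₀
    rw [this, hTeq]
  obtain ⟨a, hTa, ha, hXa⟩ := exists_no_event (K := K) hN hTlt hX hXfin
  obtain ⟨b, hTb, hb, hYb⟩ := exists_no_event (K := K) hN hTlt hY hYfin
  have hle : min a b ≤ T := by
    refine le_csInf hDne fun t ht => ?_
    by_contra! hlt'
    rcases lt_or_ge t T with h | h
    · exact ht (hlt t h)
    · refine ht ((hXeq t ?_).eq (hYeq t ?_) ?_)
      · exact hlt'.le.trans ((min_le_left _ _).trans ha)
      · exact hlt'.le.trans ((min_le_left _ _).trans ha)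
      · filter_upwards [hXa t h (hlt'.le.trans (min_le_left _ _)),
          hYb t h (hlt'.le.trans (min_le_right _ _))] with q h1 h2
        rw [h1, h2, hev]
  exact absurd hle (not_le.2 (lt_min hTa hTb))

end Events

/-! ### Expected numbers of events, and pathwise uniqueness. -/

section Moments

variable {α : ℝ → ℝ} {p : ℝ → ℕ → ℝ}

theorem IsBranchingMechanism.exists_rate_bound (h : IsBranchingMechanism α p) :
    ∃ b : ℝ≥0, ∀ x, 0 < x → ENNReal.ofReal (α x) * ∑' n, 1 * ENNReal.ofReal (p x n) ≤ b := by
  obtain ⟨C, hC⟩ := h.rate.bounded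
  refine ⟨C.toNNReal, fun x hx => ?_⟩
  have h1 : ∑' n, 1 * ENNReal.ofReal (p x n) = 1 := by
    simp_rw [one_mul]
    rw [← ENNReal.ofReal_tsum_of_nonneg (fun n => (h.prob n).nonneg x hx) (h.prob_sum x hx).summable,
      (h.prob_sum x hx).tsum_eq, ENNReal.ofReal_one]
  rw [h1, mul_one]
  exact ENNReal.ofReal_le_ofReal (hC x hx)

theorem IsBranchingMechanism.growthRate_lt_top (h : IsBranchingMechanism α p) :
    growthRate α p < ⊤ := by
  obtain ⟨C, hC⟩ := h.rate.bounded
  refine lt_of_le_of_lt ?_ (ENNReal.mul_lt_top (ENNReal.ofReal_lt_top (r := C)) h.mean_bounded)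
  refine iSup₂_le fun x hx => ?_
  exact mul_le_mul' (ENNReal.ofReal_le_ofReal (hC x hx))
    (le_iSup₂ (f := fun x (_ : x ∈ Ioi (0 : ℝ)) => offspringMean p x) x hx)

theorem le_growthRate {x : ℝ} (hx : 0 < x) :
    ENNReal.ofReal (α x) * ∑' n : ℕ, (n : ℝ≥0∞) * ENNReal.ofReal (p x n) ≤ growthRate α p :=
  le_iSup₂ (f := fun x (_ : x ∈ Ioi (0 : ℝ)) => ENNReal.ofReal (α x) * offspringMean p x) x hx

variable {Ω : Type*} {mΩ : MeasurableSpace Ω} {P : Measure Ω} [IsProbabilityMeasure P]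
  {F : Filtration ℝ≥0 mΩ} {M : Ω → Measure NoisePoint} {G : Measure ℝ} [IsProbabilityMeasure G]

/-- The compensation formula, as an upper bound for integrals over predictable sets whose sections
in time have bounded intensity. -/
theorem IsPoissonRandomMeasure.lintegral_le_of_rate
    (hM : IsPoissonRandomMeasure P F (intensity G) M)
    {D : Set (Ω × NoisePoint)} (hD : MeasurableSet[predictableSigma F] D) {t : ℝ≥0}
    (hDt : ∀ x ∈ D, x.2.1 ∈ Ioc 0 (t : ℝ)) (f : ℕ → ℝ≥0∞) (g : ℝ → Ω → ℝ≥0∞)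
    (hg : ∀ᵐ ω ∂P, ∀ s ∈ Ioc 0 (t : ℝ),
      ∫⁻ r in {r | (ω, (s, r)) ∈ D}, f r.2.1.2.1 ∂(tailIntensity G) ≤ g s ω) :
    ∫⁻ ω, ∫⁻ q in Prod.mk ω ⁻¹' D, f (offspring q) ∂(M ω) ∂P ≤
      ∫⁻ s in Ioc 0 (t : ℝ), ∫⁻ ω, g s ω ∂P := by
  have hD' := predictableSigma_le F _ hD
  have hf : Measurable f := measurable_from_top
  let h : Ω × NoisePoint → ℝ≥0∞ := D.indicator fun x => f (offspring x.2)
  have hh : Measurable h := (hf.comp (measurable_offspring.comp measurable_snd)).indicator hD'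
  have hsec : ∀ s ω, ∫⁻ r, h (ω, (s, r)) ∂(tailIntensity G) =
      ∫⁻ r in {r | (ω, (s, r)) ∈ D}, f r.2.1.2.1 ∂(tailIntensity G) := by
    intro s ω
    have hm : MeasurableSet {r : ℝ × Mark × ℝ | (ω, (s, r)) ∈ D} :=
      (measurable_prodMk_left.comp measurable_prodMk_left) hD'
    rw [← lintegral_indicator hm]
    rfl
  rw [hM.lintegral_setLIntegral (intensity_nonpos G) hD f]
  calc ∫⁻ ω, ∫⁻ q in Prod.mk ω ⁻¹' D, f (offspring q) ∂(intensity G) ∂P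
      = ∫⁻ ω, ∫⁻ q, h (ω, q) ∂(intensity G) ∂P := by
        refine lintegral_congr fun ω => ?_
        rw [← lintegral_indicator (measurable_prodMk_left hD')]
        rfl
    _ = ∫⁻ ω, (∫⁻ s in Ioi (0 : ℝ), (∫⁻ r, h (ω, (s, r)) ∂(tailIntensity G))) ∂P := by
        refine lintegral_congr fun ω => ?_
        rw [intensity_eq]
        exact lintegral_prod (fun q => h (ω, q)) (hh.comp measurable_prodMk_left).aemeasurable
    _ = ∫⁻ s in Ioi (0 : ℝ), ∫⁻ ω, ∫⁻ r, h (ω, (s, r)) ∂(tailIntensity G) ∂P := by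
        refine lintegral_lintegral_swap (Measurable.aemeasurable ?_)
        exact Measurable.lintegral_prod_right'
          (f := fun x : (Ω × ℝ) × (ℝ × Mark × ℝ) => h (x.1.1, (x.1.2, x.2)))
          (hh.comp (by fun_prop))
    _ ≤ ∫⁻ s in Ioi (0 : ℝ), (Ioc 0 (t : ℝ)).indicator (fun s => ∫⁻ ω, g s ω ∂P) s := by
        refine lintegral_mono fun s => ?_
        by_cases hs : s ∈ Ioc 0 (t : ℝ)
        · rw [indicator_of_mem hs]
          refine lintegral_mono_ae ?_
          filter_upwards [hg] with ω hω
          rw [hsec]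
          exact hω s hs
        · rw [indicator_of_notMem hs]
          have : ∀ ω r, h (ω, (s, r)) = 0 := fun ω r =>
            indicator_of_notMem (fun hx => hs (hDt _ hx)) _
          simp [this]
    _ ≤ ∫⁻ s, (Ioc 0 (t : ℝ)).indicator (fun s => ∫⁻ ω, g s ω ∂P) s := setLIntegral_le_lintegral _ _
    _ = ∫⁻ s in Ioc 0 (t : ℝ), ∫⁻ ω, g s ω ∂P := lintegral_indicator measurableSet_Ioc _

/-- The predictable set of reproduction events up to time `t`. -/
def predictableEvents (α : ℝ → ℝ) (p : ℝ → ℕ → ℝ) (K : ℝ≥0∞) (X : ℝ≥0 → Ω → LifeMeasure)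
    (t : ℝ≥0) : Set (Ω × NoisePoint) :=
  {x | x.2 ∈ eventSet α p K (fun r => X r x.1) ∩ {q | q.1 ≤ t}}

theorem measurableSet_predictableEvents (h : IsBranchingMechanism α p) (K : ℝ≥0∞)
    {X : ℝ≥0 → Ω → LifeMeasure} (hX : ∀ t, Measurable[F t] (X t)) (t : ℝ≥0) :
    MeasurableSet[predictableSigma F] (predictableEvents α p K X t) := by
  refine (measurableSet_predictable_eventSet h K hX).inter ?_
  exact (measurable_fst.comp (measurable_snd_predictable F)) measurableSet_Iic

theorem predictableEvents_section (K : ℝ≥0∞) (X : ℝ≥0 → Ω → LifeMeasure) (t : ℝ≥0) (ω : Ω) :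
    Prod.mk ω ⁻¹' predictableEvents α p K X t = eventSet α p K (fun r => X r ω) ∩ {q | q.1 ≤ t} :=
  rfl

theorem predictableEvents_time {K : ℝ≥0∞} {X : ℝ≥0 → Ω → LifeMeasure} {t : ℝ≥0}
    {x : Ω × NoisePoint} (hx : x ∈ predictableEvents α p K X t) : x.2.1 ∈ Ioc 0 (t : ℝ) :=
  ⟨hx.1.1, hx.2⟩

theorem setOf_predictableEvents {K : ℝ≥0∞} {X : ℝ≥0 → Ω → LifeMeasure} {t : ℝ≥0} {s : ℝ}
    (hs : s ∈ Ioc 0 (t : ℝ)) (ω : Ω) :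
    {r | (ω, (s, r)) ∈ predictableEvents α p K X t} =
      reproduces α p K (leftVersion (fun r => X r ω) s) := by
  ext r
  simp [predictableEvents, eventSet, hs.1, hs.2]

theorem lintegral_reproduces_le_level (h : IsBranchingMechanism α p) (ν : FiniteMeasure ℝ)
    (K : ℝ≥0∞) (f : ℕ → ℝ≥0∞) {b : ℝ≥0∞}
    (hb : ∀ x, 0 < x → ENNReal.ofReal (α x) * ∑' n, f n * ENNReal.ofReal (p x n) ≤ b) :
    ∫⁻ r in reproduces α p K ν, f r.2.1.2.1 ∂(tailIntensity G) ≤ b * K := by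
  by_cases hK : (ν : Measure ℝ) univ ≤ K
  · exact (lintegral_reproduces_le G h ν K f hb).trans (by gcongr)
  · have : reproduces α p K ν = ∅ := by
      ext r
      simp [reproduces, hK]
    simp [this]

/-- Truncation caps the rate at `b * K` whatever the path does, so no integrability of the process
is needed. -/
theorem IsPoissonRandomMeasure.lintegral_events_le_level
    (hM : IsPoissonRandomMeasure P F (intensity G) M) (h : IsBranchingMechanism α p) (K : ℝ≥0∞)
    {X : ℝ≥0 → Ω → LifeMeasure} (hX : ∀ t, Measurable[F t] (X t)) (t : ℝ≥0) (f : ℕ → ℝ≥0∞)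
    {b : ℝ≥0∞} (hb : ∀ x, 0 < x → ENNReal.ofReal (α x) * ∑' n, f n * ENNReal.ofReal (p x n) ≤ b) :
    ∫⁻ ω, ∫⁻ q in eventSet α p K (fun r => X r ω) ∩ {q | q.1 ≤ t}, f (offspring q) ∂(M ω) ∂P ≤
      b * K * t := by
  refine (hM.lintegral_le_of_rate (measurableSet_predictableEvents h K hX t)
    (fun x hx => predictableEvents_time hx) f (fun _ _ => b * K)
    (Eventually.of_forall fun ω s hs => ?_)).trans ?_
  · rw [setOf_predictableEvents hs]
    exact lintegral_reproduces_le_level h _ K f hb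
  · simp

theorem IsPoissonRandomMeasure.ae_setLIntegral_events_lt_top
    (hM : IsPoissonRandomMeasure P F (intensity G) M) (h : IsBranchingMechanism α p) (K : ℕ)
    {X : ℝ≥0 → Ω → LifeMeasure} (hX : ∀ t, Measurable[F t] (X t)) (f : ℕ → ℝ≥0∞)
    {b : ℝ≥0∞} (hbt : b < ⊤)
    (hb : ∀ x, 0 < x → ENNReal.ofReal (α x) * ∑' n, f n * ENNReal.ofReal (p x n) ≤ b) :
    ∀ᵐ ω ∂P, ∀ t : ℝ≥0,
      ∫⁻ q in eventSet α p K (fun r => X r ω) ∩ {q | q.1 ≤ t}, f (offspring q) ∂(M ω) < ⊤ := by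
  have hn : ∀ᵐ ω ∂P, ∀ n : ℕ, ∫⁻ q in eventSet α p K (fun r => X r ω) ∩ {q | q.1 ≤ (n : ℝ≥0)},
      f (offspring q) ∂(M ω) < ⊤ := by
    refine ae_all_iff.2 fun n => ?_
    refine ae_lt_top' (hM.aemeasurable_setLIntegral
      (predictableSigma_le F _ (measurableSet_predictableEvents h K hX n)) f) ?_
    refine ne_top_of_le_ne_top ?_ (hM.lintegral_events_le_level h K hX n f hb)
    exact ENNReal.mul_ne_top (ENNReal.mul_ne_top hbt.ne (ENNReal.natCast_ne_top K))
      (ENNReal.coe_ne_top)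
  filter_upwards [hn] with ω hω t
  obtain ⟨n, hn⟩ := exists_nat_ge t
  have hsub : eventSet α p K (fun r => X r ω) ∩ {q | q.1 ≤ (t : ℝ)} ⊆
      eventSet α p K (fun r => X r ω) ∩ {q | q.1 ≤ ((n : ℝ≥0) : ℝ)} := fun q hq =>
    ⟨hq.1, le_trans (show q.1 ≤ t from hq.2) (by exact_mod_cast hn)⟩
  exact lt_of_le_of_lt (lintegral_mono_set hsub) (hω n)

/-- The càdlàg condition stands inside the almost sure statement and reaches only up to `t`, so that
solutions with a finite lifetime are covered. -/
theorem IsPoissonRandomMeasure.ae_events_lt_top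
    (hM : IsPoissonRandomMeasure P F (intensity G) M) (h : IsBranchingMechanism α p)
    {X : ℝ≥0 → Ω → LifeMeasure} (hX : ∀ t, Measurable[F t] (X t)) :
    ∀ᵐ ω ∂P, ∀ (k : ℕ) (t : ℝ≥0), (∀ s ≤ t, CadlagAt (fun r => X r ω) s) →
      M ω (truncEvents α p k (fun r => X r ω) t) < ⊤ := by
  obtain ⟨b, hb⟩ := h.exists_rate_bound
  filter_upwards [ae_all_iff.2 fun k : ℕ => hM.ae_setLIntegral_events_lt_top h k hX (fun _ => 1)
    ENNReal.coe_lt_top hb] with ω hω k t hc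
  rw [truncEvents_eq_eventSet _ hc]
  simpa using hω k t

/-- Pathwise uniqueness. -/
theorem IsPoissonRandomMeasure.pathwise_unique
    (hM : IsPoissonRandomMeasure P F (intensity G) M) (h : IsBranchingMechanism α p)
    {X₀ : Ω → LifeMeasure} {X Y : ℝ≥0 → Ω → LifeMeasure} {ζ η : Ω → WithTop ℝ≥0}
    (hX : IsSolution P F α p M X₀ X ζ) (hY : IsSolution P F α p M X₀ Y η) :
    ∀ᵐ ω ∂P, ∀ t : ℝ≥0, (t : WithTop ℝ≥0) < ζ ω → (t : WithTop ℝ≥0) < η ω → X t ω = Y t ω := by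
  filter_upwards [hX.cadlag, hX.equation, hY.cadlag, hY.equation,
    hM.ae_events_lt_top h hX.adapted, hM.ae_events_lt_top h hY.adapted]
    with ω h1 h2 h3 h4 h5 h6 t htζ htη
  have hζ : ∀ s ≤ t, (s : WithTop ℝ≥0) < ζ ω := fun s hs =>
    lt_of_le_of_lt (WithTop.coe_le_coe.2 hs) htζ
  have hη : ∀ s ≤ t, (s : WithTop ℝ≥0) < η ω := fun s hs =>
    lt_of_le_of_lt (WithTop.coe_le_coe.2 hs) htη
  have cX : ∀ s ≤ t, CadlagAt (fun r => X r ω) s := fun s hs => h1 s (hζ s hs)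
  have cY : ∀ s ≤ t, CadlagAt (fun r => Y r ω) s := fun s hs => h3 s (hη s hs)
  exact eq_of_produces (K := ⊤) (hM.integer_valued ω) cX cY (fun k => h5 k t cX)
    (fun k => h6 k t cY) (fun s hs => (solvesAt_iff _ _ _ _).1 (h2 s (hζ s hs)))
    (fun s hs => (solvesAt_iff _ _ _ _).1 (h4 s (hη s hs))) t le_rfl

end Moments

/-! ### The population driven by a prescribed path. -/

section Step

/-- Birth and death time of the `i`-th child of a point of the noise. -/
def lifeSpan (i : ℕ) (q : NoisePoint) : ℝ × ℝ := (q.1, q.1 + q.2.2.1.2.2 i)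

theorem measurable_lifeSpan (i : ℕ) : Measurable (lifeSpan i) := by
  unfold lifeSpan
  fun_prop

theorem measurableSet_lt_offspring (i : ℕ) : MeasurableSet {q | i < offspring q} :=
  measurable_offspring (measurableSet_Ioi (a := i))

/-- The birth and death times of the initial population `μ` and of the children of the points
of `N` in `S`. -/
def birthMeasure (N : Measure NoisePoint) (μ : LifeMeasure) (S : Set NoisePoint) :
    Measure (ℝ × ℝ) :=
  (μ.1 : Measure ℝ).map (fun z => ((0 : ℝ), z)) +
    Measure.sum fun i => (N.restrict (S ∩ {q | i < offspring q})).map (lifeSpan i)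

theorem birthMeasure_apply (N : Measure NoisePoint) (μ : LifeMeasure) (S : Set NoisePoint)
    {C : Set (ℝ × ℝ)} (hC : MeasurableSet C) :
    birthMeasure N μ S C = (μ.1 : Measure ℝ) {z | ((0 : ℝ), z) ∈ C} +
      ∑' i, N (lifeSpan i ⁻¹' C ∩ (S ∩ {q | i < offspring q})) := by
  have hm : Measurable fun z : ℝ => ((0 : ℝ), z) := measurable_prodMk_left
  rw [birthMeasure, Measure.add_apply, Measure.map_apply hm hC, Measure.sum_apply _ hC]
  congr 1
  refine tsum_congr fun i => ?_
  rw [Measure.map_apply (measurable_lifeSpan i) hC,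
    Measure.restrict_apply ((measurable_lifeSpan i) hC)]

theorem measurable_add_tsum {Ω : Type*} {m : MeasurableSpace Ω} {f : Ω → ℝ≥0∞}
    {g : ℕ → Ω → ℝ≥0∞} (hf : Measurable f) (hg : ∀ i, Measurable (g i)) :
    Measurable fun ω => f ω + ∑' i, g i ω :=
  hf.add (Measurable.tsum hg)

/-- Tonelli: summing over child numbers first or over noise points first. -/
theorem tsum_measure_children (N : Measure NoisePoint) (S : Set NoisePoint)
    {H : ℕ → Set NoisePoint} (hH : ∀ i, MeasurableSet (H i)) :
    ∑' i, N (H i ∩ (S ∩ {q | i < offspring q})) =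
      ∫⁻ q in S, ∑ i ∈ Finset.range (offspring q), (H i).indicator 1 q ∂N := by
  have h1 : ∀ q, ∑ i ∈ Finset.range (offspring q), (H i).indicator (1 : NoisePoint → ℝ≥0∞) q =
      ∑' i, (H i ∩ {q | i < offspring q}).indicator 1 q := by
    intro q
    rw [tsum_eq_sum (s := Finset.range (offspring q))]
    · refine Finset.sum_congr rfl fun i hi => ?_
      have hi' : i < offspring q := Finset.mem_range.1 hi
      by_cases hq : q ∈ H i
      · rw [indicator_of_mem hq, indicator_of_mem (s := H i ∩ {q | i < offspring q}) ⟨hq, hi'⟩]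
      · rw [indicator_of_notMem hq, indicator_of_notMem fun hx => hq hx.1]
    · intro i hi
      exact indicator_of_notMem (fun hx => hi (Finset.mem_range.2 hx.2)) _
  have hm : ∀ i, MeasurableSet (H i ∩ {q | i < offspring q}) :=
    fun i => (hH i).inter (measurableSet_lt_offspring i)
  simp_rw [h1]
  rw [lintegral_tsum fun i => (measurable_one.indicator (hm i)).aemeasurable]
  refine tsum_congr fun i => ?_
  rw [lintegral_indicator_one (hm i), Measure.restrict_apply (hm i)]
  congr 1
  ext q
  simp only [mem_inter_iff]
  tauto

theorem birthMeasure_time (N : Measure NoisePoint) (μ : LifeMeasure) (S : Set NoisePoint)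
    (t : ℝ≥0) :
    birthMeasure N μ S {b | b.1 ≤ t} =
      totalMass μ + ∫⁻ q in S ∩ {q | q.1 ≤ t}, (offspring q : ℝ≥0∞) ∂N := by
  have hT : MeasurableSet {b : ℝ × ℝ | b.1 ≤ (t : ℝ)} :=
    measurableSet_le measurable_fst measurable_const
  rw [birthMeasure_apply _ _ _ hT]
  congr 1
  · simp [totalMass]
  · rw [tsum_congr fun i => congrArg N (show lifeSpan i ⁻¹' {b : ℝ × ℝ | b.1 ≤ (t : ℝ)} ∩
      (S ∩ {q | i < offspring q}) = univ ∩ ((S ∩ {q | q.1 ≤ (t : ℝ)}) ∩ {q | i < offspring q}) from ?_),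
      tsum_measure_children N _ (fun _ => MeasurableSet.univ)]
    · simp
    · ext q
      simp only [lifeSpan, mem_inter_iff, mem_preimage, mem_ofPred_eq, mem_univ, true_and]
      tauto

theorem residualLives_birthMeasure (N : Measure NoisePoint) (μ : LifeMeasure) (S : Set NoisePoint)
    (t : ℝ≥0) {C : Set ℝ} (hC : MeasurableSet C) :
    residualLives (birthMeasure N μ S) t C = (μ.1 : Measure ℝ) {z | (t : ℝ) < z ∧ z - t ∈ C} +
      ∑' i, N (lifeSpan i ⁻¹' {b | b ∈ aliveAt t ∧ b.2 - t ∈ C} ∩ (S ∩ {q | i < offspring q})) := by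
  have hm : Measurable fun b : ℝ × ℝ => b.2 - (t : ℝ) := by fun_prop
  have hD : MeasurableSet {b : ℝ × ℝ | b ∈ aliveAt t ∧ b.2 - (t : ℝ) ∈ C} :=
    (measurableSet_aliveAt t).inter (hm hC)
  rw [residualLives_apply _ _ hC, birthMeasure_apply _ _ _ hD]
  congr 3
  ext z
  simp [aliveAt]

/-- An initial life `z` leaves a residual life in `(0,x]` at time `t` exactly when `z ∈ (t, x + t]`,
and a child born at `s` with life `z_i` has residual life `z_i - (t - s)`. Thus the residual lives
of the population are the right side of the equation. -/
theorem residualLives_birthMeasure_Ioc (N : Measure NoisePoint) (μ : LifeMeasure)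
    {S : Set NoisePoint} (hS : MeasurableSet S) (t : ℝ≥0) (x : ℝ) :
    residualLives (birthMeasure N μ S) t (Ioc 0 x) = (distrib μ (x + t) - distrib μ t) +
      ∫⁻ q, (S ∩ {q | q.1 ≤ t}).indicator (aliveOffspring t x) q ∂N := by
  have hT' : MeasurableSet {q : NoisePoint | q.1 ≤ (t : ℝ)} :=
    measurableSet_le measurable_fst measurable_const
  rw [residualLives_birthMeasure _ _ _ _ measurableSet_Ioc]
  congr 1
  · rcases le_total x 0 with hx | hx
    · have h1 : {z : ℝ | (t : ℝ) < z ∧ z - t ∈ Ioc 0 x} = ∅ := by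
        ext z
        simp only [mem_ofPred_eq, mem_Ioc, mem_empty_iff_false, iff_false]
        rintro ⟨h, h1, h2⟩
        linarith
      rw [h1, measure_empty, tsub_eq_zero_of_le]
      exact measure_mono (Ioc_subset_Ioc_right (by linarith))
    · rw [distrib, distrib, ← measure_sdiff (Ioc_subset_Ioc_right (by linarith))
        measurableSet_Ioc.nullMeasurableSet (measure_ne_top _ _)]
      congr 1
      ext z
      have ht := t.coe_nonneg
      simp only [mem_ofPred_eq, mem_Ioc, Set.mem_sdiff, not_and, not_le]
      constructor
      · rintro ⟨h, h1, h2⟩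
        exact ⟨⟨by linarith, by linarith⟩, fun _ => h⟩
      · rintro ⟨⟨h1, h2⟩, h3⟩
        have := h3 h1
        exact ⟨this, by linarith, by linarith⟩
  · have hH : ∀ i, MeasurableSet
        {q : NoisePoint | q.2.2.1.2.2 i - ((t : ℝ) - q.1) ∈ Ioc 0 x} := by
      intro i
      have : Measurable fun q : NoisePoint => q.2.2.1.2.2 i - ((t : ℝ) - q.1) := by fun_prop
      exact this measurableSet_Ioc
    rw [lintegral_indicator (hS.inter hT')]
    refine (tsum_congr fun i => congrArg N ?_).trans
      (tsum_measure_children N _ hH)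
    ext q
    simp only [lifeSpan, aliveAt, mem_inter_iff, mem_preimage, mem_ofPred_eq, mem_Ioc]
    constructor
    · rintro ⟨⟨⟨h1, h2⟩, h3, h4⟩, h5, h6⟩
      exact ⟨⟨by linarith, by linarith⟩, ⟨h5, h1⟩, h6⟩
    · rintro ⟨⟨h3, h4⟩, ⟨h5, h1⟩, h6⟩
      exact ⟨⟨⟨h1, by linarith⟩, by linarith, by linarith⟩, h5, h6⟩

variable {α : ℝ → ℝ} {p : ℝ → ℕ → ℝ} {Ω : Type*} {mΩ : MeasurableSpace Ω} {P : Measure Ω}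
  [IsProbabilityMeasure P] {F : Filtration ℝ≥0 mΩ} {M : Ω → Measure NoisePoint} {G : Measure ℝ}
  [IsProbabilityMeasure G]

open Classical in
/-- One step of the iteration: an adapted càdlàg process drives another one. -/
theorem IsPoissonRandomMeasure.exists_produces
    (hM : IsPoissonRandomMeasure P F (intensity G) M)
    (hF : ∀ N : Set Ω, P N = 0 → MeasurableSet[F 0] N) (h : IsBranchingMechanism α p) (K : ℕ)
    {X₀ : Ω → LifeMeasure} (hX₀ : Measurable[F 0] X₀)
    {X : ℝ≥0 → Ω → LifeMeasure} (hX : ∀ t, Measurable[F t] (X t))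
    (hXc : ∀ ω t, CadlagAt (fun r => X r ω) t) :
    ∃ Y : ℝ≥0 → Ω → LifeMeasure, (∀ t, Measurable[F t] (Y t)) ∧
      (∀ ω t, CadlagAt (fun r => Y r ω) t) ∧
      ∀ᵐ ω ∂P, ∀ t, Produces α p K (M ω) (X₀ ω) (fun r => X r ω) (fun r => Y r ω) t ∧
        totalMass (Y t ω) ≤ totalMass (X₀ ω) +
          ∫⁻ q in truncEvents α p K (fun r => X r ω) t, (offspring q : ℝ≥0∞) ∂(M ω) := by
  have hpred := measurableSet_predictable_eventSet (F := F) h (K : ℝ≥0∞) hX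
  have hSm : ∀ ω, MeasurableSet (eventSet α p K fun r => X r ω) := fun ω =>
    measurable_prodMk_left (x := ω) (predictableSigma_le F _ hpred)
  let B : Ω → Measure (ℝ × ℝ) := fun ω =>
    birthMeasure (M ω) (X₀ ω) (eventSet α p K fun r => X r ω)
  -- The population is emptied on the null event of infinitely many births, so that the output is
  -- càdlàg for every `ω`, as the next iteration step requires.
  let B' : Ω → Measure (ℝ × ℝ) := fun ω =>
    if ∀ t : ℝ≥0, B ω {b | b.1 ≤ t} < ⊤ then B ω else 0
  have hB' : ∀ ω, ∀ t : ℝ≥0, B' ω {b | b.1 ≤ t} < ⊤ := by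
    intro ω t
    simp only [B']
    split_ifs with hω
    · exact hω t
    · simp
  have hae : ∀ᵐ ω ∂P, B' ω = B ω := by
    filter_upwards [hM.ae_setLIntegral_events_lt_top h K hX (fun n => (n : ℝ≥0∞))
      h.growthRate_lt_top fun x hx => le_growthRate hx] with ω hω
    refine if_pos fun t => ?_
    simp only [B]
    rw [birthMeasure_time]
    exact ENNReal.add_lt_top.2 ⟨measure_lt_top _ _, hω t⟩
  refine ⟨fun t ω => residualPath (B' ω) (hB' ω) t, fun t => ?_,
    fun ω t => cadlagAt_residualPath _ _ t, ?_⟩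
  · refine Measurable.subtype_mk (Measurable.subtype_mk ?_)
    refine Measure.measurable_of_measurable_coe _ fun C hC => ?_
    have hm : Measurable fun b : ℝ × ℝ => b.2 - (t : ℝ) := by fun_prop
    have h0 : Measurable[F t] fun ω => ((X₀ ω).1 : Measure ℝ) {z | (t : ℝ) < z ∧ z - t ∈ C} := by
      have hC' : MeasurableSet {z : ℝ | (t : ℝ) < z ∧ z - t ∈ C} :=
        measurableSet_Ioi.inter ((measurable_id.sub_const (t : ℝ)) hC)
      exact (measurable_finiteMeasure_apply hC').comp
        (measurable_subtype_coe.comp (hX₀.mono (F.mono zero_le) le_rfl))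
    have h1 : ∀ i, Measurable[F t] fun ω => M ω
        (lifeSpan i ⁻¹' {b | b ∈ aliveAt t ∧ b.2 - t ∈ C} ∩
          ((eventSet α p K fun r => X r ω) ∩ {q | i < offspring q})) := by
      intro i
      refine hM.measurable_predictable_section hF t (C := Prod.snd ⁻¹'
        (lifeSpan i ⁻¹' {b | b ∈ aliveAt t ∧ b.2 - t ∈ C}) ∩
          ({x | x.2 ∈ eventSet α p K fun r => X r x.1} ∩ Prod.snd ⁻¹' {q | i < offspring q})) ?_ ?_
      · refine MeasurableSet.inter ?_ (hpred.inter ?_)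
        · exact measurable_snd_predictable F
            (measurable_lifeSpan i ((measurableSet_aliveAt t).inter (hm hC)))
        · exact measurable_snd_predictable F (measurableSet_lt_offspring i)
      · exact fun x hx => hx.1.1.1
    refine measurable_of_ae_eq hF (measurable_add_tsum h0 h1) ?_
    filter_upwards [hae] with ω hω
    rw [hω]
    exact (residualLives_birthMeasure _ _ _ _ hC).symm
  · filter_upwards [hae] with ω hω t
    rw [Produces, truncEvents_eq_eventSet K fun s _ => hXc ω s]
    refine ⟨fun x _ => ?_, ?_⟩
    · change residualLives (B' ω) t (Ioc 0 x) = _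
      rw [hω]
      exact residualLives_birthMeasure_Ioc _ _ (hSm ω) t x
    · change residualLives (B' ω) t univ ≤ _
      rw [hω, ← birthMeasure_time]
      exact residualLives_le _ _ _

end Step

/-! ### Picard iteration for the truncated equation. -/

section Picard

/-- Integration sends each term of the exponential series to the next; this drives both the Picard
estimate and the Gronwall bound. -/
theorem lintegral_pow_div_factorial (c t : ℝ≥0) (j : ℕ) :
    ∫⁻ s in Ioc 0 (t : ℝ), (c : ℝ≥0∞) * ENNReal.ofReal ((c * s) ^ j / j.factorial) =
      ENNReal.ofReal ((c * t) ^ (j + 1) / (j + 1).factorial) := by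
  have h1 : ∀ s ∈ Ioc 0 (t : ℝ), (c : ℝ≥0∞) * ENNReal.ofReal ((c * s) ^ j / j.factorial) =
      ENNReal.ofReal (c ^ (j + 1) / j.factorial * s ^ j) := by
    intro s _
    rw [← ENNReal.ofReal_coe_nnreal, ← ENNReal.ofReal_mul c.coe_nonneg]
    congr 1
    rw [mul_pow]
    ring
  rw [setLIntegral_congr_fun measurableSet_Ioc h1, ← ofReal_integral_eq_lintegral_ofReal,
    ← intervalIntegral.integral_of_le t.coe_nonneg, intervalIntegral.integral_const_mul,
    integral_pow]
  · congr 1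
    rw [Nat.factorial_succ, mul_pow]
    push_cast
    field_simp
    simp
  · exact (Continuous.integrableOn_Ioc (by fun_prop))
  · filter_upwards [ae_restrict_mem measurableSet_Ioc] with s hs
    have := hs.1.le
    positivity

/-- Agreement must extend strictly beyond `t`, because right-continuity at `t` looks past `t`. -/
theorem CadlagAt.congr {X Y : ℝ≥0 → LifeMeasure} {t t' : ℝ≥0} (h : CadlagAt X t) (ht : t < t')
    (hXY : ∀ s ≤ t', X s = Y s) : CadlagAt Y t := by
  obtain ⟨h1, ν, h2⟩ := h
  refine ⟨h1.congr_of_eventuallyEq ?_ (hXY t ht.le).symm, ν, h2.congr' ?_⟩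
  · filter_upwards [mem_nhdsWithin_of_mem_nhds (Iio_mem_nhds ht)] with s hs
    exact (hXY s (le_of_lt hs)).symm
  · filter_upwards [self_mem_nhdsWithin] with s hs
    rw [hXY s ((le_of_lt hs).trans ht.le)]

variable {α : ℝ → ℝ} {p : ℝ → ℕ → ℝ} {Ω : Type*} {mΩ : MeasurableSpace Ω} {P : Measure Ω}
  [IsProbabilityMeasure P] {F : Filtration ℝ≥0 mΩ} {M : Ω → Measure NoisePoint} {G : Measure ℝ}
  [IsProbabilityMeasure G]

open Classical in
-- Eventual constancy makes `{Z t ∈ B}` almost surely the lower limit of the events `{Y n t ∈ B}`;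
-- knowing the null sets turns this into adaptedness.
theorem exists_stable_limit {P : Measure Ω} (hF : ∀ N : Set Ω, P N = 0 → MeasurableSet[F 0] N)
    {Y : ℕ → ℝ≥0 → Ω → LifeMeasure} (hY : ∀ n t, Measurable[F t] (Y n t))
    (hs : ∀ᵐ ω ∂P, ∀ t : ℝ≥0, ∃ n, ∀ m ≥ n, ∀ s ≤ t, Y m s ω = Y n s ω) :
    ∃ Z : ℝ≥0 → Ω → LifeMeasure, (∀ t, Measurable[F t] (Z t)) ∧
      ∀ᵐ ω ∂P, ∀ t : ℝ≥0, ∃ n, ∀ m ≥ n, ∀ s ≤ t, Y m s ω = Z s ω := by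
  let Z : ℝ≥0 → Ω → LifeMeasure := fun s ω =>
    if h : ∃ n, ∀ m ≥ n, Y m s ω = Y n s ω then Y h.choose s ω else Y 0 s ω
  have hZ : ∀ s ω n, (∀ m ≥ n, Y m s ω = Y n s ω) → Y n s ω = Z s ω := by
    intro s ω n hn
    have hex : ∃ n, ∀ m ≥ n, Y m s ω = Y n s ω := ⟨n, hn⟩
    have : Z s ω = Y hex.choose s ω := dif_pos hex
    rw [this, ← hn _ (le_max_left n hex.choose), hex.choose_spec _ (le_max_right n hex.choose)]
  refine ⟨Z, fun t B hB => ?_, ?_⟩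
  · refine measurableSet_of_ae_iff hF (W := ⋃ n, ⋂ m ≥ n, Y m t ⁻¹' B) ?_ ?_
    · exact MeasurableSet.iUnion fun n => MeasurableSet.iInter fun m =>
        MeasurableSet.iInter fun _ => hY m t hB
    · filter_upwards [hs] with ω hω
      obtain ⟨n, hn⟩ := hω t
      have hn' : ∀ m ≥ n, Y m t ω = Z t ω := fun m hm => by
        rw [hn m hm t le_rfl]
        exact hZ t ω n fun m hm => hn m hm t le_rfl
      simp only [mem_iUnion, mem_iInter, mem_preimage]
      constructor
      · rintro ⟨k, hk⟩
        rw [← hn' _ (le_max_left n k)]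
        exact hk _ (le_max_right n k)
      · intro h
        exact ⟨n, fun m hm => by rwa [hn' m hm]⟩
  · filter_upwards [hs] with ω hω t
    obtain ⟨n, hn⟩ := hω t
    refine ⟨n, fun m hm s hst => ?_⟩
    rw [hn m hm s hst]
    exact hZ s ω n fun m hm => hn m hm s hst

/-- The points up to time `t` that are reproduction events of exactly one of two processes. -/
def discrepancy (α : ℝ → ℝ) (p : ℝ → ℕ → ℝ) (K : ℝ≥0∞) (X Y : ℝ≥0 → Ω → LifeMeasure)
    (t : ℝ≥0) : Set (Ω × NoisePoint) :=
  symmDiff (predictableEvents α p K X t) (predictableEvents α p K Y t)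

/-- The event that the noise has a point in the discrepancy set. -/
def discrepancyEvent (M : Ω → Measure NoisePoint) (α : ℝ → ℝ) (p : ℝ → ℕ → ℝ) (K : ℝ≥0∞)
    (X Y : ℝ≥0 → Ω → LifeMeasure) (t : ℝ≥0) : Set Ω :=
  {ω | M ω (Prod.mk ω ⁻¹' discrepancy α p K X Y t) ≠ 0}

theorem mem_predictableEvents_iff {K : ℝ≥0∞} {X : ℝ≥0 → Ω → LifeMeasure} {ω : Ω}
    (hX : ∀ t, CadlagAt (fun r => X r ω) t) (t : ℝ≥0) (q : NoisePoint) :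
    (ω, q) ∈ predictableEvents α p K X t ↔ q ∈ truncEvents α p K (fun r => X r ω) t := by
  rw [truncEvents_eq_eventSet K fun s _ => hX s]
  rfl

theorem eq_of_notMem_discrepancyEvent {K : ℝ≥0∞} {X Y X' Y' : ℝ≥0 → Ω → LifeMeasure} {ω : Ω}
    {μ : LifeMeasure} (hX : ∀ t, CadlagAt (fun r => X r ω) t)
    (hY : ∀ t, CadlagAt (fun r => Y r ω) t) {t : ℝ≥0}
    (hXX' : ∀ t, Produces α p K (M ω) μ (fun r => X r ω) (fun r => X' r ω) t)
    (hYY' : ∀ t, Produces α p K (M ω) μ (fun r => Y r ω) (fun r => Y' r ω) t)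
    (h : ω ∉ discrepancyEvent M α p K X Y t) : ∀ s ≤ t, X' s ω = Y' s ω := by
  intro s hs
  refine (hXX' s).eq (hYY' s) ?_
  have h0 : M ω (Prod.mk ω ⁻¹' discrepancy α p K X Y t) = 0 := not_not.1 h
  refine (measure_eq_zero_iff_ae_notMem.1 h0).mono fun q hq => ?_
  have key : q ∈ truncEvents α p K (fun r => X r ω) t ↔ q ∈ truncEvents α p K (fun r => Y r ω) t := by
    rw [← mem_predictableEvents_iff hX, ← mem_predictableEvents_iff hY]
    by_contra hne
    apply hq
    change (ω, q) ∈ symmDiff (predictableEvents α p K X t) (predictableEvents α p K Y t)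
    rw [Set.mem_symmDiff]
    tauto
  have hres : ∀ Z : ℝ≥0 → LifeMeasure, q ∈ truncEvents α p K Z s ↔
      q ∈ truncEvents α p K Z t ∧ q.1 ≤ s := by
    intro Z
    constructor
    · exact fun hq => ⟨truncEvents_mono_time K Z hs hq, hq.1.2⟩
    · exact fun hq => ⟨⟨hq.1.1.1, hq.2⟩, hq.1.2⟩
  rw [hres, hres, key]

theorem discrepancy_section_eq_empty {K : ℝ≥0∞} {X Y : ℝ≥0 → Ω → LifeMeasure} {ω : Ω}
    (hX : ∀ t, CadlagAt (fun r => X r ω) t) (hY : ∀ t, CadlagAt (fun r => Y r ω) t) {t : ℝ≥0}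
    (h : ∀ s ≤ t, X s ω = Y s ω) : Prod.mk ω ⁻¹' discrepancy α p K X Y t = ∅ := by
  ext q
  have := truncEvents_congr_path (α := α) (p := p) K (fun s (_ : s ≤ t) => hX s)
    (fun s hs => h s (le_of_lt hs))
  rw [mem_preimage, discrepancy, Set.mem_symmDiff, mem_predictableEvents_iff hX,
    mem_predictableEvents_iff hY, this]
  simp

theorem measurableSet_discrepancy (h : IsBranchingMechanism α p) (K : ℝ≥0∞)
    {X Y : ℝ≥0 → Ω → LifeMeasure} (hX : ∀ t, Measurable[F t] (X t))
    (hY : ∀ t, Measurable[F t] (Y t)) (t : ℝ≥0) :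
    MeasurableSet[predictableSigma F] (discrepancy α p K X Y t) :=
  ((measurableSet_predictableEvents h K hX t).diff (measurableSet_predictableEvents h K hY t)).union
    ((measurableSet_predictableEvents h K hY t).diff (measurableSet_predictableEvents h K hX t))

/-- By integrality and Markov, the probability is at most the expected number of discrepancies. At
time `s` these arise only on `E s`, at rate at most `b K` from each of the two processes, whence the
constant `2bK`. -/
theorem IsPoissonRandomMeasure.measure_discrepancyEvent_le
    (hM : IsPoissonRandomMeasure P F (intensity G) M) (h : IsBranchingMechanism α p) {K : ℕ}
    {b : ℝ≥0} (hb : ∀ x, 0 < x → ENNReal.ofReal (α x) * ∑' n, 1 * ENNReal.ofReal (p x n) ≤ b)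
    {X Y : ℝ≥0 → Ω → LifeMeasure} (hX : ∀ t, Measurable[F t] (X t))
    (hY : ∀ t, Measurable[F t] (Y t)) (hXc : ∀ ω t, CadlagAt (fun r => X r ω) t)
    (hYc : ∀ ω t, CadlagAt (fun r => Y r ω) t) {E : ℝ≥0 → Set Ω}
    (hE : ∀ᵐ ω ∂P, ∀ t, ω ∉ E t → ∀ s ≤ t, X s ω = Y s ω) (t : ℝ≥0) :
    P (discrepancyEvent M α p K X Y t) ≤
      ∫⁻ s in Ioc 0 (t : ℝ), ((2 * b * K : ℝ≥0) : ℝ≥0∞) * P (E s.toNNReal) := by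
  have hD := measurableSet_discrepancy (F := F) h (K : ℝ≥0∞) hX hY t
  have hone : ∀ ω, M ω (Prod.mk ω ⁻¹' discrepancy α p K X Y t) =
      ∫⁻ q in Prod.mk ω ⁻¹' discrepancy α p K X Y t, (fun _ => 1 : ℕ → ℝ≥0∞) (offspring q)
        ∂(M ω) := fun ω => by simp
  calc P (discrepancyEvent M α p K X Y t)
      ≤ P {ω | 1 ≤ M ω (Prod.mk ω ⁻¹' discrepancy α p K X Y t)} := by
        refine measure_mono fun ω hω => ?_
        obtain ⟨k, hk⟩ := hM.integer_valued ω (Prod.mk ω ⁻¹' discrepancy α p K X Y t)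
          (measurable_prodMk_left (predictableSigma_le F _ hD))
        have hω' : M ω (Prod.mk ω ⁻¹' discrepancy α p K X Y t) ≠ 0 := hω
        change 1 ≤ M ω (Prod.mk ω ⁻¹' discrepancy α p K X Y t)
        rw [hk] at hω' ⊢
        have : k ≠ 0 := fun h => hω' (by simp [h])
        exact_mod_cast Order.one_le_iff_ne_zero.2 this
    _ ≤ ∫⁻ ω, M ω (Prod.mk ω ⁻¹' discrepancy α p K X Y t) ∂P := by
        have := mul_meas_ge_le_lintegral₀
          (hM.aemeasurable_section (predictableSigma_le F _ hD)) 1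
        simpa using this
    _ ≤ ∫⁻ s in Ioc 0 (t : ℝ), ∫⁻ ω, (E s.toNNReal).indicator
          (fun _ => ((2 * b * K : ℝ≥0) : ℝ≥0∞)) ω ∂P := by
        simp_rw [hone]
        refine hM.lintegral_le_of_rate hD ?_ (fun _ => 1) _ ?_
        · rintro x (hx | hx)
          · exact predictableEvents_time hx.1
          · exact predictableEvents_time hx.1
        · filter_upwards [hE] with ω hω s hs
          by_cases hωs : ω ∈ E s.toNNReal
          · rw [indicator_of_mem hωs]
            have hsub : {r | (ω, (s, r)) ∈ discrepancy α p K X Y t} ⊆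
                reproduces α p K (leftVersion (fun r => X r ω) s) ∪
                  reproduces α p K (leftVersion (fun r => Y r ω) s) := by
              rw [← setOf_predictableEvents hs, ← setOf_predictableEvents hs]
              rintro r (hr | hr)
              · exact Or.inl hr.1
              · exact Or.inr hr.1
            refine (lintegral_mono_set hsub).trans ((lintegral_union_le _ _ _).trans ?_)
            refine (add_le_add (lintegral_reproduces_le_level h _ K (fun _ => 1) hb)
              (lintegral_reproduces_le_level h _ K (fun _ => 1) hb)).trans (le_of_eq ?_)
            push_cast
            ring
          -- Off `E s` the paths agree up to `s` and so share their events through `s`; a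
          -- discrepancy at time `s` would lie among these.
          · have hempty : {r | (ω, (s, r)) ∈ discrepancy α p K X Y t} = ∅ := by
              rw [eq_empty_iff_forall_notMem]
              intro r hr
              have h1 := discrepancy_section_eq_empty (α := α) (p := p) (K := K) (hXc ω) (hYc ω)
                (hω _ hωs)
              have h2 : (s, r) ∈ Prod.mk ω ⁻¹' discrepancy α p K X Y s.toNNReal := by
                have hs' : s ≤ (s.toNNReal : ℝ) := Real.le_coe_toNNReal s
                rcases hr with hr | hr
                · exact Or.inl ⟨⟨hr.1.1, hs'⟩, fun h => hr.2 ⟨h.1, hs.2⟩⟩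
                · exact Or.inr ⟨⟨hr.1.1, hs'⟩, fun h => hr.2 ⟨h.1, hs.2⟩⟩
              rw [h1] at h2
              exact h2
            rw [hempty]
            simp
    _ ≤ _ := lintegral_mono fun s => lintegral_indicator_const_le _ _

theorem exists_picard_sequence (hM : IsPoissonRandomMeasure P F (intensity G) M)
    (hF : ∀ N : Set Ω, P N = 0 → MeasurableSet[F 0] N) (h : IsBranchingMechanism α p) (K : ℕ)
    {X₀ : Ω → LifeMeasure} (hX₀ : Measurable[F 0] X₀) :
    ∃ X : ℕ → ℝ≥0 → Ω → LifeMeasure, (∀ n t, Measurable[F t] (X n t)) ∧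
      (∀ n ω t, CadlagAt (fun r => X n r ω) t) ∧
      ∀ᵐ ω ∂P, ∀ n t, Produces α p K (M ω) (X₀ ω) (fun r => X n r ω) (fun r => X (n + 1) r ω) t ∧
        totalMass (X (n + 1) t ω) ≤ totalMass (X₀ ω) +
          ∫⁻ q in truncEvents α p K (fun r => X n r ω) t, (offspring q : ℝ≥0∞) ∂(M ω) := by
  let Proc := {X : ℝ≥0 → Ω → LifeMeasure //
    (∀ t, Measurable[F t] (X t)) ∧ ∀ ω t, CadlagAt (fun r => X r ω) t}
  have hstep : ∀ X : Proc, ∃ Y : Proc, ∀ᵐ ω ∂P, ∀ t,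
      Produces α p K (M ω) (X₀ ω) (fun r => X.1 r ω) (fun r => Y.1 r ω) t ∧
        totalMass (Y.1 t ω) ≤ totalMass (X₀ ω) +
          ∫⁻ q in truncEvents α p K (fun r => X.1 r ω) t, (offspring q : ℝ≥0∞) ∂(M ω) := by
    intro X
    obtain ⟨Y, hY1, hY2, hY3⟩ := hM.exists_produces hF h K hX₀ X.2.1 X.2.2
    exact ⟨⟨Y, hY1, hY2⟩, hY3⟩
  choose Φ hΦ using hstep
  let Z : LifeMeasure := ⟨0, by simp⟩
  let X0 : Proc := ⟨fun _ _ => Z, fun _ => measurable_const,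
    fun _ _ => ⟨continuousWithinAt_const, Z.1, tendsto_const_nhds⟩⟩
  refine ⟨fun n => (Φ^[n] X0).1, fun n => (Φ^[n] X0).2.1, fun n => (Φ^[n] X0).2.2, ?_⟩
  refine ae_all_iff.2 fun n => ?_
  simp_rw [Function.iterate_succ_apply']
  exact hΦ _

/-- The equation truncated at the level `K` has an adapted solution. -/
theorem exists_truncated_solution (hM : IsPoissonRandomMeasure P F (intensity G) M)
    (hF : ∀ N : Set Ω, P N = 0 → MeasurableSet[F 0] N) (h : IsBranchingMechanism α p) (K : ℕ)
    {X₀ : Ω → LifeMeasure} (hX₀ : Measurable[F 0] X₀) :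
    ∃ X : ℝ≥0 → Ω → LifeMeasure, (∀ t, Measurable[F t] (X t)) ∧
      ∀ᵐ ω ∂P, ∀ t, CadlagAt (fun r => X r ω) t ∧
        Produces α p K (M ω) (X₀ ω) (fun r => X r ω) (fun r => X r ω) t ∧
        totalMass (X t ω) ≤ totalMass (X₀ ω) +
          ∫⁻ q in truncEvents α p K (fun r => X r ω) t, (offspring q : ℝ≥0∞) ∂(M ω) := by
  obtain ⟨b, hb⟩ := h.exists_rate_bound
  obtain ⟨X, hXm, hXc, hXp⟩ := exists_picard_sequence hM hF h K hX₀
  let E : ℕ → ℝ≥0 → Set Ω := fun j => discrepancyEvent M α p K (X (j + 1)) (X j)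
  have hEeq : ∀ᵐ ω ∂P, ∀ j t, ω ∉ E j t → ∀ s ≤ t, X (j + 2) s ω = X (j + 1) s ω := by
    filter_upwards [hXp] with ω hω j t hj
    exact eq_of_notMem_discrepancyEvent (hXc (j + 1) ω) (hXc j ω) (fun t => (hω (j + 1) t).1)
      (fun t => (hω j t).1) hj
  have hEle : ∀ j t, P (E j t) ≤
      ENNReal.ofReal (((2 * b * K : ℝ≥0) * t) ^ j / j.factorial) := by
    intro j
    induction j with
    | zero => intro t; simpa using prob_le_one
    | succ j ih =>
      intro t
      refine (hM.measure_discrepancyEvent_le h hb (hXm (j + 2)) (hXm (j + 1)) (hXc (j + 2))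
        (hXc (j + 1)) (E := E j) (hEeq.mono fun ω hω => hω j) t).trans ?_
      rw [← lintegral_pow_div_factorial]
      refine setLIntegral_mono' measurableSet_Ioc fun s hs => ?_
      gcongr
      refine (ih s.toNNReal).trans (le_of_eq ?_)
      rw [Real.coe_toNNReal s hs.1.le]
  have hEnull : ∀ t, P (⋂ j, E j t) = 0 := by
    intro t
    have hlim : Tendsto (fun j : ℕ => ENNReal.ofReal (((2 * b * K : ℝ≥0) * t) ^ j / j.factorial))
        atTop (𝓝 0) := by
      rw [← ENNReal.ofReal_zero]
      exact ENNReal.tendsto_ofReal (FloorSemiring.tendsto_pow_div_factorial_atTop _)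
    exact le_antisymm (ge_of_tendsto' hlim fun j =>
      (measure_mono (iInter_subset _ j)).trans (hEle j t)) zero_le
  have hstab : ∀ᵐ ω ∂P, ∀ t : ℝ≥0, ∃ n, ∀ m ≥ n, ∀ s ≤ t, X m s ω = X n s ω := by
    have hnot : ∀ᵐ ω ∂P, ∀ k : ℕ, ω ∉ ⋂ j, E j k :=
      ae_all_iff.2 fun k => measure_eq_zero_iff_ae_notMem.1 (hEnull k)
    filter_upwards [hnot, hEeq] with ω h1 h2 t
    obtain ⟨k, hk⟩ := exists_nat_ge t
    have h3 := h1 k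
    rw [mem_iInter, not_forall] at h3
    obtain ⟨j, hj⟩ := h3
    -- One step without discrepancy makes the next two iterates equal, so no later step produces a
    -- discrepancy either.
    have hall : ∀ i, ω ∉ E (j + i) k := by
      intro i
      induction i with
      | zero => exact hj
      | succ i ih =>
        have := discrepancy_section_eq_empty (α := α) (p := p) (K := K) (hXc (j + i + 2) ω)
          (hXc (j + i + 1) ω) (h2 _ _ ih)
        change ¬ (M ω (Prod.mk ω ⁻¹' discrepancy α p K (X (j + i + 2)) (X (j + i + 1)) k) ≠ 0)
        rw [this]
        simp
    refine ⟨j + 1, fun m hm s hs => ?_⟩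
    obtain ⟨i, rfl⟩ := Nat.exists_eq_add_of_le hm
    induction i with
    | zero => rfl
    | succ i ih =>
      rw [← ih (by omega), show j + 1 + (i + 1) = (j + i) + 2 by ring,
        show j + 1 + i = (j + i) + 1 by ring]
      exact h2 _ _ (hall i) s (hs.trans hk)
  obtain ⟨Z, hZm, hZ⟩ := exists_stable_limit hF hXm hstab
  refine ⟨Z, hZm, ?_⟩
  filter_upwards [hZ, hXp] with ω h1 h2 t
  -- The horizon `t + 1` leaves room to the right of `t` for transferring the càdlàg property.
  obtain ⟨n, hn⟩ := h1 (t + 1)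
  have ht : t < t + 1 := lt_add_one t
  have hn0 := hn n le_rfl
  have hn1 := hn (n + 1) (Nat.le_succ n) t ht.le
  have hev : truncEvents α p K (fun r => X n r ω) t = truncEvents α p K (fun r => Z r ω) t :=
    truncEvents_congr_path K (fun s _ => hXc n ω s) fun s hs => hn0 s (hs.le.trans ht.le)
  have h3 := h2 n t
  rw [Produces, hev, hn1] at h3
  exact ⟨(hXc n ω t).congr ht hn0, h3⟩

end Picard

/-! ### Removal of the truncation and the first-moment bound. -/

section Global

/-- Gronwall by iteration: `n` substitutions give a partial sum of the exponential series plus the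
remainder `C (bt)^n / n!`, which tends to zero since `C` is finite. Only explicit upper bounds are
evaluated, so `φ` need not be measurable. -/
theorem le_exp_of_integral_inequality {φ : ℝ≥0 → ℝ≥0∞} {a C : ℝ≥0∞} {b t : ℝ≥0}
    (hφ : ∀ s ≤ t, φ s ≤ a + ∫⁻ r in Ioc 0 (s : ℝ), (b : ℝ≥0∞) * φ r.toNNReal)
    (hC : C ≠ ⊤) (hφC : ∀ s ≤ t, φ s ≤ C) :
    φ t ≤ a * ENNReal.ofReal (Real.exp (b * t)) := by
  let e : ℕ → ℝ → ℝ≥0∞ := fun j r => ENNReal.ofReal ((b * r) ^ j / j.factorial)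
  have he : ∀ j, Measurable (e j) := fun j => by
    apply Measurable.ennreal_ofReal
    fun_prop
  have hint : ∀ (s : ℝ≥0) j, ∫⁻ r in Ioc 0 (s : ℝ), (b : ℝ≥0∞) * e j r = e (j + 1) s :=
    fun s j => lintegral_pow_div_factorial b s j
  have hiter : ∀ n, ∀ s ≤ t, φ s ≤ a * ∑ j ∈ Finset.range n, e j s + C * e n s := by
    intro n
    induction n with
    | zero => intro s hs; simpa [e] using hφC s hs
    | succ n ih =>
      intro s hs
      have hbe : ∀ j, Measurable fun r => (b : ℝ≥0∞) * e j r := fun j => (he j).const_mul _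
      have hsm : Measurable fun r => ∑ j ∈ Finset.range n, (b : ℝ≥0∞) * e j r :=
        Finset.measurable_fun_sum _ fun j _ => hbe j
      calc φ s ≤ a + ∫⁻ r in Ioc 0 (s : ℝ), (b : ℝ≥0∞) * φ r.toNNReal := hφ s hs
        _ ≤ a + ∫⁻ r in Ioc 0 (s : ℝ), (a * ∑ j ∈ Finset.range n, (b : ℝ≥0∞) * e j r +
              C * ((b : ℝ≥0∞) * e n r)) := by
            refine add_le_add le_rfl (setLIntegral_mono' measurableSet_Ioc fun r hr => ?_)
            have h1 := ih r.toNNReal ((Real.toNNReal_le_iff_le_coe.2 hr.2).trans hs)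
            rw [Real.coe_toNNReal r hr.1.le] at h1
            calc (b : ℝ≥0∞) * φ r.toNNReal
                ≤ b * (a * ∑ j ∈ Finset.range n, e j r + C * e n r) := by gcongr
              _ = _ := by rw [← Finset.mul_sum]; ring
        _ = a + (a * ∑ j ∈ Finset.range n, e (j + 1) s + C * e (n + 1) s) := by
            rw [lintegral_add_left (hsm.const_mul _), lintegral_const_mul _ hsm,
              lintegral_const_mul _ (hbe n), lintegral_finsetSum _ fun j _ => hbe j, hint]
            simp_rw [hint]
        _ = a * ∑ j ∈ Finset.range (n + 1), e j s + C * e (n + 1) s := by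
            have h0 : e 0 s = 1 := by simp [e]
            rw [Finset.sum_range_succ', h0]
            ring
  have hbound : ∀ n, φ t ≤ a * ENNReal.ofReal (Real.exp (b * t)) + C * e n t := by
    intro n
    refine (hiter n t le_rfl).trans ?_
    gcongr
    simp only [e]
    rw [← ENNReal.ofReal_sum_of_nonneg fun j _ => by positivity]
    exact ENNReal.ofReal_le_ofReal (Real.sum_le_exp_of_nonneg (by positivity) n)
  have hlim : Tendsto (fun n => a * ENNReal.ofReal (Real.exp (b * t)) + C * e n t) atTop
      (𝓝 (a * ENNReal.ofReal (Real.exp (b * t)) + C * 0)) := by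
    refine Tendsto.const_add _ (ENNReal.Tendsto.const_mul ?_ (Or.inr hC))
    rw [← ENNReal.ofReal_zero]
    exact ENNReal.tendsto_ofReal (FloorSemiring.tendsto_pow_div_factorial_atTop _)
  simpa using ge_of_tendsto' hlim hbound

variable {α : ℝ → ℝ} {p : ℝ → ℕ → ℝ} {Ω : Type*} {mΩ : MeasurableSpace Ω} {P : Measure Ω}
  [IsProbabilityMeasure P] {F : Filtration ℝ≥0 mΩ} {M : Ω → Measure NoisePoint} {G : Measure ℝ}
  [IsProbabilityMeasure G] {X₀ : Ω → LifeMeasure}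

/-- The initial mass together with all births up to time `t`. -/
def progeny (M : Ω → Measure NoisePoint) (X₀ : Ω → LifeMeasure) (α : ℝ → ℝ) (p : ℝ → ℕ → ℝ)
    (K : ℝ≥0∞) (X : ℝ≥0 → Ω → LifeMeasure) (t : ℝ≥0) (ω : Ω) : ℝ≥0∞ :=
  totalMass (X₀ ω) +
    ∫⁻ q in eventSet α p K (fun r => X r ω) ∩ {q | q.1 ≤ t}, (offspring q : ℝ≥0∞) ∂(M ω)

theorem progeny_mono (K : ℝ≥0∞) (X : ℝ≥0 → Ω → LifeMeasure) (ω : Ω) {s t : ℝ≥0} (hst : s ≤ t) :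
    progeny M X₀ α p K X s ω ≤ progeny M X₀ α p K X t ω := by
  have hsub : eventSet α p K (fun r => X r ω) ∩ {q | q.1 ≤ (s : ℝ)} ⊆
      eventSet α p K (fun r => X r ω) ∩ {q | q.1 ≤ (t : ℝ)} := fun q hq =>
    ⟨hq.1, le_trans (show q.1 ≤ s from hq.2) (by exact_mod_cast hst)⟩
  exact add_le_add le_rfl (lintegral_mono_set hsub)

theorem measurable_totalMass : Measurable totalMass :=
  (measurable_finiteMeasure_apply MeasurableSet.univ).comp measurable_subtype_coe

theorem aemeasurable_progeny {P : Measure Ω} (hM : IsPoissonRandomMeasure P F (intensity G) M)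
    (h : IsBranchingMechanism α p) (hX₀ : Measurable[F 0] X₀) (K : ℝ≥0∞)
    {X : ℝ≥0 → Ω → LifeMeasure} (hX : ∀ t, Measurable[F t] (X t)) (t : ℝ≥0) :
    AEMeasurable (progeny M X₀ α p K X t) P :=
  (measurable_totalMass.comp (hX₀.mono (F.le 0) le_rfl)).aemeasurable.add
    (hM.aemeasurable_setLIntegral
      (predictableSigma_le F _ (measurableSet_predictableEvents h K hX t)) fun n => n)

/-- The first-moment bound for solutions of the truncated equation. -/
theorem setLIntegral_progeny_le (hM : IsPoissonRandomMeasure P F (intensity G) M)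
    (h : IsBranchingMechanism α p) (hX₀ : Measurable[F 0] X₀) (K : ℕ)
    {X : ℝ≥0 → Ω → LifeMeasure} (hX : ∀ t, Measurable[F t] (X t))
    (hXc : ∀ᵐ ω ∂P, ∀ t, CadlagAt (fun r => X r ω) t)
    (hXm : ∀ᵐ ω ∂P, ∀ t, totalMass (X t ω) ≤ progeny M X₀ α p K X t ω)
    {A : Set Ω} (hA : MeasurableSet[F 0] A) (t : ℝ≥0) :
    ∫⁻ ω in A, progeny M X₀ α p K X t ω ∂P ≤ (∫⁻ ω in A, totalMass (X₀ ω) ∂P) *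
      ENNReal.ofReal (Real.exp ((growthRate α p).toReal * t)) := by
  have hA' : MeasurableSet A := F.le 0 _ hA
  have hβ : ((growthRate α p).toNNReal : ℝ≥0∞) = growthRate α p :=
    ENNReal.coe_toNNReal h.growthRate_lt_top.ne
  have hmX₀ : Measurable fun ω => totalMass (X₀ ω) :=
    measurable_totalMass.comp (hX₀.mono (F.le 0) le_rfl)
  have hsplit : ∀ s, ∫⁻ ω in A, progeny M X₀ α p K X s ω ∂P = ∫⁻ ω in A, totalMass (X₀ ω) ∂P +
      ∫⁻ ω in A, (∫⁻ q in eventSet α p K (fun r => X r ω) ∩ {q | q.1 ≤ s},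
        (offspring q : ℝ≥0∞) ∂(M ω)) ∂P := fun s => lintegral_add_left hmX₀ _
  by_cases ha : ∫⁻ ω in A, totalMass (X₀ ω) ∂P = ⊤
  · rw [ha, ENNReal.top_mul]
    · exact le_top
    · simpa using Real.exp_pos _
  have hrate : ∀ x, 0 < x →
      ENNReal.ofReal (α x) * ∑' n : ℕ, (n : ℝ≥0∞) * ENNReal.ofReal (p x n) ≤ growthRate α p :=
    fun x hx => le_growthRate hx
  -- The a priori bound `C` depends on `K` through the truncation but serves only to start Gronwall;
  -- the resulting estimate is uniform in `K`.
  refine le_exp_of_integral_inequality (φ := fun s => ∫⁻ ω in A, progeny M X₀ α p K X s ω ∂P)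
    (C := ∫⁻ ω in A, totalMass (X₀ ω) ∂P + growthRate α p * K * t) (b := (growthRate α p).toNNReal)
    ?_ ?_ ?_
  · intro s _
    rw [hsplit]
    refine add_le_add le_rfl ?_
    have hD : MeasurableSet[predictableSigma F]
        (Prod.fst ⁻¹' A ∩ predictableEvents α p K X s) :=
      (measurableSet_predictable_initial F hA).inter (measurableSet_predictableEvents h K hX s)
    calc ∫⁻ ω in A, (∫⁻ q in eventSet α p K (fun r => X r ω) ∩ {q | q.1 ≤ s},
          (offspring q : ℝ≥0∞) ∂(M ω)) ∂P
        = ∫⁻ ω, (∫⁻ q in Prod.mk ω ⁻¹' (Prod.fst ⁻¹' A ∩ predictableEvents α p K X s),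
            (fun n => n : ℕ → ℝ≥0∞) (offspring q) ∂(M ω)) ∂P := by
          rw [← lintegral_indicator hA']
          refine lintegral_congr fun ω => ?_
          by_cases hω : ω ∈ A
          · have : Prod.mk ω ⁻¹' (Prod.fst ⁻¹' A ∩ predictableEvents α p K X s) =
                eventSet α p K (fun r => X r ω) ∩ {q | q.1 ≤ s} := by
              rw [← predictableEvents_section]
              ext q
              simp [hω]
            rw [indicator_of_mem hω, this]
          · have : Prod.mk ω ⁻¹' (Prod.fst ⁻¹' A ∩ predictableEvents α p K X s) = ∅ := by
              ext q
              simp [hω]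
            rw [indicator_of_notMem hω, this]
            simp
      _ ≤ ∫⁻ r in Ioc 0 (s : ℝ), ∫⁻ ω, A.indicator
            (fun ω => growthRate α p * progeny M X₀ α p K X r.toNNReal ω) ω ∂P := by
          refine hM.lintegral_le_of_rate hD (fun x hx => predictableEvents_time hx.2) _ _ ?_
          filter_upwards [hXc, hXm] with ω hc hm r hr
          by_cases hω : ω ∈ A
          · rw [indicator_of_mem hω]
            have hsub : {x | (ω, (r, x)) ∈ Prod.fst ⁻¹' A ∩ predictableEvents α p K X s} ⊆
                reproduces α p K (leftVersion (fun r => X r ω) r) := by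
              rw [← setOf_predictableEvents hr]
              exact fun x hx => hx.2
            refine (lintegral_mono_set hsub).trans
              ((lintegral_reproduces_le G h _ K _ hrate).trans ?_)
            gcongr
            have hr0 : 0 < r.toNNReal := Real.toNNReal_pos.2 hr.1
            have hv := leftVersion_eq hr0 (hc _)
            rw [Real.coe_toNNReal r hr.1.le] at hv
            rw [hv]
            refine mass_leftLimit_le hr0 (hc _) ?_
            filter_upwards [self_mem_nhdsWithin] with u hu
            exact (hm u).trans (progeny_mono _ _ _ (le_of_lt hu))
          · have : {x | (ω, (r, x)) ∈ Prod.fst ⁻¹' A ∩ predictableEvents α p K X s} = ∅ := by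
              ext x
              simp [hω]
            rw [this]
            simp
      _ = ∫⁻ r in Ioc 0 (s : ℝ), ((growthRate α p).toNNReal : ℝ≥0∞) *
            ∫⁻ ω in A, progeny M X₀ α p K X r.toNNReal ω ∂P := by
          refine lintegral_congr fun r => ?_
          rw [lintegral_indicator hA', hβ, lintegral_const_mul' _ _ h.growthRate_lt_top.ne]
  · exact ENNReal.add_ne_top.2 ⟨ha, ENNReal.mul_ne_top (ENNReal.mul_ne_top
      h.growthRate_lt_top.ne (ENNReal.natCast_ne_top K)) ENNReal.coe_ne_top⟩
  · intro s hs
    rw [hsplit]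
    refine add_le_add le_rfl ((setLIntegral_le_lintegral _ _).trans ?_)
    refine (hM.lintegral_events_le_level h K hX s _ hrate).trans ?_
    gcongr

/-- The truncation levels are eventually not reached. -/
theorem ae_exists_progeny_le (hM : IsPoissonRandomMeasure P F (intensity G) M)
    (h : IsBranchingMechanism α p) (hX₀ : Measurable[F 0] X₀)
    {X : ℕ → ℝ≥0 → Ω → LifeMeasure} (hX : ∀ K t, Measurable[F t] (X K t))
    (hXc : ∀ K, ∀ᵐ ω ∂P, ∀ t, CadlagAt (fun r => X K r ω) t)
    (hXm : ∀ K : ℕ, ∀ᵐ ω ∂P, ∀ t, totalMass (X K t ω) ≤ progeny M X₀ α p K (X K) t ω) :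
    ∀ᵐ ω ∂P, ∀ t : ℝ≥0, ∃ K : ℕ, progeny M X₀ α p K (X K) t ω ≤ K := by
  -- On `{X₀(∞) ≤ m}` the mean progeny is at most `c` at every level, so by Markov `K` times this
  -- probability is at most `c` for all `K`. Restricting to this event avoids any moment assumption
  -- on `X₀`.
  have key : ∀ m n : ℕ, P ({ω | totalMass (X₀ ω) ≤ m} ∩
      ⋂ K : ℕ, {ω | (K : ℝ≥0∞) ≤ progeny M X₀ α p K (X K) n ω}) = 0 := by
    intro m n
    by_contra hne
    set A : Set Ω := {ω | totalMass (X₀ ω) ≤ m} with hAdef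
    have hA : MeasurableSet[F 0] A := (measurable_totalMass.comp hX₀) measurableSet_Iic
    set c : ℝ≥0∞ := m * ENNReal.ofReal (Real.exp ((growthRate α p).toReal * (n : ℝ≥0))) with hc
    have hctop : c ≠ ⊤ := ENNReal.mul_ne_top (ENNReal.natCast_ne_top m) ENNReal.ofReal_ne_top
    obtain ⟨K, hK⟩ := ENNReal.exists_nat_mul_gt hne hctop
    refine absurd hK (not_lt.2 ?_)
    calc (K : ℝ≥0∞) * P (A ∩ ⋂ K : ℕ, {ω | (K : ℝ≥0∞) ≤ progeny M X₀ α p K (X K) n ω})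
        ≤ K * (P.restrict A) {ω | (K : ℝ≥0∞) ≤ progeny M X₀ α p K (X K) n ω} := by
          refine mul_le_mul' le_rfl ?_
          rw [Measure.restrict_apply' (F.le 0 _ hA), inter_comm]
          exact measure_mono (inter_subset_inter_left _ (iInter_subset _ K))
      _ ≤ ∫⁻ ω in A, progeny M X₀ α p K (X K) n ω ∂P :=
          mul_meas_ge_le_lintegral₀ (aemeasurable_progeny hM h hX₀ K (hX K) n).restrict _
      _ ≤ (∫⁻ ω in A, totalMass (X₀ ω) ∂P) *
            ENNReal.ofReal (Real.exp ((growthRate α p).toReal * (n : ℝ≥0))) :=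
          setLIntegral_progeny_le hM h hX₀ K (hX K) (hXc K) (hXm K) hA n
      _ ≤ c := by
          rw [hc]
          gcongr
          calc ∫⁻ ω in A, totalMass (X₀ ω) ∂P ≤ ∫⁻ _ in A, (m : ℝ≥0∞) ∂P :=
                setLIntegral_mono' (F.le 0 _ hA) fun ω hω => hω
            _ = m * P A := setLIntegral_const _ _
            _ ≤ m * 1 := by gcongr; exact prob_le_one
            _ = m := mul_one _
  have hall : ∀ᵐ ω ∂P, ∀ m n : ℕ, ω ∉ {ω | totalMass (X₀ ω) ≤ m} ∩
      ⋂ K : ℕ, {ω | (K : ℝ≥0∞) ≤ progeny M X₀ α p K (X K) n ω} :=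
    ae_all_iff.2 fun m => ae_all_iff.2 fun n => measure_eq_zero_iff_ae_notMem.1 (key m n)
  filter_upwards [hall] with ω hω t
  obtain ⟨n, hn⟩ := exists_nat_ge t
  obtain ⟨m, hm⟩ := ENNReal.exists_nat_gt (show totalMass (X₀ ω) ≠ ⊤ from measure_ne_top _ _)
  have h1 := hω m n
  by_contra! hcon
  refine h1 ⟨hm.le, mem_iInter.2 fun K => ?_⟩
  exact (hcon K).le.trans (progeny_mono _ _ _ hn)

theorem progeny_eq {K : ℝ≥0∞} {X : ℝ≥0 → Ω → LifeMeasure} {ω : Ω} {t : ℝ≥0}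
    (hX : ∀ s, CadlagAt (fun r => X r ω) s) :
    progeny M X₀ α p K X t ω = totalMass (X₀ ω) +
      ∫⁻ q in truncEvents α p K (fun r => X r ω) t, (offspring q : ℝ≥0∞) ∂(M ω) := by
  rw [progeny, truncEvents_eq_eventSet K fun s _ => hX s]

/-- Existence of an adapted global solution, for a filtration that contains the null sets. -/
theorem exists_global_solution (hM : IsPoissonRandomMeasure P F (intensity G) M)
    (hF : ∀ N : Set Ω, P N = 0 → MeasurableSet[F 0] N) (h : IsBranchingMechanism α p)
    (hX₀ : Measurable[F 0] X₀) :
    ∃ X : ℝ≥0 → Ω → LifeMeasure, (∀ t, Measurable[F t] (X t)) ∧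
      (∀ᵐ ω ∂P, ∀ t, CadlagAt (fun r => X r ω) t ∧
        SolvesAt α p (M ω) (X₀ ω) (fun r => X r ω) t ∧
        M ω (birthEvents α p (fun r => X r ω) t) < ⊤) ∧
      ∀ t : ℝ≥0, (∫⁻ ω, (⨆ s ∈ Iic t, totalMass (X s ω)) ∂P) ≤
        (∫⁻ ω, totalMass (X₀ ω) ∂P) *
          ENNReal.ofReal (Real.exp ((growthRate α p).toReal * t)) := by
  choose Y hYm hY using fun K : ℕ => exists_truncated_solution hM hF h K hX₀
  have hYc : ∀ K, ∀ᵐ ω ∂P, ∀ t, CadlagAt (fun r => Y K r ω) t :=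
    fun K => (hY K).mono fun ω hω t => (hω t).1
  have hYmass : ∀ K : ℕ, ∀ᵐ ω ∂P, ∀ t, totalMass (Y K t ω) ≤ progeny M X₀ α p K (Y K) t ω := by
    intro K
    filter_upwards [hY K] with ω hω t
    rw [progeny_eq fun s => (hω s).1]
    exact (hω t).2.2
  have hfin : ∀ᵐ ω ∂P, ∀ (K k : ℕ) (t : ℝ≥0), (∀ s ≤ t, CadlagAt (fun r => Y K r ω) s) →
      M ω (truncEvents α p k (fun r => Y K r ω) t) < ⊤ :=
    ae_all_iff.2 fun K => hM.ae_events_lt_top h (hYm K)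
  -- If the progeny at level `n` is at most `n` by time `t`, the truncation is never felt, so `Y n`
  -- solves the equation at every level `m ≥ n` and equals `Y m` by uniqueness.
  have hstab : ∀ᵐ ω ∂P, ∀ t : ℝ≥0, ∃ n : ℕ, ∀ m ≥ n, (∀ s ≤ t, Y m s ω = Y n s ω) ∧
      progeny M X₀ α p m (Y m) t ω ≤ m := by
    filter_upwards [ae_all_iff.2 hY, ae_all_iff.2 hYmass, hfin,
      ae_exists_progeny_le hM h hX₀ hYm hYc hYmass] with ω h1 h2 h3 h4 t
    obtain ⟨n, hn⟩ := h4 t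
    have hmass : ∀ s ≤ t, totalMass (Y n s ω) ≤ n := fun s hs =>
      (h2 n s).trans ((progeny_mono _ _ _ hs).trans hn)
    refine ⟨n, fun m hm => ?_⟩
    have hnm : (n : ℝ≥0∞) ≤ m := by exact_mod_cast hm
    have hlevel : ∀ s ≤ t, truncEvents α p n (fun r => Y n r ω) s =
        truncEvents α p m (fun r => Y n r ω) s := fun s hs =>
      truncEvents_congr_level (fun u _ => (h1 n u).1) (fun u hu => hmass u (hu.le.trans hs)) hnm
    have heq : ∀ s ≤ t, Y m s ω = Y n s ω := by
      refine eq_of_produces (K := m) (μ := X₀ ω) (hM.integer_valued ω)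
        (X := fun r => Y m r ω) (Y := fun r => Y n r ω)
        (fun s _ => (h1 m s).1) (fun s _ => (h1 n s).1) (fun k => h3 m k t fun s _ => (h1 m s).1)
        (fun k => h3 n k t fun s _ => (h1 n s).1) (fun s _ => (h1 m s).2.1) (fun s hs => ?_)
      have := (h1 n s).2.1
      rwa [Produces, hlevel s hs] at this
    refine ⟨heq, ?_⟩
    have hev : truncEvents α p m (fun r => Y m r ω) t = truncEvents α p n (fun r => Y n r ω) t := by
      rw [hlevel t le_rfl]
      exact truncEvents_congr_path _ (fun s _ => (h1 m s).1) fun s hs => heq s hs.le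
    rw [progeny_eq fun s => (h1 n s).1] at hn
    rw [progeny_eq fun s => (h1 m s).1, hev]
    exact hn.trans hnm
  obtain ⟨X, hXm, hX⟩ := exists_stable_limit hF hYm (hstab.mono fun ω hω t =>
    (hω t).imp fun n hn m hm => (hn m hm).1)
  have hgood : ∀ᵐ ω ∂P, ∀ t : ℝ≥0, ∃ n : ℕ, ∀ m ≥ n, (∀ s ≤ t, Y m s ω = X s ω) ∧
      progeny M X₀ α p m (Y m) t ω ≤ m := by
    filter_upwards [hstab, hX] with ω h1 h2 t
    obtain ⟨n, hn⟩ := h1 t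
    obtain ⟨k, hk⟩ := h2 t
    exact ⟨max n k, fun m hm => ⟨hk m ((le_max_right _ _).trans hm),
      (hn m ((le_max_left _ _).trans hm)).2⟩⟩
  refine ⟨X, hXm, ?_, fun t => ?_⟩
  · filter_upwards [hgood, ae_all_iff.2 hY, ae_all_iff.2 hYmass, hfin] with ω h1 h2 h3 h4 t
    obtain ⟨m, hm⟩ := h1 (t + 1)
    obtain ⟨heq, hle⟩ := hm m le_rfl
    have ht : t < t + 1 := lt_add_one t
    have hmass : ∀ s < t, totalMass (Y m s ω) ≤ m := fun s hs =>
      (h3 m s).trans ((progeny_mono _ _ _ (hs.le.trans ht.le)).trans hle)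
    have hev : truncEvents α p m (fun r => Y m r ω) t = truncEvents α p ⊤ (fun r => X r ω) t := by
      rw [truncEvents_congr_level (fun u _ => (h2 m u).1) hmass le_top]
      exact truncEvents_congr_path _ (fun s _ => (h2 m s).1) fun s hs => heq s (hs.le.trans ht.le)
    refine ⟨(h2 m t).1.congr ht heq, ?_, ?_⟩
    · rw [solvesAt_iff]
      have := (h2 m t).2.1
      rwa [Produces, hev, heq t ht.le] at this
    · rw [← truncEvents_top, ← hev]
      exact h4 m m t fun s _ => (h2 m s).1
  -- The progeny increases in time and dominates the mass, hence also the running supremum; Fatou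
  -- transfers its uniform bound to the limit.
  · calc (∫⁻ ω, (⨆ s ∈ Iic t, totalMass (X s ω)) ∂P)
        ≤ ∫⁻ ω, liminf (fun m : ℕ => progeny M X₀ α p m (Y m) t ω) atTop ∂P := by
          refine lintegral_mono_ae ?_
          filter_upwards [hgood, ae_all_iff.2 hYmass] with ω h1 h2
          obtain ⟨n, hn⟩ := h1 t
          refine le_liminf_of_le (h := ?_)
          filter_upwards [eventually_ge_atTop n] with m hm
          refine iSup₂_le fun s hs => ?_
          rw [← (hn m hm).1 s hs]
          exact (h2 m s).trans (progeny_mono _ _ _ hs)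
      _ ≤ liminf (fun m : ℕ => ∫⁻ ω, progeny M X₀ α p m (Y m) t ω ∂P) atTop :=
          lintegral_liminf_le' fun m => aemeasurable_progeny hM h hX₀ m (hYm m) t
      _ ≤ _ := by
          refine liminf_le_of_le (h := fun b hb => ?_)
          obtain ⟨m, hm⟩ := hb.exists
          refine hm.trans ?_
          have := setLIntegral_progeny_le hM h hX₀ m (hYm m) (hYc m) (hYmass m)
            (@MeasurableSet.univ Ω (F 0)) t
          simpa using this

end Global

/-! ### The completed filtration of the initial value and the noise. -/

section Strong

variable {Ω : Type*} {mΩ : MeasurableSpace Ω} {P : Measure Ω} {F : Filtration ℝ≥0 mΩ}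
  {M : Ω → Measure NoisePoint} {X₀ : Ω → LifeMeasure} {Λ : Measure NoisePoint}

theorem drivingSigma_le (hF : UsualHypotheses P F) (hM : IsPoissonRandomMeasure P F Λ M)
    (hX₀ : Measurable[F 0] X₀) (t : ℝ≥0) : drivingSigma P M X₀ t ≤ F t := by
  refine sup_le (sup_le ?_ (hM.adapted t)) ?_
  · exact hX₀.comap_le.trans (F.mono zero_le)
  · exact MeasurableSpace.generateFrom_le fun N hN => measurableSet_of_null hF.complete t hN

/-- The completed filtration generated by the initial value and the noise. -/
def drivingFiltration (hF : UsualHypotheses P F) (hM : IsPoissonRandomMeasure P F Λ M)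
    (hX₀ : Measurable[F 0] X₀) : Filtration ℝ≥0 mΩ where
  seq t := drivingSigma P M X₀ t
  mono' := by
    intro s t hst
    refine sup_le_sup (sup_le_sup le_rfl ?_) le_rfl
    refine iSup₂_le fun B hB => le_iSup₂_of_le B ⟨hB.1, fun q hq => ?_⟩ le_rfl
    exact le_trans (show q.1 ≤ s from hB.2 hq) (by exact_mod_cast hst)
  le' t := (drivingSigma_le hF hM hX₀ t).trans (F.le t)

/-- The new σ-algebras are smaller than `F t`, so independence from the future noise is inherited,
and they still contain the past noise. -/
theorem isPoissonRandomMeasure_drivingFiltration (hF : UsualHypotheses P F)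
    (hM : IsPoissonRandomMeasure P F Λ M) (hX₀ : Measurable[F 0] X₀) :
    IsPoissonRandomMeasure P (drivingFiltration hF hM hX₀) Λ M where
  measurable := hM.measurable
  integer_valued := hM.integer_valued
  law := hM.law
  indep := hM.indep
  adapted _ := le_sup_of_le_left le_sup_right
  indep_past t := indep_of_indep_of_le_right (hM.indep_past t) (drivingSigma_le hF hM hX₀ t)

end Strong

end AgeBranching

end

open AgeBranching in
theorem mainTheorem2 {Ω : Type*} {mΩ : MeasurableSpace Ω} (P : Measure Ω) [IsProbabilityMeasure P]
    (F : Filtration ℝ≥0 mΩ) (hF : UsualHypotheses P F)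
    (α : ℝ → ℝ) (p : ℝ → ℕ → ℝ) (hαp : IsBranchingMechanism α p)
    (G : Measure ℝ) [IsProbabilityMeasure G] (hG : G (Iic 0) = 0)
    (M : Ω → Measure NoisePoint) (hM : IsPoissonRandomMeasure P F (intensity G) M)
    (X₀ : Ω → LifeMeasure) (hX₀ : Measurable[F 0] X₀) :
    -- there is a strong solution with infinite lifetime ...
    (∃ X : ℝ≥0 → Ω → LifeMeasure,
      IsStrongSolution P F α p M X₀ X (fun _ => ⊤) ∧
      -- ... whose reproduction events do not accumulate in finite time ...
      (∀ᵐ ω ∂P, ∀ t : ℝ≥0, M ω (birthEvents α p (fun r => X r ω) t) < ⊤) ∧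
      -- ... and which satisfies the first-moment bound
      (∀ t : ℝ≥0, (∫⁻ ω, (⨆ s ∈ Iic t, totalMass (X s ω)) ∂P) ≤
        (∫⁻ ω, totalMass (X₀ ω) ∂P) *
          ENNReal.ofReal (Real.exp ((growthRate α p).toReal * t)))) ∧
    -- any two solutions driven by the same noise coincide as long as both are alive
    (∀ (X Y : ℝ≥0 → Ω → LifeMeasure) (ζ η : Ω → WithTop ℝ≥0),
      IsSolution P F α p M X₀ X ζ → IsSolution P F α p M X₀ Y η →
      ∀ᵐ ω ∂P, ∀ t : ℝ≥0, (t : WithTop ℝ≥0) < ζ ω → (t : WithTop ℝ≥0) < η ω →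
        X t ω = Y t ω) := by
  have hM' := isPoissonRandomMeasure_drivingFiltration hF hM hX₀
  -- Existence is applied to the driving filtration itself: adaptedness there is the strong
  -- property, and inclusion gives adaptedness to `F`.
  obtain ⟨X, hXm, hX, hmoment⟩ := exists_global_solution (X₀ := X₀) hM'
    (fun N hN => le_sup_right (a := MeasurableSpace.comap X₀ inferInstance ⊔
      noiseSigma M (Iic ((0 : ℝ≥0) : ℝ))) _ (MeasurableSpace.measurableSet_generateFrom hN)) hαp
    ((comap_measurable X₀).mono (le_sup_of_le_left le_sup_left) le_rfl)
  refine ⟨⟨X, ⟨⟨?_, fun t => (hXm t).mono (drivingSigma_le hF hM hX₀ t) le_rfl, ?_, ?_⟩, hXm⟩,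
    ?_, hmoment⟩, fun _ _ _ _ hX hY => hM.pathwise_unique hαp hX hY⟩
  · intro t
    simp
  · exact hX.mono fun ω hω t _ => (hω t).1
  · exact hX.mono fun ω hω t _ => (hω t).2.1
  · exact hX.mono fun ω hω t => (hω t).2.2
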